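/- **Lemma 4.2.** Let $d\ge 1$. Let $\mathcal D=\{[j2^k,(j+1)2^k): j,k\in\mathbb Z\}$ be the dyadic intervals and $\mathcal R=\mathcal D^d$ the dyadic rectangles $R=R_{1}\times\cdots\times R_{d}$ of $\mathbb R^d$; write $c(I)$ for the center of an interval $I$. A differentiable function $\varphi:\mathbb R\to\mathbb C$ is *$(K,N)$-adapted* to an interval $I$ if $\|\varphi\|_2\le 1$ and $$|D^n\varphi(x)|\le K|I|^{-n-\frac12}\Bigl(1+\frac{|x-c(I)|}{|I|}\Bigr)^{-N},\qquad x\in\mathbb R,\ n=0,1 .$$ A function on $\mathbb R^d$ is *$(K,N)$-adapted* to $R=R_{1}\times\cdots\times R_{d}$ if it is a product $\prod_{j=1}^d\varphi_j(x_j)$ with each $\varphi_j$ $(K,N)$-adapted to $R_{j}$ (the factors may depend on all of $R$). A family $\{\varphi_R: R\in\mathcal R\}$ *has zeros in every coordinate* if $\int_{\mathbb R}\varphi_R(x_1,\dots,x_d)\,dx_j=0$ for all $R$, all $1\le j\le d$ and all values of $x_k$, $k\ne j$. Put $\langle f,\varphi\rangle=\int f\,\overline{\varphi}\,dx$ and let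 $$\mathrm{S\cdots S}f=\Bigl[\sum_{R\in\mathcal R}\frac{|\langle f,\varphi_R\rangle|^2}{|R|}\mathbf 1_R\Bigr]^{1/2}$$ be the $d$-parameter square function. For $f\in L^1(\mathbb R^d)$ let $\|f\|_{H^1}=\|f\|_1+\|\mathrm Sf\|_1$, where $\mathrm Sf$ is the same expression with $\varphi_R$ replaced by the product Haar functions $h_R(x)=\prod_j h_{R_j}(x_j)$, $h_I=|I|^{-1/2}(\mathbf 1_{I_-}-\mathbf 1_{I_+})$, with $I_-$, $I_+$ the left and right halves of $I$; $H^1$ is the space of those $f\in L^1$ with $\|f\|_{H^1}<\infty$ (dyadic product Hardy space). There is an integer $N\ge 2$ depending only on $d$ such that for every $K$ and every $1<p<\infty$ there are constants $C_p=C(d,K,p)$, and $C=C(d,K)$, so that for every family $\{\varphi_R : R\in\mathcal R\}$ with each $\varphi_R$ $(K,N)$-adapted to $R$ and with zeros in every coordinate, $$\|\mathrm{S\cdots S}f\|_p\le C_p\|f\|_p\quad(f\in L^p(\mathbb R^d)),$$ $$\|\mathrm{S\cdots S}f\|_1\le C\|f\|_{H^1}\quad(f\in H^1),$$ $$\sup_U|U|^{-1}\sum_{R\in\mathcal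 R,\ R\subset U}|\langle f,\varphi_R\rangle|^2\le C\|f\|_\infty^2\quad(f\in L^\infty(\mathbb R^d)),$$ where the supremum is over all subsets $U\subset\mathbb R^d$ of finite (outer) measure; for $|U|=0$ the sum is empty and the quotient is read as $0$. -/

import Mathlib

open MeasureTheory
open scoped ENNReal NNReal

namespace MultiParam

/-- Dyadic intervals, indexed without repetition: `(k, j)` stands for `[j 2^k, (j+1) 2^k)`. -/
abbrev DyadicInterval : Type := ℤ × ℤ

namespace DyadicInterval

/-- The length `2^k`. -/
noncomputable def length (I : DyadicInterval) : ℝ := (2 : ℝ) ^ I.1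

/-- The interval `[j 2^k, (j+1) 2^k)`. -/
def toSet (I : DyadicInterval) : Set ℝ :=
  Set.Ico ((I.2 : ℝ) * length I) (((I.2 : ℝ) + 1) * length I)

/-- The center `c(I)`. -/
noncomputable def center (I : DyadicInterval) : ℝ := ((I.2 : ℝ) + 1 / 2) * length I

/-- The left half of `I`, again dyadic. -/
def left (I : DyadicInterval) : DyadicInterval := (I.1 - 1, 2 * I.2)

/-- The right half of `I`, again dyadic. -/
def right (I : DyadicInterval) : DyadicInterval := (I.1 - 1, 2 * I.2 + 1)

/-- The Haar function `|I|^{-1/2} (1_{left half} - 1_{right half})`. -/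
noncomputable def haar (I : DyadicInterval) (x : ℝ) : ℂ :=
  (((length I) ^ (-(1 / 2) : ℝ) *
    ((left I).toSet.indicator (fun _ => (1 : ℝ)) x
      - (right I).toSet.indicator (fun _ => (1 : ℝ)) x) : ℝ) : ℂ)

end DyadicInterval

/-- `φ : ℝ → ℂ` is `(K, N)`-adapted to the interval `I`: its `L²` norm is at most one, and
`|Dⁿ φ(x)| ≤ K |I|^{-n-1/2} (1 + |x - c(I)| / |I|)^{-N}` for `n = 0, 1`. -/
structure IsAdapted (K : ℝ) (N : ℕ) (I : DyadicInterval) (φ : ℝ → ℂ) : Prop where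
  differentiable : Differentiable ℝ φ
  norm_two_le : eLpNorm φ 2 volume ≤ 1
  size : ∀ x, ‖φ x‖ ≤ K * I.length ^ (-(1 / 2) : ℝ) *
    ((1 + |x - I.center| / I.length) ^ N)⁻¹
  size_deriv : ∀ x, ‖deriv φ x‖ ≤ K * I.length ^ (-1 - 1 / 2 : ℝ) *
    ((1 + |x - I.center| / I.length) ^ N)⁻¹

/-- Dyadic rectangles in `ℝ^d`, given by their `d` sides. -/
abbrev DyadicRect (d : ℕ) : Type := Fin d → DyadicInterval

namespace DyadicRect

/-- The rectangle `R = R_1 × ⋯ × R_d` as a subset of `ℝ^d`. -/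
def toSet {d : ℕ} (R : DyadicRect d) : Set (Fin d → ℝ) :=
  Set.univ.pi fun i => (R i).toSet

/-- The product Haar function `h_R(x) = ∏ h_{R_i}(x_i)`. -/
noncomputable def haar {d : ℕ} (R : DyadicRect d) (x : Fin d → ℝ) : ℂ :=
  ∏ i, (R i).haar (x i)

end DyadicRect

/-- A function is `(K, N)`-adapted to a rectangle if it is a product of functions of one variable
that are `(K, N)`-adapted to the sides. The factors may depend on the whole rectangle. -/
def IsAdaptedRect {d : ℕ} (K : ℝ) (N : ℕ) (R : DyadicRect d) (φ : (Fin d → ℝ) → ℂ) : Prop :=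
  ∃ g : Fin d → ℝ → ℂ, (∀ i, IsAdapted K N (R i) (g i)) ∧ ∀ x, φ x = ∏ i, g i (x i)

/-- `φ` has a zero in the `j`th coordinate: `∫ φ(x_1, …, x_d) dx_j = 0` for all values of the
other coordinates. -/
def HasZero {d : ℕ} (j : Fin d) (φ : (Fin d → ℝ) → ℂ) : Prop :=
  ∀ x : Fin d → ℝ, ∫ t : ℝ, φ (Function.update x j t) = 0

/-- The pairing `⟨f, φ⟩ = ∫ f φ̄`. -/
noncomputable def pairing {d : ℕ} (f φ : (Fin d → ℝ) → ℂ) : ℂ :=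
  ∫ x, f x * (starRingEnd ℂ) (φ x)

/-- The `d`-parameter square function `S⋯S` formed over the family `φ`, with values in `[0, ∞]`:
`(∑_R |⟨f, φ_R⟩|² / |R| · 1_R(x))^{1/2}`. -/
noncomputable def squareFunction {d : ℕ} (φ : DyadicRect d → (Fin d → ℝ) → ℂ)
    (f : (Fin d → ℝ) → ℂ) (x : Fin d → ℝ) : ℝ≥0∞ :=
  (∑' R : DyadicRect d,
    R.toSet.indicator (fun _ => ‖pairing f (φ R)‖ₑ ^ 2 / volume R.toSet) x) ^ (1 / 2 : ℝ)

/-- The (dyadic) product Hardy norm `‖f‖_1 + ‖S f‖_1`, with `S` the square function formed over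
the product Haar basis. -/
noncomputable def hardyNorm {d : ℕ} (f : (Fin d → ℝ) → ℂ) : ℝ≥0∞ :=
  eLpNorm f 1 volume + eLpNorm (squareFunction DyadicRect.haar f) 1 volume

/-- The Carleson quantity `sup_U |U|^{-1} ∑_{R ⊆ U} |⟨f, φ_R⟩|²`, the supremum over all subsets
`U` of `ℝ^d` of finite (outer) measure. For a null set `U` the sum is empty. -/
noncomputable def carlesonSup {d : ℕ} (φ : DyadicRect d → (Fin d → ℝ) → ℂ)
    (f : (Fin d → ℝ) → ℂ) : ℝ≥0∞ :=
  ⨆ (U : Set (Fin d → ℝ)) (_ : volume U < ∞),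
    (volume U)⁻¹ * ∑' R : {R : DyadicRect d // R.toSet ⊆ U}, ‖pairing f (φ R.1)‖ₑ ^ 2

end MultiParam

/-! The family is compared with the Haar system. If a product $\varphi_R$ does not vanish
identically, its zero in the $j$th coordinate forces its $j$th factor to have mean zero. A dyadic
partition of unity around each side then writes each factor as a sum over $m\ge 0$ of Lipschitz
functions of mean zero, supported in the $2^{m+1}$-dilate of the side and of size $O(2^{-20m})$
(`exists_local_atoms`). It therefore suffices to bound products of such atoms of a fixed multi-order
$m$ with summable decay in $m$, and to add up by Minkowski's inequality.

The Haar coefficient of an atom on $I$ against $h_{I'}$ vanishes unless $I'$ is short and close to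
$I$, or long with a jump of $h_{I'}$ close to $I$: otherwise either the supports are disjoint or
$h_{I'}$ is constant where the atom lives. The remaining coefficients decay in the difference of
scales (`enorm_coef_le_nearKernel`). Hence the numbers $|\langle f,\psi_R\rangle|$ are dominated by
a product matrix applied to $|\langle f,h_{R'}\rangle|$. Split by differences of scales, each piece
satisfies Schur's test and moves a coefficient only to rectangles inside a controlled dilate of the
original one, so it is bounded on $\ell^2$ and, by Cauchy-Schwarz on the enlarged support, from
localized $\ell^2$ to $L^1$ of the square function (`isAtomicallyBounded_prod`). The decay in the
scales pays for the enlargement.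

A Chang-Fefferman decomposition sorts the rectangles by the level at which the square function of
the coefficients stops covering half of them (`exists_level_decomposition`). Summing the localized
bounds over the levels gives $H^1\to L^1$, and interpolating them by hand gives $L^p$ for $1<p<2$ in
terms of the Haar square function. The latter is bounded on $L^p$, $1<p\le 2$: on the line by a
stopping-time energy estimate for $\ell^2$-valued functions, and on $\mathbb R^d$ by iterating it
one coordinate at a time.

Rectangles in a set $S$ see $f$ only on the union of the supports of their atoms, whose measure
exceeds that of $\bigcup S$ by at most $\prod 4\cdot 2^{m_i}$. The resulting localized $\ell^2$
bound (`exists_localized_l2_le`) is the Carleson estimate for bounded $f$. It also gives $p>2$: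
$\int G^p=\int G^2G^{p-2}$ becomes a sum weighted by averages of $G^{p-2}$, which is controlled by
$\int|f|^2v$ with $v$ a strong maximal function of $G^{p-2}$, and Hölder's inequality permits
absorption of $\int G^p$. -/

namespace MultiParam

/-! ### Geometric sums over the dyadic scales -/

/-- The constant `∑ 2^{-ns}` of the geometric series. -/
noncomputable def geomConst (s : ℝ) : ℝ≥0∞ := ∑' n : ℕ, ((2 : ℝ≥0∞) ^ (-s)) ^ n

theorem geomConst_lt_top {s : ℝ} (hs : 0 < s) : geomConst s < ∞ := by
  unfold geomConst
  rw [ENNReal.tsum_geometric]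
  have h : (2 : ℝ≥0∞) ^ (-s) < 1 := ENNReal.rpow_lt_one_of_one_lt_of_neg (by norm_num) (by linarith)
  rw [ENNReal.inv_lt_top]
  exact tsub_pos_of_lt h

theorem one_le_geomConst (s : ℝ) : 1 ≤ geomConst s := by
  unfold geomConst
  calc (1 : ℝ≥0∞) = ((2 : ℝ≥0∞) ^ (-s)) ^ 0 := by simp
    _ ≤ _ := ENNReal.le_tsum 0

theorem two_zpow_rpow (j : ℤ) (s : ℝ) : ((2 : ℝ≥0∞) ^ j) ^ s = 2 ^ ((j : ℝ) * s) := by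
  rw [← ENNReal.rpow_intCast, ← ENNReal.rpow_mul]

theorem two_rpow_add (a b : ℝ) : (2 : ℝ≥0∞) ^ (a + b) = 2 ^ a * 2 ^ b :=
  ENNReal.rpow_add _ _ two_ne_zero ENNReal.ofNat_ne_top

theorem two_zpow_ne_zero (j : ℤ) : (2 : ℝ≥0∞) ^ j ≠ 0 :=
  (ENNReal.zpow_pos two_ne_zero ENNReal.ofNat_ne_top j).ne'

theorem two_zpow_ne_top (j : ℤ) : (2 : ℝ≥0∞) ^ j ≠ ∞ :=
  (ENNReal.zpow_lt_top two_ne_zero ENNReal.ofNat_ne_top j).ne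

theorem tsum_two_zpow_le (n : ℤ) (s : ℝ) :
    ∑' j : ℤ, (if j ≤ n then ((2 : ℝ≥0∞) ^ j) ^ s else 0) = geomConst s * ((2 : ℝ≥0∞) ^ n) ^ s := by
  have hinj : Function.Injective (fun i : ℕ => n - (i : ℤ)) := fun a b h => by simpa using h
  rw [← hinj.tsum_eq]
  · unfold geomConst
    rw [mul_comm, ← ENNReal.tsum_mul_left]
    refine tsum_congr fun i => ?_
    rw [if_pos (by omega), two_zpow_rpow, two_zpow_rpow, ← ENNReal.rpow_natCast,
      ← ENNReal.rpow_mul, ← two_rpow_add]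
    congr 1
    push_cast
    ring
  · intro j hj
    have : j ≤ n := by
      by_contra h
      simp [h] at hj
    exact ⟨(n - j).toNat, by simp; omega⟩

theorem tsum_two_zpow_ge (n : ℤ) (s : ℝ) :
    ∑' j : ℤ, (if n ≤ j then ((2 : ℝ≥0∞) ^ j) ^ (-s) else 0)
      = geomConst s * ((2 : ℝ≥0∞) ^ n) ^ (-s) := by
  have hinj : Function.Injective (fun i : ℕ => n + (i : ℤ)) := fun a b h => by simpa using h
  rw [← hinj.tsum_eq]
  · unfold geomConst
    rw [mul_comm, ← ENNReal.tsum_mul_left]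
    refine tsum_congr fun i => ?_
    rw [if_pos (by omega), two_zpow_rpow, two_zpow_rpow, ← ENNReal.rpow_natCast,
      ← ENNReal.rpow_mul, ← two_rpow_add]
    congr 1
    push_cast
    ring
  · intro j hj
    have : n ≤ j := by
      by_contra h
      simp [h] at hj
    exact ⟨(j - n).toNat, by simp; omega⟩

/-- A geometric series is comparable with its largest term, here at most `a ^ s`. -/
theorem tsum_layer_le {s : ℝ} (hs : 0 < s) (a : ℝ≥0∞) :
    ∑' j : ℤ, (if (2 : ℝ≥0∞) ^ j < a then ((2 : ℝ≥0∞) ^ j) ^ s else 0) ≤ geomConst s * a ^ s := by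
  rcases eq_or_ne a 0 with rfl | h0
  · simp
  rcases eq_or_ne a ∞ with rfl | ht
  · rw [ENNReal.top_rpow_of_pos hs, ENNReal.mul_top]
    · exact le_top
    · exact (lt_of_lt_of_le zero_lt_one (one_le_geomConst s)).ne'
  obtain ⟨n, hn1, hn2⟩ := ENNReal.exists_mem_Ioc_zpow h0 ht (y := 2) (by norm_num) (by norm_num)
  calc _ ≤ ∑' j : ℤ, (if j ≤ n then ((2 : ℝ≥0∞) ^ j) ^ s else 0) := by
        refine ENNReal.tsum_le_tsum fun j => ?_
        split_ifs with h1 h2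
        · exact le_rfl
        · exfalso
          have : (2 : ℝ≥0∞) ^ (n + 1) ≤ 2 ^ j := ENNReal.zpow_le_of_le (by norm_num) (by omega)
          exact absurd (h1.trans_le (hn2.trans this)) (lt_irrefl _)
        · exact zero_le
        · exact le_rfl
    _ = geomConst s * ((2 : ℝ≥0∞) ^ n) ^ s := tsum_two_zpow_le n s
    _ ≤ _ := by gcongr

/-- Some power of two below `a` is at least `a / 2`, whence the factor `2 ^ s`; for `a = ∞`
arbitrarily large powers take its place. With `tsum_layer_le` this replaces the layer-cake formula
by sums over dyadic heights. -/
theorem le_tsum_layer {s : ℝ} (hs : 0 < s) (a : ℝ≥0∞) :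
    a ^ s ≤ 2 ^ s * ∑' j : ℤ, (if (2 : ℝ≥0∞) ^ j < a then ((2 : ℝ≥0∞) ^ j) ^ s else 0) := by
  rcases eq_or_ne a 0 with rfl | h0
  · simp [hs]
  have key : ∀ n : ℤ, (2 : ℝ≥0∞) ^ n < a → ((2 : ℝ≥0∞) ^ (n + 1)) ^ s ≤
      2 ^ s * ∑' j : ℤ, (if (2 : ℝ≥0∞) ^ j < a then ((2 : ℝ≥0∞) ^ j) ^ s else 0) := by
    intro n hn
    calc ((2 : ℝ≥0∞) ^ (n + 1)) ^ s = 2 ^ s * ((2 : ℝ≥0∞) ^ n) ^ s := by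
          rw [two_zpow_rpow, two_zpow_rpow, ← two_rpow_add]; congr 1; push_cast; ring
      _ ≤ _ := by
          gcongr
          refine le_trans (le_of_eq ?_) (ENNReal.le_tsum n)
          rw [if_pos hn]
  rcases eq_or_ne a ∞ with rfl | ht
  · refine le_of_forall_lt fun b hb => ?_
    rw [ENNReal.top_rpow_of_pos hs] at hb
    rcases eq_or_ne b 0 with rfl | hb0
    · refine lt_of_lt_of_le ?_ (key 0 (by simp))
      exact ENNReal.rpow_pos (by simp) (two_zpow_ne_top _)
    obtain ⟨n, hn1, hn2⟩ := ENNReal.exists_mem_Ioc_zpow (x := b ^ (1 / s)) (y := 2)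
      (by simp [hb0, hb.ne]) (ENNReal.rpow_ne_top_of_nonneg (by positivity) hb.ne)
      (by norm_num) (by norm_num)
    refine lt_of_lt_of_le ?_ (key (n + 1) (two_zpow_ne_top _).lt_top)
    calc b = (b ^ (1 / s)) ^ s := by rw [← ENNReal.rpow_mul]; field_simp; simp
      _ ≤ ((2 : ℝ≥0∞) ^ (n + 1)) ^ s := by gcongr
      _ < _ := by
        refine ENNReal.rpow_lt_rpow ?_ hs
        rw [ENNReal.zpow_add two_ne_zero ENNReal.ofNat_ne_top (n + 1) 1]
        conv_lhs => rw [← mul_one ((2 : ℝ≥0∞) ^ (n + 1))]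
        exact ENNReal.mul_lt_mul_right (two_zpow_ne_zero _) (two_zpow_ne_top _) (by simp)
  obtain ⟨n, hn1, hn2⟩ := ENNReal.exists_mem_Ioc_zpow h0 ht (y := 2) (by norm_num) (by norm_num)
  exact le_trans (by gcongr) (key n hn1)

theorem lintegral_rpow_le_tsum_layer {α : Type*} [MeasurableSpace α] {μ : Measure α} {F : α → ℝ≥0∞}
    (hF : Measurable F) {s : ℝ} (hs : 0 < s) :
    ∫⁻ x, F x ^ s ∂μ ≤ 2 ^ s * ∑' j : ℤ, ((2 : ℝ≥0∞) ^ j) ^ s * μ {x | (2 : ℝ≥0∞) ^ j < F x} := by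
  calc ∫⁻ x, F x ^ s ∂μ
      ≤ ∫⁻ x, 2 ^ s * ∑' j : ℤ, (if (2 : ℝ≥0∞) ^ j < F x then ((2 : ℝ≥0∞) ^ j) ^ s else 0) ∂μ :=
        lintegral_mono fun x => le_tsum_layer hs (F x)
    _ = 2 ^ s * ∑' j : ℤ, ∫⁻ x, (if (2 : ℝ≥0∞) ^ j < F x then ((2 : ℝ≥0∞) ^ j) ^ s else 0) ∂μ := by
        rw [lintegral_const_mul', lintegral_tsum]
        · intro j
          exact (Measurable.ite (measurableSet_lt measurable_const hF) measurable_const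
            measurable_const).aemeasurable
        · exact ENNReal.rpow_ne_top_of_nonneg hs.le (by norm_num)
    _ = _ := by
        congr 1
        refine tsum_congr fun j => ?_
        rw [← lintegral_indicator_const (measurableSet_lt measurable_const hF)]
        simp only [Set.indicator_apply, Set.mem_ofPred_eq]

theorem tsum_layer_le_lintegral_rpow {α : Type*} [MeasurableSpace α] {μ : Measure α}
    {F : α → ℝ≥0∞} (hF : Measurable F) {s : ℝ} (hs : 0 < s) :
    ∑' j : ℤ, ((2 : ℝ≥0∞) ^ j) ^ s * μ {x | (2 : ℝ≥0∞) ^ j < F x}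
      ≤ geomConst s * ∫⁻ x, F x ^ s ∂μ := by
  calc _ = ∑' j : ℤ, ∫⁻ x, (if (2 : ℝ≥0∞) ^ j < F x then ((2 : ℝ≥0∞) ^ j) ^ s else 0) ∂μ := by
        refine tsum_congr fun j => ?_
        rw [← lintegral_indicator_const (measurableSet_lt measurable_const hF)]
        simp only [Set.indicator_apply, Set.mem_ofPred_eq]
    _ = ∫⁻ x, ∑' j : ℤ, (if (2 : ℝ≥0∞) ^ j < F x then ((2 : ℝ≥0∞) ^ j) ^ s else 0) ∂μ := by
        rw [lintegral_tsum]
        intro j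
        exact (Measurable.ite (measurableSet_lt measurable_const hF) measurable_const
            measurable_const).aemeasurable
    _ ≤ ∫⁻ x, geomConst s * F x ^ s ∂μ := lintegral_mono fun x => tsum_layer_le hs (F x)
    _ = _ := lintegral_const_mul' _ _ (geomConst_lt_top hs).ne

/-! ### Dyadic intervals -/

namespace DyadicInterval

theorem length_pos (I : DyadicInterval) : 0 < I.length := by unfold length; positivity

theorem mem_toSet {I : DyadicInterval} {x : ℝ} :
    x ∈ I.toSet ↔ (I.2 : ℝ) * I.length ≤ x ∧ x < ((I.2 : ℝ) + 1) * I.length := Iff.rfl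

/-- The dyadic interval of length `2^k` that contains `x`. -/
noncomputable def atScale (k : ℤ) (x : ℝ) : DyadicInterval := (k, ⌊x / 2 ^ k⌋)

theorem mem_toSet_iff_floor {I : DyadicInterval} {x : ℝ} :
    x ∈ I.toSet ↔ ⌊x / I.length⌋ = I.2 := by
  rw [mem_toSet, Int.floor_eq_iff, le_div_iff₀ I.length_pos, div_lt_iff₀ I.length_pos]

theorem mem_toSet_iff {I : DyadicInterval} {x : ℝ} : x ∈ I.toSet ↔ atScale I.1 x = I := by
  rw [mem_toSet_iff_floor]
  unfold atScale
  rw [Prod.ext_iff]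
  simp [length]

theorem mem_atScale (k : ℤ) (x : ℝ) : x ∈ (atScale k x).toSet := mem_toSet_iff.2 rfl

theorem eq_of_mem_of_mem {I J : DyadicInterval} {x : ℝ} (h : I.1 = J.1) (hI : x ∈ I.toSet)
    (hJ : x ∈ J.toSet) : I = J := by
  rw [mem_toSet_iff] at hI hJ
  rw [← hI, ← hJ, h]

theorem length_eq_mul {I J : DyadicInterval} (h : J.1 ≤ I.1) :
    I.length = (2 ^ (I.1 - J.1).toNat : ℕ) * J.length := by
  unfold length
  push_cast
  rw [← zpow_natCast, ← zpow_add₀ two_ne_zero]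
  congr 1
  omega

theorem toSet_subset_of_mem {I J : DyadicInterval} {x : ℝ} (h : J.1 ≤ I.1) (hI : x ∈ I.toSet)
    (hJ : x ∈ J.toSet) : J.toSet ⊆ I.toSet := by
  have hl := length_eq_mul h
  set n := 2 ^ (I.1 - J.1).toNat with hn
  have hp := J.length_pos
  rw [mem_toSet] at hI hJ
  rw [hl] at hI
  have h1 : I.2 * (n : ℤ) ≤ J.2 := by
    have : ((I.2 * (n : ℤ) : ℤ) : ℝ) < ((J.2 + 1 : ℤ) : ℝ) := by
      push_cast
      have : (I.2 : ℝ) * n * J.length < (J.2 + 1) * J.length := by linarith [hI.1, hJ.2]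
      exact lt_of_mul_lt_mul_right this hp.le
    have := Int.cast_lt.1 this
    omega
  have h2 : J.2 + 1 ≤ (I.2 + 1) * (n : ℤ) := by
    have : ((J.2 : ℤ) : ℝ) < (((I.2 + 1) * (n : ℤ) : ℤ) : ℝ) := by
      push_cast
      have : (J.2 : ℝ) * J.length < (I.2 + 1) * n * J.length := by linarith [hI.2, hJ.1]
      exact lt_of_mul_lt_mul_right this hp.le
    have := Int.cast_lt.1 this
    omega
  have h1' : (I.2 : ℝ) * n ≤ J.2 := by exact_mod_cast h1
  have h2' : (J.2 : ℝ) + 1 ≤ (I.2 + 1) * n := by exact_mod_cast h2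
  intro y hy
  rw [mem_toSet] at hy ⊢
  rw [hl]
  constructor
  · nlinarith [hy.1]
  · nlinarith [hy.2]

theorem measurableSet_toSet (I : DyadicInterval) : MeasurableSet I.toSet := measurableSet_Ico

theorem volume_toSet (I : DyadicInterval) : volume I.toSet = ENNReal.ofReal I.length := by
  unfold toSet
  rw [Real.volume_Ico]
  congr 1
  ring

theorem volume_toSet_ne_zero (I : DyadicInterval) : volume I.toSet ≠ 0 := by
  rw [volume_toSet]; simpa using I.length_pos

theorem volume_toSet_ne_top (I : DyadicInterval) : volume I.toSet ≠ ∞ := by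
  rw [volume_toSet]; simp

/-- The concentric closed interval of radius `r |I|`. -/
def dil (r : ℝ) (I : DyadicInterval) : Set ℝ := Metric.closedBall I.center (r * I.length)

theorem measurableSet_dil (r : ℝ) (I : DyadicInterval) : MeasurableSet (dil r I) :=
  Metric.isClosed_closedBall.measurableSet

theorem mem_dil {r : ℝ} {I : DyadicInterval} {x : ℝ} :
    x ∈ dil r I ↔ |x - I.center| ≤ r * I.length := by
  rw [dil, Metric.mem_closedBall, Real.dist_eq]

theorem volume_dil {r : ℝ} (hr : 0 ≤ r) (I : DyadicInterval) :
    volume (dil r I) = ENNReal.ofReal (2 * r) * volume I.toSet := by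
  rw [dil, Real.volume_closedBall, volume_toSet, ← ENNReal.ofReal_mul (by positivity)]
  congr 1
  ring

theorem toSet_subset_dil {r : ℝ} (hr : 1 / 2 ≤ r) (I : DyadicInterval) : I.toSet ⊆ dil r I := by
  intro x hx
  have := I.length_pos
  rw [mem_toSet] at hx
  rw [mem_dil, abs_le, center]
  constructor <;> nlinarith

theorem dil_subset_dil {r : ℝ} (hr : 1 / 2 ≤ r) {I J : DyadicInterval} (h : I.toSet ⊆ J.toSet) :
    dil r I ⊆ dil r J := by
  have hI := I.length_pos
  have hJ := J.length_pos
  unfold toSet at h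
  rw [Set.Ico_subset_Ico_iff (by nlinarith)] at h
  intro x hx
  rw [mem_dil, abs_le, center] at hx ⊢
  have hlen : I.length ≤ J.length := by nlinarith
  have : (r - 1 / 2) * I.length ≤ (r - 1 / 2) * J.length := by gcongr
  constructor <;> nlinarith

/-- Dyadic intervals are nested or disjoint, so the maximal members of a finite collection are
disjoint and cover all others. -/
theorem exists_disjoint_cover (G : Finset DyadicInterval) :
    ∃ G' ⊆ G, ((G' : Set DyadicInterval).PairwiseDisjoint toSet) ∧
      ∀ I ∈ G, ∃ J ∈ G', I.toSet ⊆ J.toSet := by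
  classical
  refine ⟨G.filter fun J => ∀ I ∈ G, J.toSet ⊆ I.toSet → I.1 ≤ J.1, Finset.filter_subset _ _,
    ?_, ?_⟩
  · intro I hI J hJ hne
    simp only [Finset.coe_filter, Set.mem_ofPred_eq] at hI hJ
    rw [Function.onFun, Set.disjoint_left]
    intro x hxI hxJ
    apply hne
    rcases le_total I.1 J.1 with h | h
    · exact eq_of_mem_of_mem (le_antisymm h (hI.2 J hJ.1 (toSet_subset_of_mem h hxJ hxI))) hxI hxJ
    · exact eq_of_mem_of_mem (le_antisymm (hJ.2 I hI.1 (toSet_subset_of_mem h hxI hxJ)) h) hxI hxJ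
  · intro I hI
    obtain ⟨J, hJ, hmax⟩ := Finset.exists_max_image (G.filter fun J => I.toSet ⊆ J.toSet)
      (fun J => J.1) ⟨I, by simp [hI]⟩
    simp only [Finset.mem_filter] at hJ hmax
    refine ⟨J, ?_, hJ.2⟩
    simp only [Finset.mem_filter]
    exact ⟨hJ.1, fun L hL hJL => hmax L ⟨hL, hJ.2.trans hJL⟩⟩

/-- Only the maximal intervals matter, since the dilate of a subinterval lies in the dilate of the
larger interval. The density `u` lets one argument serve both the measure of dilates (`u = 1`) and
the weak-type bound for the maximal function. -/
theorem volume_biUnion_dil_le {r : ℝ} (hr : 1 / 2 ≤ r) (G : Finset DyadicInterval)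
    (u : ℝ → ℝ≥0∞) (hG : ∀ I ∈ G, volume I.toSet ≤ ∫⁻ t in I.toSet, u t) :
    volume (⋃ I ∈ G, dil r I) ≤ ENNReal.ofReal (2 * r) * ∫⁻ t in ⋃ I ∈ G, I.toSet, u t := by
  obtain ⟨G', hsub, hdis, hcov⟩ := exists_disjoint_cover G
  calc volume (⋃ I ∈ G, dil r I) ≤ volume (⋃ I ∈ G', dil r I) := by
        refine measure_mono ?_
        simp only [Set.iUnion_subset_iff]
        intro I hI
        obtain ⟨J, hJ, hIJ⟩ := hcov I hI
        exact (dil_subset_dil hr hIJ).trans (Set.subset_biUnion_of_mem (u := fun J => dil r J) hJ)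
    _ ≤ ∑ I ∈ G', volume (dil r I) := measure_biUnion_finset_le _ _
    _ ≤ ∑ I ∈ G', ENNReal.ofReal (2 * r) * ∫⁻ t in I.toSet, u t := by
        refine Finset.sum_le_sum fun I hI => ?_
        rw [volume_dil (by linarith)]
        gcongr
        exact hG I (hsub hI)
    _ = ENNReal.ofReal (2 * r) * ∫⁻ t in ⋃ I ∈ G', I.toSet, u t := by
        rw [← Finset.mul_sum, lintegral_biUnion_finset hdis fun I _ => I.measurableSet_toSet]
    _ ≤ _ := by
        exact mul_le_mul' le_rfl (lintegral_mono_set (Set.biUnion_subset_biUnion_left hsub))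

end DyadicInterval

/-! ### Fibrewise estimates -/

theorem lintegral_le_mul_of_fiber {d : ℕ} (i : Fin d) {f g : (Fin d → ℝ) → ℝ≥0∞}
    (hf : Measurable f) (hg : Measurable g) (C : ℝ≥0∞)
    (h : ∀ x, ∫⁻ t, f (Function.update x i t) ≤ C * ∫⁻ t, g (Function.update x i t)) :
    ∫⁻ x, f x ≤ C * ∫⁻ x, g x := by
  rw [← lintegral_const_mul _ hg]
  refine lintegral_le_of_lmarginal_le (μ := fun _ => volume) {i} hf (hg.const_mul C) ?_
  rw [lmarginal_singleton, lmarginal_singleton]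
  intro x
  dsimp only
  rw [lintegral_const_mul C (f := fun t => g (Function.update x i t))
    (hg.comp (measurable_update x))]
  exact h x

theorem measure_biUnion_le_of_finset {α ι : Type*} [Countable ι] [MeasurableSpace α]
    {μ : Measure α} {S : Set ι} {A : ι → Set α} {C : ℝ≥0∞}
    (h : ∀ F : Finset ι, (F : Set ι) ⊆ S → μ (⋃ i ∈ F, A i) ≤ C) : μ (⋃ i ∈ S, A i) ≤ C := by
  classical
  have : (⋃ i ∈ S, A i) = ⋃ F : {F : Finset ι // (F : Set ι) ⊆ S}, ⋃ i ∈ F.1, A i := by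
    ext x
    simp only [Set.mem_iUnion, exists_prop, Subtype.exists]
    constructor
    · rintro ⟨i, hi, hx⟩
      exact ⟨{i}, by simpa using hi, i, by simp, hx⟩
    · rintro ⟨F, hF, i, hi, hx⟩
      exact ⟨i, hF hi, hx⟩
  rw [this, Directed.measure_iUnion]
  · exact iSup_le fun F => h F.1 F.2
  · intro F G
    refine ⟨⟨F.1 ∪ G.1, by simp [F.2, G.2]⟩, ?_, ?_⟩
    · exact Set.biUnion_subset_biUnion_left (by simp)
    · exact Set.biUnion_subset_biUnion_left (by simp)

/-! ### Dyadic rectangles and their dilates -/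

namespace DyadicRect

variable {d : ℕ}

/-- The rectangle with sides `dil (r i) (R i)`. -/
def dil (r : Fin d → ℝ) (R : DyadicRect d) : Set (Fin d → ℝ) :=
  Set.univ.pi fun i => (R i).dil (r i)

theorem measurableSet_toSet (R : DyadicRect d) : MeasurableSet R.toSet :=
  MeasurableSet.univ_pi fun i => (R i).measurableSet_toSet

theorem measurableSet_dil (r : Fin d → ℝ) (R : DyadicRect d) : MeasurableSet (R.dil r) :=
  MeasurableSet.univ_pi fun i => (R i).measurableSet_dil (r i)

theorem volume_toSet (R : DyadicRect d) : volume R.toSet = ∏ i, volume (R i).toSet := by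
  rw [toSet, volume_pi_pi]

theorem volume_toSet_ne_zero (R : DyadicRect d) : volume R.toSet ≠ 0 := by
  rw [volume_toSet]
  exact Finset.prod_ne_zero_iff.2 fun i _ => (R i).volume_toSet_ne_zero

theorem volume_toSet_ne_top (R : DyadicRect d) : volume R.toSet ≠ ∞ := by
  rw [volume_toSet]
  exact ENNReal.prod_ne_top fun i _ => (R i).volume_toSet_ne_top

theorem toSet_subset_dil {r : Fin d → ℝ} (hr : ∀ i, 1 / 2 ≤ r i) (R : DyadicRect d) :
    R.toSet ⊆ R.dil r :=
  Set.pi_mono fun i _ => (R i).toSet_subset_dil (hr i)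

/-- The sides are dilated one coordinate at a time. On each line in the new direction the claim is
the one-dimensional covering estimate, so the constant is a product of factors linear in the `r i`.
-/
theorem volume_biUnion_dil_le {r : Fin d → ℝ} (hr : ∀ i, 1 / 2 ≤ r i) (S : Set (DyadicRect d)) :
    volume (⋃ R ∈ S, R.dil r) ≤ (∏ i, ENNReal.ofReal (2 * r i)) * volume (⋃ R ∈ S, R.toSet) := by
  classical
  refine measure_biUnion_le_of_finset fun F hF => ?_
  -- `W s` is the union of the rectangles after only the sides with index in `s` have been dilated.
  let W : Finset (Fin d) → Set (Fin d → ℝ) := fun s =>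
    ⋃ R ∈ F, Set.univ.pi fun i => if i ∈ s then (R i).dil (r i) else (R i).toSet
  have hW : ∀ s, MeasurableSet (W s) := fun s =>
    Finset.measurableSet_biUnion _ fun R _ => MeasurableSet.univ_pi fun i => by
      split_ifs
      · exact (R i).measurableSet_dil _
      · exact (R i).measurableSet_toSet
  have key : ∀ s : Finset (Fin d),
      volume (W s) ≤ (∏ i ∈ s, ENNReal.ofReal (2 * r i)) * volume (W ∅) := by
    intro s
    induction s using Finset.induction_on with
    | empty => simp
    | insert i s hi ih =>
      rw [Finset.prod_insert hi, mul_assoc]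
      refine le_trans ?_ (mul_le_mul_right ih _)
      rw [← lintegral_indicator_one (hW _), ← lintegral_indicator_one (hW _)]
      refine lintegral_le_mul_of_fiber i (measurable_one.indicator (hW _))
        (measurable_one.indicator (hW _)) _ fun x => ?_
      -- The `i`th sides of those rectangles whose other sides, dilated or not according to `s`,
      -- contain the other coordinates of `x`. The slices of `W s` and `W (insert i s)` are the
      -- union of these intervals and the union of their dilates.
      let G : Finset DyadicInterval := (F.filter fun R => ∀ j, j ≠ i →
        x j ∈ if j ∈ s then (R j).dil (r j) else (R j).toSet).image fun R => R i
      have h1 : ∀ t, Function.update x i t ∈ W (insert i s) ↔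
          t ∈ ⋃ I ∈ G, I.dil (r i) := by
        intro t
        simp only [W, G, Set.mem_iUnion, Finset.mem_image, Finset.mem_filter, Set.mem_univ_pi,
          exists_prop]
        constructor
        · rintro ⟨R, hR, hx⟩
          refine ⟨R i, ⟨R, ⟨hR, fun j hj => ?_⟩, rfl⟩, ?_⟩
          · simpa [hj] using hx j
          · simpa using hx i
        · rintro ⟨I, ⟨R, ⟨hR, hx⟩, rfl⟩, ht⟩
          refine ⟨R, hR, fun j => ?_⟩
          by_cases hj : j = i
          · subst hj
            simpa using ht
          · simpa [hj] using hx j hj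
      have h2 : ∀ t, Function.update x i t ∈ W s ↔ t ∈ ⋃ I ∈ G, I.toSet := by
        intro t
        simp only [W, G, Set.mem_iUnion, Finset.mem_image, Finset.mem_filter, Set.mem_univ_pi,
          exists_prop]
        constructor
        · rintro ⟨R, hR, hx⟩
          refine ⟨R i, ⟨R, ⟨hR, fun j hj => ?_⟩, rfl⟩, ?_⟩
          · simpa [hj] using hx j
          · simpa [hi] using hx i
        · rintro ⟨I, ⟨R, ⟨hR, hx⟩, rfl⟩, ht⟩
          refine ⟨R, hR, fun j => ?_⟩
          by_cases hj : j = i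
          · subst hj
            simpa [hi] using ht
          · simpa [hj] using hx j hj
      have e1 : ∀ t, (W (insert i s)).indicator (1 : (Fin d → ℝ) → ℝ≥0∞) (Function.update x i t)
          = (⋃ I ∈ G, I.dil (r i)).indicator (1 : ℝ → ℝ≥0∞) t := fun t => by
        simp only [Set.indicator, h1, Pi.one_apply]
      have e2 : ∀ t, (W s).indicator (1 : (Fin d → ℝ) → ℝ≥0∞) (Function.update x i t)
          = (⋃ I ∈ G, I.toSet).indicator (1 : ℝ → ℝ≥0∞) t := fun t => by
        simp only [Set.indicator, h2, Pi.one_apply]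
      simp only [e1, e2]
      rw [lintegral_indicator_one
          (Finset.measurableSet_biUnion _ fun I _ => I.measurableSet_dil _),
        lintegral_indicator_one (Finset.measurableSet_biUnion _ fun I _ => I.measurableSet_toSet)]
      have := DyadicInterval.volume_biUnion_dil_le (hr i) G (fun _ => 1) (by simp)
      simpa using this
  have h0 : W ∅ = ⋃ R ∈ F, R.toSet := by simp [W, toSet]
  have h1 : W Finset.univ = ⋃ R ∈ F, R.dil r := by simp [W, dil]
  have := key Finset.univ
  rw [h0, h1] at this
  exact this.trans (mul_le_mul' le_rfl (measure_mono (Set.biUnion_subset_biUnion_left hF)))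

end DyadicRect

end MultiParam

namespace MultiParam

/-! ### The maximal function over dilated dyadic intervals -/

/-- The supremum of the averages of `u` over the dyadic intervals `I` with `x ∈ dil r I`. -/
noncomputable def maxFn (r : ℝ) (u : ℝ → ℝ≥0∞) (x : ℝ) : ℝ≥0∞ :=
  ⨆ I : DyadicInterval,
    (I.dil r).indicator (fun _ => (volume I.toSet)⁻¹ * ∫⁻ t in I.toSet, u t) x

theorem average_le_maxFn {r : ℝ} {I : DyadicInterval} {x : ℝ} (h : x ∈ I.dil r) (u : ℝ → ℝ≥0∞) :
    (volume I.toSet)⁻¹ * ∫⁻ t in I.toSet, u t ≤ maxFn r u x := by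
  refine le_trans (le_of_eq ?_) (le_iSup (fun I : DyadicInterval =>
    (I.dil r).indicator (fun _ => (volume I.toSet)⁻¹ * ∫⁻ t in I.toSet, u t) x) I)
  rw [Set.indicator_of_mem h]

theorem measurable_maxFn (r : ℝ) (u : ℝ → ℝ≥0∞) : Measurable (maxFn r u) :=
  Measurable.iSup fun I => measurable_const.indicator (I.measurableSet_dil r)

/-- The intervals with large average cover the level set by their dilates; each has measure at most
the integral of `u / t` over it, and the covering estimate applies. -/
theorem volume_lt_maxFn_le {r : ℝ} (hr : 1 / 2 ≤ r) (u : ℝ → ℝ≥0∞) {t : ℝ≥0∞} (h0 : t ≠ 0)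
    (ht : t ≠ ∞) : volume {x | t < maxFn r u x} ≤ ENNReal.ofReal (2 * r) * (t⁻¹ * ∫⁻ x, u x) := by
  have hset : {x | t < maxFn r u x} ⊆ ⋃ I ∈ {I : DyadicInterval |
      t < (volume I.toSet)⁻¹ * ∫⁻ t in I.toSet, u t}, I.dil r := by
    intro x hx
    have hx' : t < maxFn r u x := hx
    obtain ⟨I, hI⟩ := lt_iSup_iff.1 hx'
    by_cases hxI : x ∈ I.dil r
    · rw [Set.indicator_of_mem hxI] at hI
      exact Set.mem_biUnion (show I ∈ {I : DyadicInterval | _} from hI) hxI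
    · simp [Set.indicator_of_notMem hxI] at hI
  refine (measure_mono hset).trans (measure_biUnion_le_of_finset fun F hF => ?_)
  refine (DyadicInterval.volume_biUnion_dil_le hr F (fun x => t⁻¹ * u x) fun I hI => ?_).trans ?_
  · have h1' : t < (volume I.toSet)⁻¹ * ∫⁻ t in I.toSet, u t := hF hI
    have h1 := h1'.le
    rw [lintegral_const_mul' _ _ (ENNReal.inv_ne_top.2 h0), mul_comm, ← div_eq_mul_inv,
      ENNReal.le_div_iff_mul_le (Or.inl h0) (Or.inl ht), mul_comm]
    rwa [mul_comm, ← div_eq_mul_inv, ENNReal.le_div_iff_mul_le (Or.inl I.volume_toSet_ne_zero)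
      (Or.inl I.volume_toSet_ne_top)] at h1
  · rw [lintegral_const_mul' _ _ (ENNReal.inv_ne_top.2 h0)]
    exact mul_le_mul' le_rfl (mul_le_mul' le_rfl (setLIntegral_le_lintegral _ _))

theorem maxFn_le_add {u v : ℝ → ℝ≥0∞} {c : ℝ≥0∞} (h : ∀ t, u t ≤ v t + c) (r : ℝ) (x : ℝ) :
    maxFn r u x ≤ maxFn r v x + c := by
  refine iSup_le fun I => ?_
  by_cases hx : x ∈ I.dil r
  · rw [Set.indicator_of_mem hx]
    calc _ ≤ (volume I.toSet)⁻¹ * ∫⁻ t in I.toSet, (v t + c) := by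
          exact mul_le_mul' le_rfl (lintegral_mono fun t => h t)
      _ = (volume I.toSet)⁻¹ * (∫⁻ t in I.toSet, v t) + c := by
          rw [lintegral_add_right _ measurable_const, mul_add, setLIntegral_const, mul_comm c,
            ← mul_assoc, ENNReal.inv_mul_cancel I.volume_toSet_ne_zero I.volume_toSet_ne_top,
            one_mul]
      _ ≤ _ := add_le_add (average_le_maxFn hx v) le_rfl
  · simp [Set.indicator_of_notMem hx]

/-- The constant in the `L^q` inequality for the maximal function. -/
noncomputable def maxConst (q : ℝ) : ℝ≥0∞ := 2 ^ (2 * q) * geomConst (q - 1)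

theorem maxConst_lt_top {q : ℝ} (hq : 1 < q) : maxConst q < ∞ :=
  ENNReal.mul_lt_top (ENNReal.rpow_lt_top_of_nonneg (by linarith) (by norm_num))
    (geomConst_lt_top (by linarith))

/-- Marcinkiewicz interpolation between weak type (1,1) and the trivial sup bound, keeping the
constant linear in `r`. -/
theorem lintegral_maxFn_rpow_le {r : ℝ} (hr : 1 / 2 ≤ r) {q : ℝ} (hq : 1 < q) {u : ℝ → ℝ≥0∞}
    (hu : Measurable u) :
    ∫⁻ x, maxFn r u x ^ q ≤ ENNReal.ofReal (2 * r) * maxConst q * ∫⁻ x, u x ^ q := by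
  have hq0 : 0 < q := by linarith
  -- Discarding the values of `u` up to `2 ^ j` lowers the maximal function by at most `2 ^ j`, so
  -- the weak-type bound need only be applied to the large part of `u`.
  have hlev : ∀ j : ℤ, volume {x | (2 : ℝ≥0∞) ^ (j + 1) < maxFn r u x} ≤
      ENNReal.ofReal (2 * r) * (((2 : ℝ≥0∞) ^ j)⁻¹ * ∫⁻ x, if 2 ^ j < u x then u x else 0) := by
    intro j
    refine (measure_mono ?_).trans
      (volume_lt_maxFn_le hr _ (two_zpow_ne_zero j) (two_zpow_ne_top j))
    intro x hx
    have h1 := maxFn_le_add (u := u) (v := fun x => if 2 ^ j < u x then u x else 0)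
      (c := 2 ^ j) (fun t => by
        split_ifs with h
        · exact le_self_add
        · simpa using h) r x
    have h2 := lt_of_lt_of_le hx h1
    rw [ENNReal.zpow_add two_ne_zero ENNReal.ofNat_ne_top, zpow_one, mul_two] at h2
    by_contra h3
    simp only [Set.mem_ofPred_eq, not_lt] at h3
    exact absurd h2 (not_lt.2 (by gcongr))
  calc ∫⁻ x, maxFn r u x ^ q
      ≤ 2 ^ q * ∑' j : ℤ, ((2 : ℝ≥0∞) ^ j) ^ q * volume {x | (2 : ℝ≥0∞) ^ j < maxFn r u x} :=
        lintegral_rpow_le_tsum_layer (measurable_maxFn r u) hq0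
    _ = 2 ^ q * ∑' j : ℤ, ((2 : ℝ≥0∞) ^ (j + 1)) ^ q *
          volume {x | (2 : ℝ≥0∞) ^ (j + 1) < maxFn r u x} := by
        congr 1
        exact ((Equiv.addRight (1 : ℤ)).tsum_eq _).symm
    _ ≤ 2 ^ q * ∑' j : ℤ, ((2 : ℝ≥0∞) ^ (j + 1)) ^ q * (ENNReal.ofReal (2 * r) *
          (((2 : ℝ≥0∞) ^ j)⁻¹ * ∫⁻ x, if 2 ^ j < u x then u x else 0)) := by
        gcongr with j
        exact hlev j
    _ = ENNReal.ofReal (2 * r) * 2 ^ (2 * q) *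
          ∑' j : ℤ, ∫⁻ x, ((2 : ℝ≥0∞) ^ j) ^ (q - 1) * if 2 ^ j < u x then u x else 0 := by
        rw [← ENNReal.tsum_mul_left, ← ENNReal.tsum_mul_left]
        refine tsum_congr fun j => ?_
        rw [lintegral_const_mul' _ _ (ENNReal.rpow_ne_top_of_ne_zero (two_zpow_ne_zero j)
          (two_zpow_ne_top j))]
        have : (2 : ℝ≥0∞) ^ q * ((2 : ℝ≥0∞) ^ (j + 1)) ^ q * ((2 : ℝ≥0∞) ^ j)⁻¹ =
            2 ^ (2 * q) * ((2 : ℝ≥0∞) ^ j) ^ (q - 1) := by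
          rw [two_zpow_rpow, two_zpow_rpow, ← ENNReal.rpow_intCast, ← ENNReal.rpow_neg,
            ← two_rpow_add, ← two_rpow_add, ← two_rpow_add]
          congr 1
          push_cast
          ring
        calc _ = ENNReal.ofReal (2 * r) * ((2 : ℝ≥0∞) ^ q * ((2 : ℝ≥0∞) ^ (j + 1)) ^ q *
              ((2 : ℝ≥0∞) ^ j)⁻¹) * ∫⁻ x, (if 2 ^ j < u x then u x else 0) := by ring
          _ = _ := by rw [this]; ring
    _ = ENNReal.ofReal (2 * r) * 2 ^ (2 * q) * ∫⁻ x,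
          (∑' j : ℤ, if 2 ^ j < u x then ((2 : ℝ≥0∞) ^ j) ^ (q - 1) else 0) * u x := by
        rw [← lintegral_tsum]
        · congr 2
          funext x
          rw [← ENNReal.tsum_mul_right]
          refine tsum_congr fun j => ?_
          split_ifs <;> simp
        · intro j
          exact (measurable_const.mul (Measurable.ite (measurableSet_lt measurable_const hu)
            hu measurable_const)).aemeasurable
    _ ≤ ENNReal.ofReal (2 * r) * 2 ^ (2 * q) * ∫⁻ x, geomConst (q - 1) * u x ^ q := by
        refine mul_le_mul' le_rfl (lintegral_mono fun x => ?_)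
        calc _ ≤ geomConst (q - 1) * u x ^ (q - 1) * u x :=
              mul_le_mul' (tsum_layer_le (by linarith) (u x)) le_rfl
          _ = geomConst (q - 1) * u x ^ q := by
              rw [mul_assoc]
              congr 1
              conv_lhs => rw [← ENNReal.rpow_one (u x), ← ENNReal.rpow_mul, one_mul,
                ← ENNReal.rpow_add_of_nonneg _ _ (by linarith) zero_le_one]
              congr 1
              ring
    _ = _ := by
        rw [lintegral_const_mul' _ _ (geomConst_lt_top (by linarith)).ne, maxConst]
        ring

namespace DyadicRect

variable {d : ℕ}

/-- Iterating the one-dimensional maximal operators over the coordinates dominates every average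
over a rectangle, as for the strong maximal function. Since the bound is linear in each `r i`,
dilating by $2^{m_i}$ costs only $\prod 2^{m_i}$. -/
theorem exists_maximal {r : Fin d → ℝ} (hr : ∀ i, 1 / 2 ≤ r i) {q : ℝ} (hq : 1 < q)
    {u : (Fin d → ℝ) → ℝ≥0∞} (hu : Measurable u) :
    ∃ v : (Fin d → ℝ) → ℝ≥0∞, Measurable v ∧
      ∫⁻ x, v x ^ q ≤ (∏ i, ENNReal.ofReal (2 * r i) * maxConst q) * ∫⁻ x, u x ^ q ∧
      ∀ (R : DyadicRect d) x, x ∈ R.dil r →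
        (volume R.toSet)⁻¹ * ∫⁻ y in R.toSet, u y ≤ v x := by
  classical
  -- Integrating `w R s` over the coordinates in `s` averages `u` over the corresponding sides of
  -- `R` and leaves the other coordinates free.
  let w : DyadicRect d → Finset (Fin d) → (Fin d → ℝ) → ℝ≥0∞ := fun R s y =>
    (∏ i ∈ s, (R i).toSet.indicator (fun _ => (volume (R i).toSet)⁻¹) (y i)) * u y
  have hw : ∀ R s, Measurable (w R s) := fun R s =>
    (Finset.measurable_prod s fun i _ => (measurable_const.indicator
      (R i).measurableSet_toSet).comp (measurable_pi_apply i)).mul hu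
  have key : ∀ s : Finset (Fin d), ∃ v : (Fin d → ℝ) → ℝ≥0∞, Measurable v ∧
      ∫⁻ x, v x ^ q ≤ (∏ i ∈ s, ENNReal.ofReal (2 * r i) * maxConst q) * ∫⁻ x, u x ^ q ∧
      ∀ (R : DyadicRect d) (x), (∀ i ∈ s, x i ∈ (R i).dil (r i)) →
        (∫⋯∫⁻_s, w R s ∂fun _ => volume) x ≤ v x := by
    intro s
    induction s using Finset.induction_on with
    | empty => exact ⟨u, hu, by simp, fun R x _ => by simp [w]⟩
    | insert i s hi ih =>
      obtain ⟨v, hv, hvq, hvR⟩ := ih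
      have hmeas : Measurable fun x => maxFn (r i) (fun t => v (Function.update x i t)) (x i) := by
        refine Measurable.iSup fun I => ?_
        have : Measurable fun x : Fin d → ℝ => (volume I.toSet)⁻¹ *
            ∫⁻ t in I.toSet, v (Function.update x i t) := by
          refine Measurable.const_mul ?_ _
          refine Measurable.lintegral_prod_right (f := fun x t => v (Function.update x i t)) ?_
          exact hv.comp measurable_update'
        exact this.indicator ((I.measurableSet_dil (r i)).preimage (measurable_pi_apply i))
      refine ⟨fun x => maxFn (r i) (fun t => v (Function.update x i t)) (x i), hmeas, ?_, ?_⟩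
      · rw [Finset.prod_insert hi, mul_assoc]
        refine le_trans ?_ (mul_le_mul' le_rfl hvq)
        refine lintegral_le_mul_of_fiber i (hmeas.pow_const q) (hv.pow_const q) _ fun x => ?_
        simp only [Function.update_idem, Function.update_self]
        exact lintegral_maxFn_rpow_le (hr i) hq (hv.comp (measurable_update x))
      · intro R x hx
        rw [lmarginal_insert _ (hw _ _) hi]
        refine le_trans ?_ (average_le_maxFn (hx i (Finset.mem_insert_self i s)) _)
        rw [← lintegral_const_mul' _ _ (ENNReal.inv_ne_top.2 (R i).volume_toSet_ne_zero),
          ← lintegral_indicator (R i).measurableSet_toSet]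
        refine lintegral_mono fun t => ?_
        -- The normalized indicator of the new side does not depend on the coordinates in `s`, so it
        -- leaves the inner integral.
        have hfac : ∀ y : Fin d → ℝ, (∀ j, j ∉ s → y j = Function.update x i t j) →
            w R (insert i s) y
              = (R i).toSet.indicator (fun _ => (volume (R i).toSet)⁻¹) t * w R s y := by
          intro y hy
          simp only [w]
          rw [Finset.prod_insert hi, hy i hi, Function.update_self, mul_assoc]
        have hlm : (∫⋯∫⁻_s, w R (insert i s) ∂fun _ => volume) (Function.update x i t) =
            (R i).toSet.indicator (fun _ => (volume (R i).toSet)⁻¹) t *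
              (∫⋯∫⁻_s, w R s ∂fun _ => volume) (Function.update x i t) := by
          unfold lmarginal
          rw [← lintegral_const_mul' _ _ (by
            by_cases ht : t ∈ (R i).toSet <;> simp [ht, (R i).volume_toSet_ne_zero])]
          refine lintegral_congr fun y => hfac _ fun j hj => ?_
          simp [Function.updateFinset, hj]
        rw [hlm]
        by_cases ht : t ∈ (R i).toSet
        · rw [Set.indicator_of_mem ht, Set.indicator_of_mem ht]
          gcongr
          refine hvR R _ fun j hj => ?_
          have hji : j ≠ i := fun h => hi (h ▸ hj)
          rw [Function.update_of_ne hji]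
          exact hx j (Finset.mem_insert_of_mem hj)
        · rw [Set.indicator_of_notMem ht, Set.indicator_of_notMem ht, zero_mul]
  obtain ⟨v, hv, hvq, hvR⟩ := key Finset.univ
  refine ⟨v, hv, hvq, fun R x hx => ?_⟩
  refine le_trans (le_of_eq ?_) (hvR R x fun i _ => hx i (Set.mem_univ i))
  rw [lmarginal_univ, ← volume_pi, ← lintegral_const_mul' _ _
    (ENNReal.inv_ne_top.2 R.volume_toSet_ne_zero), ← lintegral_indicator R.measurableSet_toSet]
  refine lintegral_congr fun y => ?_
  by_cases hy : y ∈ R.toSet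
  · rw [Set.indicator_of_mem hy]
    simp only [w]
    congr 1
    rw [volume_toSet, ENNReal.prod_inv_distrib]
    · exact Finset.prod_congr rfl fun i _ => by rw [Set.indicator_of_mem (hy i (Set.mem_univ i))]
    · intro i _ j _ _
      exact Or.inl (R i).volume_toSet_ne_zero
  · rw [Set.indicator_of_notMem hy]
    obtain ⟨i, hi⟩ : ∃ i, y i ∉ (R i).toSet := by
      by_contra h
      push Not at h
      exact hy fun i _ => h i
    simp only [w]
    rw [Finset.prod_eq_zero (Finset.mem_univ i) (Set.indicator_of_notMem hi _), zero_mul]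

end DyadicRect

end MultiParam

namespace MultiParam

/-! ### Sequence norms -/

/-- The `ℓ²` norm of a family of extended nonnegative reals. -/
noncomputable def l2norm {ι : Type*} (a : ι → ℝ≥0∞) : ℝ≥0∞ := (∑' i, a i ^ 2) ^ (1 / 2 : ℝ)

theorem rpow_half_sq (a : ℝ≥0∞) : (a ^ (1 / 2 : ℝ)) ^ 2 = a := by
  rw [← ENNReal.rpow_natCast, ← ENNReal.rpow_mul]
  norm_num

theorem sq_rpow_half (a : ℝ≥0∞) : (a ^ 2) ^ (1 / 2 : ℝ) = a := by
  rw [← ENNReal.rpow_natCast, ← ENNReal.rpow_mul]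
  norm_num

theorem l2norm_sq {ι : Type*} (a : ι → ℝ≥0∞) : l2norm a ^ 2 = ∑' i, a i ^ 2 := rpow_half_sq _

theorem l2norm_mono {ι : Type*} {a b : ι → ℝ≥0∞} (h : ∀ i, a i ≤ b i) : l2norm a ≤ l2norm b :=
  ENNReal.rpow_le_rpow (ENNReal.tsum_le_tsum fun i => by gcongr; exact h i) (by norm_num)

theorem l2norm_le_iff {ι : Type*} {a : ι → ℝ≥0∞} {C : ℝ≥0∞} :
    l2norm a ≤ C ↔ ∀ s : Finset ι, (∑ i ∈ s, a i ^ 2) ^ (1 / 2 : ℝ) ≤ C := by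
  have hC : C = (C ^ 2) ^ (1 / 2 : ℝ) := (sq_rpow_half C).symm
  rw [l2norm, hC]
  simp only [ENNReal.rpow_le_rpow_iff (show (0 : ℝ) < 1 / 2 by norm_num)]
  rw [ENNReal.tsum_eq_iSup_sum, iSup_le_iff]

theorem l2_sum_le {ι κ : Type*} (s : Finset ι) (t : Finset κ) (a : κ → ι → ℝ≥0∞) :
    (∑ i ∈ s, (∑ j ∈ t, a j i) ^ 2) ^ (1 / 2 : ℝ) ≤ ∑ j ∈ t, (∑ i ∈ s, a j i ^ 2) ^ (1 / 2 : ℝ) := by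
  classical
  induction t using Finset.induction_on with
  | empty => simp
  | insert j t hj ih =>
    simp only [Finset.sum_insert hj]
    have := ENNReal.Lp_add_le s (fun i => a j i) (fun i => ∑ j ∈ t, a j i) (p := 2) (by norm_num)
    simp only [ENNReal.rpow_ofNat] at this
    exact this.trans (add_le_add le_rfl ih)

theorem l2norm_tsum_le {ι κ : Type*} (a : κ → ι → ℝ≥0∞) :
    l2norm (fun i => ∑' j, a j i) ≤ ∑' j, l2norm (a j) := by
  rw [l2norm_le_iff]
  intro s
  have h1 : Filter.Tendsto (fun t : Finset κ => (∑ i ∈ s, (∑ j ∈ t, a j i) ^ 2) ^ (1 / 2 : ℝ))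
      Filter.atTop (nhds ((∑ i ∈ s, (∑' j, a j i) ^ 2) ^ (1 / 2 : ℝ))) := by
    refine Filter.Tendsto.ennrpow_const _ (tendsto_finsetSum _ fun i _ => ?_)
    exact ENNReal.Tendsto.pow ENNReal.summable.hasSum
  refine le_of_tendsto h1 (Filter.Eventually.of_forall fun t => ?_)
  refine (l2_sum_le s t a).trans ((Finset.sum_le_sum fun j _ => ?_).trans
    (ENNReal.sum_le_tsum t))
  exact l2norm_le_iff.1 le_rfl s

/-! ### Square functions and matrices acting on coefficient families -/

section SeqSquare

variable {d : ℕ}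

/-- The square function of a family of coefficients. -/
noncomputable def seqSquare (c : DyadicRect d → ℝ≥0∞) (x : Fin d → ℝ) : ℝ≥0∞ :=
  (∑' R : DyadicRect d, R.toSet.indicator (fun _ => c R ^ 2 / volume R.toSet) x) ^ (1 / 2 : ℝ)

theorem squareFunction_eq (φ : DyadicRect d → (Fin d → ℝ) → ℂ) (f : (Fin d → ℝ) → ℂ) :
    squareFunction φ f = seqSquare fun R => ‖pairing f (φ R)‖ₑ := rfl

theorem measurable_seqSquare (c : DyadicRect d → ℝ≥0∞) : Measurable (seqSquare c) :=
  (Measurable.tsum fun R =>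
    measurable_const.indicator R.measurableSet_toSet).pow_const _

theorem seqSquare_sq (c : DyadicRect d → ℝ≥0∞) (x : Fin d → ℝ) : seqSquare c x ^ 2 =
    ∑' R : DyadicRect d, R.toSet.indicator (fun _ => c R ^ 2 / volume R.toSet) x :=
  rpow_half_sq _

theorem seqSquare_mono {c c' : DyadicRect d → ℝ≥0∞} (h : ∀ R, c R ≤ c' R) (x : Fin d → ℝ) :
    seqSquare c x ≤ seqSquare c' x := by
  refine ENNReal.rpow_le_rpow (ENNReal.tsum_le_tsum fun R => ?_) (by norm_num)
  refine Set.indicator_le_indicator ?_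
  gcongr
  exact h R

theorem seqSquare_eq_l2norm (c : DyadicRect d → ℝ≥0∞) (x : Fin d → ℝ) : seqSquare c x =
    l2norm fun R : DyadicRect d => R.toSet.indicator (fun _ => c R / volume R.toSet ^ (1 / 2 : ℝ)) x := by
  unfold seqSquare l2norm
  congr 2
  funext R
  beta_reduce
  by_cases hx : x ∈ R.toSet
  · rw [Set.indicator_of_mem hx, Set.indicator_of_mem hx, ENNReal.div_eq_inv_mul,
      ENNReal.div_eq_inv_mul, mul_pow, ← ENNReal.inv_pow, rpow_half_sq]
  · simp [Set.indicator_of_notMem hx]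

theorem seqSquare_tsum_le {κ : Type*} (c : κ → DyadicRect d → ℝ≥0∞) (x : Fin d → ℝ) :
    seqSquare (fun R => ∑' j, c j R) x ≤ ∑' j, seqSquare (c j) x := by
  simp only [seqSquare_eq_l2norm]
  refine le_trans (le_of_eq ?_) (l2norm_tsum_le _)
  congr 1
  funext R
  by_cases hx : x ∈ R.toSet
  · simp only [Set.indicator_of_mem hx, ENNReal.div_eq_inv_mul, ENNReal.tsum_mul_left]
  · simp [Set.indicator_of_notMem hx]

/-- Tonelli's theorem: integrating the squared square function against a weight turns the weight
into its averages over rectangles. The weights used are indicators, and $G^{p-2}$ in the argument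
for $p>2$. -/
theorem lintegral_seqSquare_sq_indicator (c : DyadicRect d → ℝ≥0∞) {w : (Fin d → ℝ) → ℝ≥0∞}
    (hw : Measurable w) : ∫⁻ x, seqSquare c x ^ 2 * w x =
      ∑' R : DyadicRect d, c R ^ 2 * ((volume R.toSet)⁻¹ * ∫⁻ x in R.toSet, w x) := by
  simp only [seqSquare_sq, ← ENNReal.tsum_mul_right]
  rw [lintegral_tsum]
  · refine tsum_congr fun R => ?_
    rw [← mul_assoc, ← div_eq_mul_inv, ← lintegral_const_mul _ hw,
      ← lintegral_indicator R.measurableSet_toSet]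
    refine lintegral_congr fun x => ?_
    by_cases hx : x ∈ R.toSet
    · simp [Set.indicator_of_mem hx]
    · simp [Set.indicator_of_notMem hx]
  · exact fun R => ((measurable_const.indicator R.measurableSet_toSet).mul hw).aemeasurable

theorem lintegral_seqSquare_sq (c : DyadicRect d → ℝ≥0∞) :
    ∫⁻ x, seqSquare c x ^ 2 = ∑' R : DyadicRect d, c R ^ 2 := by
  have := lintegral_seqSquare_sq_indicator c (w := fun _ => 1) measurable_const
  simp only [mul_one] at this
  rw [this]
  refine tsum_congr fun R => ?_
  rw [setLIntegral_one, ENNReal.inv_mul_cancel R.volume_toSet_ne_zero R.volume_toSet_ne_top,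
    mul_one]

/-- The union of the rectangles on which a coefficient family does not vanish. -/
def spread (c : DyadicRect d → ℝ≥0∞) : Set (Fin d → ℝ) := ⋃ R ∈ {R | c R ≠ 0}, R.toSet

theorem measurableSet_spread (c : DyadicRect d → ℝ≥0∞) : MeasurableSet (spread c) :=
  MeasurableSet.biUnion (Set.to_countable _) fun R _ => R.measurableSet_toSet

theorem subset_spread {c : DyadicRect d → ℝ≥0∞} {R : DyadicRect d} (h : c R ≠ 0) :
    R.toSet ⊆ spread c := Set.subset_biUnion_of_mem (u := fun R : DyadicRect d => R.toSet)
      (show R ∈ {R | c R ≠ 0} from h)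

/-- Cauchy-Schwarz, as the square function vanishes off `spread c` and its squared $L^2$ norm is the
sum of the squared coefficients. -/
theorem lintegral_seqSquare_le (c : DyadicRect d → ℝ≥0∞) :
    ∫⁻ x, seqSquare c x ≤ volume (spread c) ^ (1 / 2 : ℝ) * l2norm c := by
  have h := ENNReal.lintegral_mul_le_Lp_mul_Lq (volume : Measure (Fin d → ℝ))
    Real.HolderConjugate.two_two (f := (spread c).indicator 1) (g := seqSquare c)
    (measurable_one.indicator (measurableSet_spread c)).aemeasurable
    (measurable_seqSquare c).aemeasurable
  simp only [ENNReal.rpow_ofNat, lintegral_seqSquare_sq] at h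
  refine (lintegral_mono fun x => ?_).trans (h.trans (le_of_eq ?_))
  · by_cases hx : x ∈ spread c
    · simp [Set.indicator_of_mem hx]
    · refine le_of_eq_of_le ?_ zero_le
      have : ∀ R : DyadicRect d, R.toSet.indicator (fun _ => c R ^ 2 / volume R.toSet) x = 0 := by
        intro R
        by_cases hR : c R = 0
        · simp [hR]
        · exact Set.indicator_of_notMem (fun hxR => hx (subset_spread hR hxR)) _
      simp [seqSquare, this]
  · unfold l2norm
    congr 2
    rw [← lintegral_indicator_one (measurableSet_spread c)]
    refine lintegral_congr fun x => ?_
    by_cases hx : x ∈ spread c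
    · simp [Set.indicator_of_mem hx]
    · simp [Set.indicator_of_notMem hx]

/-- The operator on coefficient families with matrix `A`. -/
noncomputable def kernelOp (A : DyadicRect d → DyadicRect d → ℝ≥0∞) (c : DyadicRect d → ℝ≥0∞)
    (R : DyadicRect d) : ℝ≥0∞ := ∑' R', A R R' * c R'

theorem kernelOp_tsum {κ : Type*} (A : DyadicRect d → DyadicRect d → ℝ≥0∞)
    (c : κ → DyadicRect d → ℝ≥0∞) (R : DyadicRect d) :
    kernelOp A (fun R => ∑' j, c j R) R = ∑' j, kernelOp A (c j) R := by
  unfold kernelOp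
  rw [ENNReal.tsum_comm]
  exact tsum_congr fun R' => ENNReal.tsum_mul_left.symm

theorem kernelOp_tsum_left {κ : Type*} (A : κ → DyadicRect d → DyadicRect d → ℝ≥0∞)
    (c : DyadicRect d → ℝ≥0∞) (R : DyadicRect d) :
    kernelOp (fun R R' => ∑' j, A j R R') c R = ∑' j, kernelOp (A j) c R := by
  unfold kernelOp
  rw [ENNReal.tsum_comm]
  exact tsum_congr fun R' => ENNReal.tsum_mul_right.symm

/-- Bounds for a matrix on coefficient families: on `ℓ²`, and from localized `ℓ²` to `L¹`. -/
structure IsAtomicallyBounded (A : DyadicRect d → DyadicRect d → ℝ≥0∞) (Q : ℝ≥0∞) : Prop where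
  l2norm_le : ∀ c, l2norm (kernelOp A c) ≤ Q * l2norm c
  lintegral_le : ∀ c, ∫⁻ x, seqSquare (kernelOp A c) x ≤
    Q * (volume (spread c) ^ (1 / 2 : ℝ) * l2norm c)

theorem isAtomicallyBounded_tsum {κ : Type*} [Countable κ]
    {A : κ → DyadicRect d → DyadicRect d → ℝ≥0∞} {q : κ → ℝ≥0∞}
    (h : ∀ θ, IsAtomicallyBounded (A θ) (q θ)) :
    IsAtomicallyBounded (fun R R' => ∑' θ, A θ R R') (∑' θ, q θ) := by
  have heq : ∀ c, kernelOp (fun R R' => ∑' θ, A θ R R') c = fun R => ∑' θ, kernelOp (A θ) c R :=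
    fun c => funext fun R => kernelOp_tsum_left A c R
  constructor
  · intro c
    rw [heq, ← ENNReal.tsum_mul_right]
    exact (l2norm_tsum_le fun θ => kernelOp (A θ) c).trans
      (ENNReal.tsum_le_tsum fun θ => (h θ).l2norm_le c)
  · intro c
    rw [heq, ← ENNReal.tsum_mul_right]
    calc _ ≤ ∫⁻ x, ∑' θ, seqSquare (kernelOp (A θ) c) x :=
          lintegral_mono fun x => seqSquare_tsum_le _ x
      _ = ∑' θ, ∫⁻ x, seqSquare (kernelOp (A θ) c) x :=
          lintegral_tsum fun θ => (measurable_seqSquare _).aemeasurable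
      _ ≤ _ := ENNReal.tsum_le_tsum fun θ => (h θ).lintegral_le c

/-- The constant in the measure estimate for the rectangles half covered by a set. -/
noncomputable def coverConst (d : ℕ) : ℝ≥0∞ := 4 * ∏ _i : Fin d, maxConst 2

theorem coverConst_lt_top (d : ℕ) : coverConst d < ∞ :=
  ENNReal.mul_lt_top (by norm_num)
    (ENNReal.prod_lt_top fun _ _ => maxConst_lt_top (by norm_num))

/-- On a rectangle half covered by `V` the strong maximal function of the indicator of `V` is at
least 1/2. Chebyshev's inequality in $L^2$ gives the factor 4 of `coverConst`. -/
theorem volume_biUnion_half_covered_le {V : Set (Fin d → ℝ)} (hV : MeasurableSet V)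
    {S : Set (DyadicRect d)} (hS : ∀ R ∈ S, volume R.toSet ≤ 2 * volume (R.toSet ∩ V)) :
    volume (⋃ R ∈ S, R.toSet) ≤ coverConst d * volume V := by
  obtain ⟨v, hv, hvq, hvR⟩ := DyadicRect.exists_maximal (r := fun _ : Fin d => 1 / 2)
    (fun _ => le_rfl) (q := 2) (by norm_num) (measurable_one.indicator hV)
  have h1 : (∏ i : Fin d, ENNReal.ofReal (2 * (1 / 2)) * maxConst 2) =
      ∏ _i : Fin d, maxConst 2 := by norm_num
  have h2 : ∀ x, V.indicator (1 : (Fin d → ℝ) → ℝ≥0∞) x ^ (2 : ℝ) = V.indicator 1 x := by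
    intro x
    by_cases hx : x ∈ V <;> simp [hx]
  simp only [h1, h2, lintegral_indicator_one hV] at hvq
  have hsub : (⋃ R ∈ S, R.toSet) ⊆ {x | 1 ≤ 4 * v x ^ (2 : ℝ)} := by
    intro x hx
    simp only [Set.mem_iUnion, exists_prop] at hx
    obtain ⟨R, hR, hxR⟩ := hx
    have h3 := hvR R x (R.toSet_subset_dil (fun _ => le_rfl) hxR)
    rw [lintegral_indicator_one hV, Measure.restrict_apply hV, Set.inter_comm] at h3
    have h4 : 1 ≤ 2 * v x := by
      calc (1 : ℝ≥0∞) = (volume R.toSet)⁻¹ * volume R.toSet :=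
            (ENNReal.inv_mul_cancel R.volume_toSet_ne_zero R.volume_toSet_ne_top).symm
        _ ≤ (volume R.toSet)⁻¹ * (2 * volume (R.toSet ∩ V)) := by gcongr; exact hS R hR
        _ = 2 * ((volume R.toSet)⁻¹ * volume (R.toSet ∩ V)) := by ring
        _ ≤ _ := by gcongr
    have h5 : 1 ≤ (2 * v x) ^ 2 := one_le_pow₀ h4
    have h6 : 4 * v x ^ (2 : ℝ) = (2 * v x) ^ 2 := by
      rw [ENNReal.rpow_ofNat, mul_pow]
      norm_num
    show 1 ≤ 4 * v x ^ (2 : ℝ)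
    rw [h6]
    exact h5
  calc _ ≤ volume {x | 1 ≤ 4 * v x ^ (2 : ℝ)} := measure_mono hsub
    _ ≤ ∫⁻ x, 4 * v x ^ (2 : ℝ) := by
        simpa using mul_meas_ge_le_lintegral₀ ((hv.pow_const _).const_mul _).aemeasurable 1
    _ = 4 * ∫⁻ x, v x ^ (2 : ℝ) := lintegral_const_mul' _ _ (by norm_num)
    _ ≤ _ := by
        rw [coverConst, mul_assoc]
        gcongr

end SeqSquare

end MultiParam

namespace MultiParam

/-! ### Level-set decomposition of coefficient families and interpolation -/

section LevelSets

variable {d : ℕ}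

/-- The set `{𝒮c > 2^j}`. -/
def levelSet (c : DyadicRect d → ℝ≥0∞) (j : ℤ) : Set (Fin d → ℝ) :=
  {x | (2 : ℝ≥0∞) ^ j < seqSquare c x}

theorem measurableSet_levelSet (c : DyadicRect d → ℝ≥0∞) (j : ℤ) :
    MeasurableSet (levelSet c j) := measurableSet_lt measurable_const (measurable_seqSquare c)

/-- The greatest `j` for which `levelSet c j` covers more than half of `R` works. Such `j` exist
because the term of `R` alone bounds the square function from below on `R`; they are bounded above
because the square function is in $L^p$. -/
theorem exists_level {c : DyadicRect d → ℝ≥0∞} {p : ℝ} (hp : 0 < p)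
    (hc : ∫⁻ x, seqSquare c x ^ p ≠ ∞) {R : DyadicRect d} (hR : c R ≠ 0) :
    ∃ j : ℤ, volume R.toSet ≤ 2 * volume (R.toSet ∩ levelSet c j) ∧
      2 * volume (R.toSet ∩ levelSet c (j + 1)) ≤ volume R.toSet := by
  have hV0 := R.volume_toSet_ne_zero
  have hVt := R.volume_toSet_ne_top
  have hne : ∃ j : ℤ, volume R.toSet < 2 * volume (R.toSet ∩ levelSet c j) := by
    -- The minimum with 1 keeps the number finite even if `c R = ∞`.
    have hpos : 0 < (c R ^ 2 / volume R.toSet) ^ (1 / 2 : ℝ) ⊓ 1 := by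
      refine lt_min (ENNReal.rpow_pos_of_nonneg (ENNReal.div_pos (by simpa using hR) hVt)
        (by norm_num)) one_pos
    obtain ⟨n, hn1, -⟩ := ENNReal.exists_mem_Ioc_zpow hpos.ne'
      (ne_top_of_le_ne_top ENNReal.one_ne_top inf_le_right) (y := 2) (by norm_num) (by norm_num)
    refine ⟨n, ?_⟩
    have : R.toSet ∩ levelSet c n = R.toSet := by
      refine Set.inter_eq_left.2 fun x hx => ?_
      refine lt_of_lt_of_le (hn1.trans_le inf_le_left) ?_
      refine ENNReal.rpow_le_rpow (le_trans (le_of_eq ?_) (ENNReal.le_tsum R)) (by norm_num)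
      rw [Set.indicator_of_mem hx]
    rw [this, two_mul]
    exact ENNReal.lt_add_right hVt hV0
  have hbdd : ∃ b : ℤ, ∀ j, volume R.toSet < 2 * volume (R.toSet ∩ levelSet c j) → j ≤ b := by
    have hm : ∀ j : ℤ, ((2 : ℝ≥0∞) ^ j) ^ p * volume (levelSet c j) ≤
        ∫⁻ x, seqSquare c x ^ p := by
      intro j
      refine le_trans ?_ (mul_meas_ge_le_lintegral₀
        ((measurable_seqSquare c).pow_const p).aemeasurable (((2 : ℝ≥0∞) ^ j) ^ p))
      gcongr
      intro x hx
      exact ENNReal.rpow_le_rpow (le_of_lt hx) hp.le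
    set B := 2 * (∫⁻ x, seqSquare c x ^ p) / volume R.toSet with hB
    have hBt : B ≠ ∞ := ENNReal.div_ne_top (ENNReal.mul_ne_top (by norm_num) hc) hV0
    have h1 : ∀ j : ℤ, volume R.toSet < 2 * volume (R.toSet ∩ levelSet c j) →
        ((2 : ℝ≥0∞) ^ j) ^ p ≤ B := by
      intro j hj
      rw [hB, ENNReal.le_div_iff_mul_le (Or.inl hV0) (Or.inl hVt)]
      calc ((2 : ℝ≥0∞) ^ j) ^ p * volume R.toSet
          ≤ ((2 : ℝ≥0∞) ^ j) ^ p * (2 * volume (levelSet c j)) := by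
            gcongr
            exact hj.le.trans (mul_le_mul' le_rfl (measure_mono Set.inter_subset_right))
        _ = 2 * (((2 : ℝ≥0∞) ^ j) ^ p * volume (levelSet c j)) := by ring
        _ ≤ _ := by gcongr; exact hm j
    have hpos : (B + 1) ^ (1 / p) ≠ 0 := by
      simp [hp.le, ENNReal.rpow_eq_zero_iff]
    obtain ⟨n, -, hn⟩ := ENNReal.exists_mem_Ioc_zpow hpos
      (ENNReal.rpow_ne_top_of_nonneg (by positivity) (by simp [hBt])) (y := 2) (by norm_num)
      (by norm_num)
    refine ⟨n + 1, fun j hj => ?_⟩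
    by_contra hlt
    push Not at hlt
    have h2 : (2 : ℝ≥0∞) ^ (n + 1) ≤ 2 ^ j := ENNReal.zpow_le_of_le (by norm_num) hlt.le
    have h3 : B + 1 ≤ B := by
      calc B + 1 = ((B + 1) ^ (1 / p)) ^ p := by rw [← ENNReal.rpow_mul]; field_simp; simp
        _ ≤ ((2 : ℝ≥0∞) ^ j) ^ p := by gcongr; exact hn.trans h2
        _ ≤ B := h1 j hj
    exact absurd h3 (not_le.2 (ENNReal.lt_add_right hBt one_ne_zero))
  obtain ⟨j, hj, hmax⟩ := Int.exists_greatest_of_bdd hbdd hne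
  refine ⟨j, hj.le, ?_⟩
  by_contra h
  push Not at h
  have := hmax (j + 1) h
  omega

/-- Each rectangle with a nonzero coefficient is assigned to the single level `j` supplied by
`exists_level`. Half covering by the level set at `j` bounds the spread of that level; at least half
of the rectangle lying outside the level set at `j + 1` bounds its energy. As each coefficient
occurs in one level only, sums over levels commute with squaring. -/
theorem exists_level_decomposition (c : DyadicRect d → ℝ≥0∞) {p : ℝ} (hp : 0 < p)
    (hc : ∫⁻ x, seqSquare c x ^ p ≠ ∞) :
    ∃ b : ℤ → DyadicRect d → ℝ≥0∞, (∀ R, c R = ∑' j, b j R) ∧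
      (∀ (S : Set ℤ) R, (∑' j, S.indicator (fun j => b j R) j) ^ 2
        = ∑' j, S.indicator (fun j => b j R ^ 2) j) ∧
      (∀ j, volume (spread (b j)) ≤ coverConst d * volume (levelSet c j)) ∧
      (∀ j, ∑' R, b j R ^ 2 ≤ 8 * ((2 : ℝ≥0∞) ^ j) ^ 2 * volume (spread (b j))) := by
  classical
  have hex : ∀ R : DyadicRect d, ∃ j : ℤ, c R ≠ 0 →
      volume R.toSet ≤ 2 * volume (R.toSet ∩ levelSet c j) ∧
      2 * volume (R.toSet ∩ levelSet c (j + 1)) ≤ volume R.toSet := by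
    intro R
    by_cases hR : c R = 0
    · exact ⟨0, fun h => absurd hR h⟩
    · obtain ⟨j, hj⟩ := exists_level hp hc hR
      exact ⟨j, fun _ => hj⟩
  choose lev hlev using hex
  set b : ℤ → DyadicRect d → ℝ≥0∞ := fun j R => if j = lev R then c R else 0 with hb
  have hspread : ∀ j R, b j R ≠ 0 → lev R = j ∧ c R ≠ 0 := by
    intro j R h
    simp only [hb] at h
    split_ifs at h with h1
    · exact ⟨h1.symm, h⟩
    · exact absurd rfl h
  refine ⟨b, fun R => (tsum_ite_eq (lev R) fun _ => c R).symm, fun S R => ?_, fun j => ?_,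
    fun j => ?_⟩
  · rw [tsum_eq_single (lev R), tsum_eq_single (lev R)]
    · by_cases h : lev R ∈ S <;> simp [h]
    · intro j hj
      by_cases h : j ∈ S <;> simp [h, hb, hj]
    · intro j hj
      by_cases h : j ∈ S <;> simp [h, hb, hj]
  · refine volume_biUnion_half_covered_le (measurableSet_levelSet c j) fun R hR => ?_
    obtain ⟨h1, h2⟩ := hspread j R hR
    rw [← h1]
    exact (hlev R h2).1
  · set Ω := levelSet c (j + 1) with hΩ
    have hΩm : MeasurableSet Ω := measurableSet_levelSet c (j + 1)
    -- Restricting the average to the complement of `Ω` loses at most a factor 2. There the square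
    -- function is at most `2 ^ (j + 1)`, so the energy is at most 2 · 4 · `(2 ^ j) ^ 2` times the
    -- measure of the spread.
    have h1 : ∀ R, b j R ^ 2 ≤ 2 * (b j R ^ 2 * ((volume R.toSet)⁻¹ *
        ∫⁻ x in R.toSet, (spread (b j) \ Ω).indicator 1 x)) := by
      intro R
      by_cases hR : b j R = 0
      · simp [hR]
      obtain ⟨hl, hcR⟩ := hspread j R hR
      have h2 := (hlev R hcR).2
      rw [hl] at h2
      rw [lintegral_indicator_one ((measurableSet_spread _).diff hΩm),
        Measure.restrict_apply ((measurableSet_spread _).diff hΩm)]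
      have hset : (spread (b j) \ Ω) ∩ R.toSet = R.toSet \ Ω := by
        ext x
        constructor
        · rintro ⟨⟨_, h⟩, hx⟩
          exact ⟨hx, h⟩
        · rintro ⟨hx, h⟩
          exact ⟨⟨subset_spread hR hx, h⟩, hx⟩
      have hhalf : volume R.toSet ≤ 2 * volume (R.toSet \ Ω) := by
        have h3 := measure_inter_add_sdiff (μ := volume) R.toSet hΩm
        have hfin : volume (R.toSet ∩ Ω) ≠ ∞ :=
          ne_top_of_le_ne_top R.volume_toSet_ne_top (measure_mono Set.inter_subset_left)
        rw [← h3, two_mul] at h2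
        have h4 := (ENNReal.add_le_add_iff_left hfin).1 h2
        rw [← h3, two_mul]
        gcongr
      rw [hset]
      calc b j R ^ 2 = b j R ^ 2 * ((volume R.toSet)⁻¹ * volume R.toSet) := by
            rw [ENNReal.inv_mul_cancel R.volume_toSet_ne_zero R.volume_toSet_ne_top, mul_one]
        _ ≤ b j R ^ 2 * ((volume R.toSet)⁻¹ * (2 * volume (R.toSet \ Ω))) := by gcongr
        _ = _ := by ring
    calc ∑' R, b j R ^ 2 ≤ ∑' R : DyadicRect d, 2 * (b j R ^ 2 * ((volume R.toSet)⁻¹ *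
          ∫⁻ x in R.toSet, (spread (b j) \ Ω).indicator 1 x)) := ENNReal.tsum_le_tsum h1
      _ = 2 * ∫⁻ x, seqSquare (b j) x ^ 2 * (spread (b j) \ Ω).indicator 1 x := by
          rw [ENNReal.tsum_mul_left, lintegral_seqSquare_sq_indicator _
            (measurable_one.indicator ((measurableSet_spread _).diff hΩm))]
      _ ≤ 2 * ∫⁻ x, (spread (b j)).indicator (fun _ => ((2 : ℝ≥0∞) ^ (j + 1)) ^ 2) x := by
          refine mul_le_mul' le_rfl (lintegral_mono fun x => ?_)
          by_cases hx : x ∈ spread (b j) \ Ω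
          · rw [Set.indicator_of_mem hx, Set.indicator_of_mem hx.1, Pi.one_apply, mul_one]
            have h5 : seqSquare c x ≤ 2 ^ (j + 1) := not_lt.1 hx.2
            gcongr
            refine (seqSquare_mono (fun R => ?_) x).trans h5
            simp only [hb]
            split_ifs <;> simp
          · simp [Set.indicator_of_notMem hx]
      _ = _ := by
          rw [lintegral_indicator_const (measurableSet_spread _),
            ENNReal.zpow_add two_ne_zero ENNReal.ofNat_ne_top, zpow_one]
          ring

variable {A : DyadicRect d → DyadicRect d → ℝ≥0∞} {Q : ℝ≥0∞}

/-- An upper bound for the norm of an atomically bounded matrix on the dyadic Hardy space. -/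
noncomputable def hardyConst (d : ℕ) (Q : ℝ≥0∞) : ℝ≥0∞ := Q * (3 * coverConst d)

/-- One level behaves like a multiple of an $H^1$ atom: its energy is what Cauchy-Schwarz on its
spread needs. The 3 of `hardyConst` bounds $\sqrt 8$. -/
theorem lintegral_seqSquare_kernelOp_level_le (hA : IsAtomicallyBounded A Q)
    {c b : DyadicRect d → ℝ≥0∞} {j : ℤ}
    (h1 : volume (spread b) ≤ coverConst d * volume (levelSet c j))
    (h2 : ∑' R, b R ^ 2 ≤ 8 * ((2 : ℝ≥0∞) ^ j) ^ 2 * volume (spread b)) :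
    ∫⁻ x, seqSquare (kernelOp A b) x ≤ hardyConst d Q * (2 ^ j * volume (levelSet c j)) := by
  have h3 : l2norm b ≤ 3 * 2 ^ j * volume (spread b) ^ (1 / 2 : ℝ) := by
    have h4 : ∑' R, b R ^ 2 ≤ (3 * 2 ^ j * volume (spread b) ^ (1 / 2 : ℝ)) ^ 2 := by
      rw [mul_pow, mul_pow, rpow_half_sq]
      refine h2.trans ?_
      gcongr
      norm_num
    exact (ENNReal.rpow_le_rpow h4 (by norm_num)).trans (le_of_eq (sq_rpow_half _))
  calc _ ≤ Q * (volume (spread b) ^ (1 / 2 : ℝ) * l2norm b) := hA.lintegral_le b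
    _ ≤ Q * (volume (spread b) ^ (1 / 2 : ℝ) * (3 * 2 ^ j * volume (spread b) ^ (1 / 2 : ℝ))) := by
        gcongr
    _ = Q * (3 * 2 ^ j * (volume (spread b) ^ (1 / 2 : ℝ)) ^ 2) := by ring
    _ ≤ Q * (3 * 2 ^ j * (coverConst d * volume (levelSet c j))) := by
        rw [rpow_half_sq]
        gcongr
    _ = _ := by rw [hardyConst]; ring

/-- The bounds for the single levels add up to a dyadic layer-cake sum for $\int\mathcal Sc$. -/
theorem lintegral_seqSquare_kernelOp_le (hA : IsAtomicallyBounded A Q)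
    (c : DyadicRect d → ℝ≥0∞) (hc : ∫⁻ x, seqSquare c x ≠ ∞) :
    ∫⁻ x, seqSquare (kernelOp A c) x ≤ hardyConst d Q * geomConst 1 * ∫⁻ x, seqSquare c x := by
  obtain ⟨b, hb, -, hb1, hb2⟩ := exists_level_decomposition c one_pos (by simpa using hc)
  have hc' : c = fun R => ∑' j, b j R := funext hb
  calc ∫⁻ x, seqSquare (kernelOp A c) x
      ≤ ∫⁻ x, ∑' j, seqSquare (kernelOp A (b j)) x := by
        refine lintegral_mono fun x => ?_
        conv_lhs => rw [hc', show kernelOp A (fun R => ∑' j, b j R) =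
          fun R => ∑' j, kernelOp A (b j) R from funext (kernelOp_tsum A b)]
        exact seqSquare_tsum_le _ x
    _ = ∑' j, ∫⁻ x, seqSquare (kernelOp A (b j)) x :=
        lintegral_tsum fun j => (measurable_seqSquare _).aemeasurable
    _ ≤ ∑' j : ℤ, hardyConst d Q * (2 ^ j * volume (levelSet c j)) :=
        ENNReal.tsum_le_tsum fun j => lintegral_seqSquare_kernelOp_level_le hA (hb1 j) (hb2 j)
    _ ≤ _ := by
        rw [ENNReal.tsum_mul_left, mul_assoc]
        refine mul_le_mul' le_rfl ?_
        have := tsum_layer_le_lintegral_rpow (μ := volume) (measurable_seqSquare c)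
          (s := 1) one_pos
        simp only [ENNReal.rpow_one] at this
        exact this

/-- The constant in the bound of an atomically bounded matrix on `L^p`, `1 < p < 2`. -/
noncomputable def lpConst (d : ℕ) (Q : ℝ≥0∞) (p : ℝ) : ℝ≥0∞ :=
  2 ^ (2 * p) * ((Q ^ 2 * (8 * coverConst d) * geomConst (2 - p) +
    hardyConst d Q * geomConst (p - 1)) * geomConst p)

theorem lpConst_lt_top (d : ℕ) {Q : ℝ≥0∞} (hQ : Q < ∞) {p : ℝ} (h1 : 1 < p) (h2 : p < 2) :
    lpConst d Q p < ∞ := by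
  have hc := coverConst_lt_top d
  refine ENNReal.mul_lt_top (ENNReal.rpow_lt_top_of_nonneg (by linarith) (by norm_num))
    (ENNReal.mul_lt_top (ENNReal.add_lt_top.2 ⟨?_, ?_⟩) (geomConst_lt_top (by linarith)))
  · exact ENNReal.mul_lt_top (ENNReal.mul_lt_top (ENNReal.pow_lt_top hQ)
      (ENNReal.mul_lt_top (by norm_num) hc)) (geomConst_lt_top (by linarith))
  · exact ENNReal.mul_lt_top (ENNReal.mul_lt_top hQ (ENNReal.mul_lt_top (by norm_num) hc))
      (geomConst_lt_top (by linarith))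

theorem two_zpow_mul (j : ℤ) (s t : ℝ) :
    ((2 : ℝ≥0∞) ^ j) ^ s * ((2 : ℝ≥0∞) ^ j) ^ t = ((2 : ℝ≥0∞) ^ j) ^ (s + t) :=
  (ENNReal.rpow_add _ _ (two_zpow_ne_zero j) (two_zpow_ne_top j)).symm

/-- Real interpolation along the level decomposition. At height $2^J$ the levels up to $J$ are
estimated in $L^2$ and the higher ones in $L^1$; for $1<p<2$ the resulting double sums over $J$ and
the levels are geometric in $J$. -/
theorem lintegral_seqSquare_kernelOp_rpow_le (hA : IsAtomicallyBounded A Q) {p : ℝ} (h1 : 1 < p)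
    (h2 : p < 2) (c : DyadicRect d → ℝ≥0∞) (hc : ∫⁻ x, seqSquare c x ^ p ≠ ∞) :
    ∫⁻ x, seqSquare (kernelOp A c) x ^ p ≤ lpConst d Q p * ∫⁻ x, seqSquare c x ^ p := by
  have hp0 : 0 < p := by linarith
  obtain ⟨b, hb, hbsq, hb1, hb2⟩ := exists_level_decomposition c hp0 hc
  set lo : ℤ → DyadicRect d → ℝ≥0∞ := fun J R =>
    ∑' j, (Set.Iic J).indicator (fun j => b j R) j with hlo
  set hi : ℤ → DyadicRect d → ℝ≥0∞ := fun J R =>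
    ∑' j, (Set.Ioi J).indicator (fun j => b j R) j with hhi
  set X : ℤ → ℝ≥0∞ := fun j => volume (levelSet c j) with hX
  have hsplit : ∀ J R, c R = lo J R + hi J R := by
    intro J R
    rw [hb, hlo, hhi]
    dsimp only
    rw [← ENNReal.tsum_add]
    refine tsum_congr fun j => ?_
    rcases le_or_gt j J with h | h
    · simp [Set.indicator, h, not_lt.2 h]
    · simp [Set.indicator, h, not_le.2 h]
  have hle : ∀ J x, seqSquare (kernelOp A c) x ≤
      seqSquare (kernelOp A (lo J)) x + seqSquare (kernelOp A (hi J)) x := by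
    intro J x
    have e1 : c = fun R => ∑' k : Bool, (if k then lo J else hi J) R := by
      funext R
      rw [tsum_bool, hsplit J R, add_comm]
      rfl
    have e2 : kernelOp A c = fun R => ∑' k : Bool, kernelOp A (if k then lo J else hi J) R := by
      conv_lhs => rw [e1]
      exact funext (kernelOp_tsum A _)
    rw [e2]
    refine (seqSquare_tsum_le _ x).trans (le_of_eq ?_)
    rw [tsum_bool, add_comm]
    rfl
  -- Low levels: Chebyshev in $L^2$, the $\ell^2$ bound for the matrix, and additivity of the
  -- energies of the levels.
  have hL : ∀ J, volume {x | (2 : ℝ≥0∞) ^ J < seqSquare (kernelOp A (lo J)) x} ≤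
      Q ^ 2 * (8 * coverConst d) * (((2 : ℝ≥0∞) ^ J) ^ (-2 : ℝ) *
        ∑' j : ℤ, if j ≤ J then ((2 : ℝ≥0∞) ^ j) ^ (2 : ℝ) * X j else 0) := by
    intro J
    have hsum : ∫⁻ x, seqSquare (kernelOp A (lo J)) x ^ 2 ≤ Q ^ 2 * (8 * coverConst d) *
        ∑' j : ℤ, if j ≤ J then ((2 : ℝ≥0∞) ^ j) ^ (2 : ℝ) * X j else 0 := by
      rw [lintegral_seqSquare_sq, ← l2norm_sq]
      calc _ ≤ (Q * l2norm (lo J)) ^ 2 := by gcongr; exact hA.l2norm_le _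
        _ = Q ^ 2 * ∑' R, lo J R ^ 2 := by rw [mul_pow, l2norm_sq]
        _ = Q ^ 2 * ∑' j, (Set.Iic J).indicator (fun j => ∑' R, b j R ^ 2) j := by
            congr 1
            simp only [hlo, hbsq]
            rw [ENNReal.tsum_comm]
            refine tsum_congr fun j => ?_
            by_cases h : j ∈ Set.Iic J <;> simp [h]
        _ ≤ Q ^ 2 * ∑' j : ℤ, 8 * coverConst d *
              (if j ≤ J then ((2 : ℝ≥0∞) ^ j) ^ (2 : ℝ) * X j else 0) := by
            gcongr with j
            by_cases h : j ≤ J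
            · rw [Set.indicator_of_mem (show j ∈ Set.Iic J from h), if_pos h,
                ENNReal.rpow_ofNat]
              calc _ ≤ 8 * ((2 : ℝ≥0∞) ^ j) ^ 2 * volume (spread (b j)) := hb2 j
                _ ≤ 8 * ((2 : ℝ≥0∞) ^ j) ^ 2 * (coverConst d * X j) := by gcongr; exact hb1 j
                _ = _ := by ring
            · rw [Set.indicator_of_notMem (show j ∉ Set.Iic J from h)]
              exact zero_le
        _ = _ := by rw [ENNReal.tsum_mul_left]; ring
    have hm := mul_meas_ge_le_lintegral₀ (μ := volume)
      ((measurable_seqSquare (kernelOp A (lo J))).pow_const 2).aemeasurable (((2 : ℝ≥0∞) ^ J) ^ 2)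
    have h3 : ((2 : ℝ≥0∞) ^ J) ^ (2 : ℝ) *
        volume {x | (2 : ℝ≥0∞) ^ J < seqSquare (kernelOp A (lo J)) x} ≤
        ∫⁻ x, seqSquare (kernelOp A (lo J)) x ^ 2 := by
      rw [ENNReal.rpow_ofNat]
      refine le_trans (mul_le_mul' le_rfl (measure_mono ?_)) hm
      intro x hx
      have hx' : (2 : ℝ≥0∞) ^ J < seqSquare (kernelOp A (lo J)) x := hx
      exact pow_le_pow_left' hx'.le 2
    calc _ = ((2 : ℝ≥0∞) ^ J) ^ (-2 : ℝ) * (((2 : ℝ≥0∞) ^ J) ^ (2 : ℝ) *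
          volume {x | (2 : ℝ≥0∞) ^ J < seqSquare (kernelOp A (lo J)) x}) := by
          rw [← mul_assoc, two_zpow_mul]
          simp
      _ ≤ ((2 : ℝ≥0∞) ^ J) ^ (-2 : ℝ) * (Q ^ 2 * (8 * coverConst d) *
          ∑' j : ℤ, if j ≤ J then ((2 : ℝ≥0∞) ^ j) ^ (2 : ℝ) * X j else 0) := mul_le_mul' le_rfl (h3.trans hsum)
      _ = _ := by ring
  -- High levels: Chebyshev in $L^1$ and the bound for each single level.
  have hH : ∀ J, volume {x | (2 : ℝ≥0∞) ^ J < seqSquare (kernelOp A (hi J)) x} ≤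
      hardyConst d Q * (((2 : ℝ≥0∞) ^ J) ^ (-1 : ℝ) *
        ∑' j : ℤ, if J ≤ j then ((2 : ℝ≥0∞) ^ j) ^ (1 : ℝ) * X j else 0) := by
    intro J
    have hsum : ∫⁻ x, seqSquare (kernelOp A (hi J)) x ≤ hardyConst d Q *
        ∑' j : ℤ, if J ≤ j then ((2 : ℝ≥0∞) ^ j) ^ (1 : ℝ) * X j else 0 := by
      have e : hi J = fun R => ∑' j, (fun j => if J < j then b j else 0) j R := by
        funext R
        simp only [hhi]
        refine tsum_congr fun j => ?_
        by_cases h : J < j <;> simp [h]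
      calc ∫⁻ x, seqSquare (kernelOp A (hi J)) x
          ≤ ∫⁻ x, ∑' j, seqSquare (kernelOp A (if J < j then b j else 0)) x := by
            refine lintegral_mono fun x => ?_
            conv_lhs => rw [e, show kernelOp A (fun R => ∑' j, (fun j => if J < j then b j else 0)
              j R) = fun R => ∑' j, kernelOp A (if J < j then b j else 0) R from
                funext (kernelOp_tsum A _)]
            exact seqSquare_tsum_le _ x
        _ = ∑' j, ∫⁻ x, seqSquare (kernelOp A (if J < j then b j else 0)) x :=
            lintegral_tsum fun j => (measurable_seqSquare _).aemeasurable
        _ ≤ ∑' j : ℤ, hardyConst d Q *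
              (if J ≤ j then ((2 : ℝ≥0∞) ^ j) ^ (1 : ℝ) * X j else 0) := by
            refine ENNReal.tsum_le_tsum fun j => ?_
            by_cases h : J < j
            · rw [if_pos h, if_pos h.le, ENNReal.rpow_one]
              exact lintegral_seqSquare_kernelOp_level_le hA (hb1 j) (hb2 j)
            · rw [if_neg h]
              simp [seqSquare, kernelOp]
        _ = _ := ENNReal.tsum_mul_left
    have hm := mul_meas_ge_le_lintegral₀ (μ := volume)
      (measurable_seqSquare (kernelOp A (hi J))).aemeasurable ((2 : ℝ≥0∞) ^ J)
    have h3 : ((2 : ℝ≥0∞) ^ J) ^ (1 : ℝ) *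
        volume {x | (2 : ℝ≥0∞) ^ J < seqSquare (kernelOp A (hi J)) x} ≤
        ∫⁻ x, seqSquare (kernelOp A (hi J)) x := by
      rw [ENNReal.rpow_one]
      refine le_trans (mul_le_mul' le_rfl (measure_mono ?_)) hm
      intro x hx
      have hx' : (2 : ℝ≥0∞) ^ J < seqSquare (kernelOp A (hi J)) x := hx
      exact hx'.le
    calc _ = ((2 : ℝ≥0∞) ^ J) ^ (-1 : ℝ) * (((2 : ℝ≥0∞) ^ J) ^ (1 : ℝ) *
          volume {x | (2 : ℝ≥0∞) ^ J < seqSquare (kernelOp A (hi J)) x}) := by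
          rw [← mul_assoc, two_zpow_mul]
          simp
      _ ≤ ((2 : ℝ≥0∞) ^ J) ^ (-1 : ℝ) * (hardyConst d Q *
          ∑' j : ℤ, if J ≤ j then ((2 : ℝ≥0∞) ^ j) ^ (1 : ℝ) * X j else 0) := mul_le_mul' le_rfl (h3.trans hsum)
      _ = _ := by ring
  have hlev : ∀ J : ℤ, volume {x | (2 : ℝ≥0∞) ^ (J + 1) < seqSquare (kernelOp A c) x} ≤
      volume {x | (2 : ℝ≥0∞) ^ J < seqSquare (kernelOp A (lo J)) x} +
      volume {x | (2 : ℝ≥0∞) ^ J < seqSquare (kernelOp A (hi J)) x} := by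
    intro J
    refine (measure_mono fun x hx => ?_).trans (measure_union_le _ _)
    have hx' : (2 : ℝ≥0∞) ^ (J + 1) < seqSquare (kernelOp A c) x := hx
    by_contra h
    simp only [Set.mem_union, Set.mem_ofPred_eq, not_or, not_lt] at h
    have h3 := hx'.trans_le ((hle J x).trans (add_le_add h.1 h.2))
    rw [ENNReal.zpow_add two_ne_zero ENNReal.ofNat_ne_top, zpow_one, mul_two] at h3
    exact lt_irrefl _ h3
  have hlayer := tsum_layer_le_lintegral_rpow (μ := volume) (measurable_seqSquare c) hp0
  -- For a fixed level $j$ the sum of $2^{J(p-2)}$ over $J\ge j$ converges because $p<2$; in `hS2`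
  -- the sum of $2^{J(p-1)}$ over $J\le j$ converges because $p>1$.
  have hS1 : ∑' J : ℤ, ((2 : ℝ≥0∞) ^ J) ^ p * (((2 : ℝ≥0∞) ^ J) ^ (-2 : ℝ) *
      ∑' j : ℤ, if j ≤ J then ((2 : ℝ≥0∞) ^ j) ^ (2 : ℝ) * X j else 0)
      = geomConst (2 - p) * ∑' j : ℤ, ((2 : ℝ≥0∞) ^ j) ^ p * X j := by
    rw [← ENNReal.tsum_mul_left]
    simp only [← mul_assoc, two_zpow_mul, ← ENNReal.tsum_mul_left]
    rw [ENNReal.tsum_comm]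
    refine tsum_congr fun j => ?_
    have := tsum_two_zpow_ge j (2 - p)
    calc _ = ∑' J : ℤ, (if j ≤ J then ((2 : ℝ≥0∞) ^ J) ^ (-(2 - p)) else 0) *
          (((2 : ℝ≥0∞) ^ j) ^ (2 : ℝ) * X j) := by
          refine tsum_congr fun J => ?_
          split_ifs
          · congr 2
            ring
          · simp
      _ = geomConst (2 - p) * (((2 : ℝ≥0∞) ^ j) ^ (-(2 - p)) * ((2 : ℝ≥0∞) ^ j) ^ (2 : ℝ)) * X j := by
          rw [ENNReal.tsum_mul_right, this]
          ring
      _ = _ := by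
          rw [two_zpow_mul]
          congr 3
          ring
  have hS2 : ∑' J : ℤ, ((2 : ℝ≥0∞) ^ J) ^ p * (((2 : ℝ≥0∞) ^ J) ^ (-1 : ℝ) *
      ∑' j : ℤ, if J ≤ j then ((2 : ℝ≥0∞) ^ j) ^ (1 : ℝ) * X j else 0)
      = geomConst (p - 1) * ∑' j : ℤ, ((2 : ℝ≥0∞) ^ j) ^ p * X j := by
    rw [← ENNReal.tsum_mul_left]
    simp only [← mul_assoc, two_zpow_mul, ← ENNReal.tsum_mul_left]
    rw [ENNReal.tsum_comm]
    refine tsum_congr fun j => ?_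
    have := tsum_two_zpow_le j (p - 1)
    calc _ = ∑' J : ℤ, (if J ≤ j then ((2 : ℝ≥0∞) ^ J) ^ (p - 1) else 0) *
          (((2 : ℝ≥0∞) ^ j) ^ (1 : ℝ) * X j) := by
          refine tsum_congr fun J => ?_
          split_ifs
          · congr 2
          · simp
      _ = geomConst (p - 1) * (((2 : ℝ≥0∞) ^ j) ^ (p - 1) * ((2 : ℝ≥0∞) ^ j) ^ (1 : ℝ)) * X j := by
          rw [ENNReal.tsum_mul_right, this]
          ring
      _ = _ := by
          rw [two_zpow_mul]
          congr 3
          ring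
  calc ∫⁻ x, seqSquare (kernelOp A c) x ^ p
      ≤ 2 ^ p * ∑' J : ℤ, ((2 : ℝ≥0∞) ^ J) ^ p *
          volume {x | (2 : ℝ≥0∞) ^ J < seqSquare (kernelOp A c) x} :=
        lintegral_rpow_le_tsum_layer (measurable_seqSquare _) hp0
    _ = 2 ^ p * ∑' J : ℤ, ((2 : ℝ≥0∞) ^ (J + 1)) ^ p *
          volume {x | (2 : ℝ≥0∞) ^ (J + 1) < seqSquare (kernelOp A c) x} := by
        congr 1
        exact ((Equiv.addRight (1 : ℤ)).tsum_eq _).symm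
    _ = 2 ^ (2 * p) * ∑' J : ℤ, ((2 : ℝ≥0∞) ^ J) ^ p *
          volume {x | (2 : ℝ≥0∞) ^ (J + 1) < seqSquare (kernelOp A c) x} := by
        rw [← ENNReal.tsum_mul_left, ← ENNReal.tsum_mul_left]
        refine tsum_congr fun J => ?_
        rw [← mul_assoc, ← mul_assoc, two_zpow_rpow, two_zpow_rpow, ← two_rpow_add,
          ← two_rpow_add]
        congr 2
        push_cast
        ring
    _ ≤ 2 ^ (2 * p) * ∑' J : ℤ, (Q ^ 2 * (8 * coverConst d) * (((2 : ℝ≥0∞) ^ J) ^ p *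
          (((2 : ℝ≥0∞) ^ J) ^ (-2 : ℝ) *
            ∑' j : ℤ, if j ≤ J then ((2 : ℝ≥0∞) ^ j) ^ (2 : ℝ) * X j else 0)) +
          hardyConst d Q * (((2 : ℝ≥0∞) ^ J) ^ p * (((2 : ℝ≥0∞) ^ J) ^ (-1 : ℝ) *
            ∑' j : ℤ, if J ≤ j then ((2 : ℝ≥0∞) ^ j) ^ (1 : ℝ) * X j else 0))) := by
        refine mul_le_mul' le_rfl (ENNReal.tsum_le_tsum fun J => ?_)
        refine (mul_le_mul' le_rfl ((hlev J).trans (add_le_add (hL J) (hH J)))).trans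
          (le_of_eq ?_)
        ring
    _ = 2 ^ (2 * p) * ((Q ^ 2 * (8 * coverConst d) * geomConst (2 - p) +
          hardyConst d Q * geomConst (p - 1)) * ∑' j : ℤ, ((2 : ℝ≥0∞) ^ j) ^ p * X j) := by
        rw [ENNReal.tsum_add, ENNReal.tsum_mul_left, ENNReal.tsum_mul_left, hS1, hS2]
        ring
    _ ≤ _ := by
        refine (mul_le_mul' le_rfl (mul_le_mul' le_rfl hlayer)).trans (le_of_eq ?_)
        rw [lpConst]
        ring

end LevelSets

end MultiParam

namespace MultiParam

/-! ### Sums over product index sets and the Schur test -/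

theorem tsum_pi_prod {κ : Type*} {d : ℕ} (f : Fin d → κ → ℝ≥0∞) :
    ∑' k : Fin d → κ, ∏ i, f i (k i) = ∏ i, ∑' k, f i k := by
  induction d with
  | zero => simp
  | succ d ih =>
    rw [← (Fin.consEquiv fun _ : Fin (d + 1) => κ).tsum_eq, ENNReal.tsum_prod', Fin.prod_univ_succ,
      ← ih fun i => f i.succ, ← ENNReal.tsum_mul_right]
    refine tsum_congr fun a => ?_
    rw [← ENNReal.tsum_mul_left]
    refine tsum_congr fun k => ?_
    simp [Fin.consEquiv, Fin.prod_univ_succ]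

theorem tsum_mul_sq_le {ι : Type*} (f g : ι → ℝ≥0∞) :
    (∑' i, f i * g i) ^ 2 ≤ (∑' i, f i ^ 2) * ∑' i, g i ^ 2 := by
  have h : ∑' i, f i * g i ≤ l2norm f * l2norm g := by
    rw [ENNReal.tsum_eq_iSup_sum]
    refine iSup_le fun s => ?_
    have := ENNReal.inner_le_Lp_mul_Lq s f g Real.HolderConjugate.two_two
    simp only [ENNReal.rpow_ofNat] at this
    exact this.trans (mul_le_mul' (l2norm_le_iff.1 le_rfl s) (l2norm_le_iff.1 le_rfl s))
  calc _ ≤ (l2norm f * l2norm g) ^ 2 := by gcongr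
    _ = _ := by rw [mul_pow, l2norm_sq, l2norm_sq]

theorem tsum_weight_mul_sq_le {ι : Type*} (w g : ι → ℝ≥0∞) :
    (∑' i, w i * g i) ^ 2 ≤ (∑' i, w i) * ∑' i, w i * g i ^ 2 := by
  have h := tsum_mul_sq_le (fun i => w i ^ (1 / 2 : ℝ)) (fun i => w i ^ (1 / 2 : ℝ) * g i)
  simp only [mul_pow, rpow_half_sq, ← mul_assoc] at h
  simpa only [← pow_two, rpow_half_sq] using h

/-! ### Product matrices -/

section ProductKernel

variable {d : ℕ}

/-- Schur's test: Cauchy-Schwarz in each row, then the column sums. -/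
theorem l2norm_kernelOp_le {A : DyadicRect d → DyadicRect d → ℝ≥0∞} {ρ γ : ℝ≥0∞}
    (hρ : ∀ R, ∑' R', A R R' ≤ ρ) (hγ : ∀ R', ∑' R, A R R' ≤ γ) (c : DyadicRect d → ℝ≥0∞) :
    l2norm (kernelOp A c) ≤ (ρ * γ) ^ (1 / 2 : ℝ) * l2norm c := by
  unfold l2norm
  rw [← ENNReal.mul_rpow_of_nonneg _ _ (by norm_num)]
  refine ENNReal.rpow_le_rpow ?_ (by norm_num)
  calc ∑' R, kernelOp A c R ^ 2 ≤ ∑' R, ρ * ∑' R', A R R' * c R' ^ 2 := by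
        refine ENNReal.tsum_le_tsum fun R => (tsum_weight_mul_sq_le _ _).trans ?_
        gcongr
        exact hρ R
    _ = ρ * ∑' R', (∑' R, A R R') * c R' ^ 2 := by
        rw [ENNReal.tsum_mul_left, ENNReal.tsum_comm]
        simp only [ENNReal.tsum_mul_right]
    _ ≤ ρ * ∑' R', γ * c R' ^ 2 := by
        gcongr with R'
        exact hγ R'
    _ = _ := by rw [ENNReal.tsum_mul_left, mul_assoc]

/-- Row and column sums of a product matrix factor over the coordinates, so Schur's test gives the
$\ell^2$ bound. By `hsub` the image of `c` lives in the union of the dilates of the rectangles of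
`c`; the measure of that union, through Cauchy-Schwarz, accounts for the factor `2 * r i` in `hq`.
-/
theorem isAtomicallyBounded_prod {a : Fin d → DyadicInterval → DyadicInterval → ℝ≥0∞}
    {ρ γ q : Fin d → ℝ≥0∞} {r : Fin d → ℝ} (hr : ∀ i, 1 / 2 ≤ r i)
    (hρ : ∀ i I, ∑' I', a i I I' ≤ ρ i) (hγ : ∀ i I', ∑' I, a i I I' ≤ γ i)
    (hsub : ∀ i I I', a i I I' ≠ 0 → I.toSet ⊆ I'.dil (r i))
    (hq : ∀ i, ENNReal.ofReal (2 * r i) * (ρ i * γ i) ≤ q i ^ 2) :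
    IsAtomicallyBounded (fun R R' : DyadicRect d => ∏ i, a i (R i) (R' i)) (∏ i, q i) := by
  have hl2 : ∀ c, l2norm (kernelOp (fun R R' : DyadicRect d => ∏ i, a i (R i) (R' i)) c) ≤
      ((∏ i, ρ i) * ∏ i, γ i) ^ (1 / 2 : ℝ) * l2norm c := by
    refine l2norm_kernelOp_le (fun R => ?_) fun R' => ?_
    · rw [tsum_pi_prod fun i I' => a i (R i) I']
      exact Finset.prod_le_prod' fun i _ => hρ i (R i)
    · rw [tsum_pi_prod fun i I => a i I (R' i)]
      exact Finset.prod_le_prod' fun i _ => hγ i (R' i)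
  have hq1 : ((∏ i, ENNReal.ofReal (2 * r i)) * ((∏ i, ρ i) * ∏ i, γ i)) ^ (1 / 2 : ℝ) ≤
      ∏ i, q i := by
    rw [← Finset.prod_mul_distrib, ← Finset.prod_mul_distrib]
    refine le_trans (ENNReal.rpow_le_rpow ((Finset.prod_le_prod' fun i _ => hq i).trans
      (le_of_eq (Finset.prod_pow _ 2 q))) (by norm_num)) (le_of_eq (sq_rpow_half _))
  have hone : 1 ≤ ∏ i, ENNReal.ofReal (2 * r i) :=
    Finset.one_le_prod' fun i _ => by
      rw [ENNReal.one_le_ofReal]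
      linarith [hr i]
  refine ⟨fun c => (hl2 c).trans (mul_le_mul' (le_trans ?_ hq1) le_rfl), fun c => ?_⟩
  · refine ENNReal.rpow_le_rpow ?_ (by norm_num)
    exact le_mul_of_one_le_left zero_le hone
  · set A := fun R R' : DyadicRect d => ∏ i, a i (R i) (R' i) with hA
    have hspread : volume (spread (kernelOp A c)) ≤
        (∏ i, ENNReal.ofReal (2 * r i)) * volume (spread c) := by
      refine (measure_mono ?_).trans (DyadicRect.volume_biUnion_dil_le hr {R | c R ≠ 0})
      refine Set.iUnion₂_subset fun R hR => ?_
      have hR' : kernelOp A c R ≠ 0 := hR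
      obtain ⟨R', hR'⟩ : ∃ R', A R R' * c R' ≠ 0 := by
        by_contra h
        push Not at h
        exact hR' (by simp [kernelOp, h])
      have hAR := left_ne_zero_of_mul hR'
      have hcR := right_ne_zero_of_mul hR'
      refine (Set.pi_mono fun i _ => hsub i (R i) (R' i)
        (Finset.prod_ne_zero_iff.1 hAR i (Finset.mem_univ i))).trans
        (Set.subset_biUnion_of_mem (u := fun R : DyadicRect d => R.dil r)
          (show R' ∈ {R | c R ≠ 0} from hcR))
    calc _ ≤ volume (spread (kernelOp A c)) ^ (1 / 2 : ℝ) * l2norm (kernelOp A c) :=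
          lintegral_seqSquare_le _
      _ ≤ ((∏ i, ENNReal.ofReal (2 * r i)) * volume (spread c)) ^ (1 / 2 : ℝ) *
            (((∏ i, ρ i) * ∏ i, γ i) ^ (1 / 2 : ℝ) * l2norm c) := by
          gcongr
          exact hl2 c
      _ = ((∏ i, ENNReal.ofReal (2 * r i)) * ((∏ i, ρ i) * ∏ i, γ i)) ^ (1 / 2 : ℝ) *
            (volume (spread c) ^ (1 / 2 : ℝ) * l2norm c) := by
          rw [ENNReal.mul_rpow_of_nonneg _ _ (by norm_num),
            ENNReal.mul_rpow_of_nonneg (∏ i, ENNReal.ofReal (2 * r i)) _ (by norm_num)]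
          ring
      _ ≤ _ := by gcongr

end ProductKernel

/-! ### The matrix majorizing Haar coefficients of localized functions -/

/-- At most $2r/\delta+1$ points of a translated lattice of step $\delta$ lie in an interval of
radius $r$. -/
theorem tsum_ite_abs_le {δ : ℝ} (hδ : 0 < δ) (x y r : ℝ) (hr : 0 ≤ r) (v : ℝ≥0∞) :
    ∑' j : ℤ, (if |(j + y) * δ - x| ≤ r then v else 0) ≤ ENNReal.ofReal (2 * r / δ + 1) * v := by
  classical
  set s := Finset.Icc ⌈(x - r) / δ - y⌉ ⌊(x + r) / δ - y⌋ with hs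
  have hmem : ∀ j : ℤ, |(j + y) * δ - x| ≤ r → j ∈ s := by
    intro j hj
    rw [abs_le] at hj
    rw [hs, Finset.mem_Icc, Int.ceil_le, Int.le_floor, sub_le_iff_le_add, le_sub_iff_add_le,
      div_le_iff₀ hδ, le_div_iff₀ hδ]
    constructor <;> linarith
  rw [tsum_eq_sum (s := s) fun j hj => if_neg fun h => hj (hmem j h)]
  calc _ ≤ ∑ _j ∈ s, v := Finset.sum_le_sum fun j _ => by split_ifs <;> simp
    _ = (s.card : ℝ≥0∞) * v := by rw [Finset.sum_const, nsmul_eq_mul]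
    _ ≤ _ := by
        gcongr
        rw [← ENNReal.ofReal_natCast]
        refine ENNReal.ofReal_le_ofReal ?_
        rw [hs, Int.card_Icc]
        have h1 := Int.floor_le ((x + r) / δ - y)
        have h2 := Int.le_ceil ((x - r) / δ - y)
        have h3 : (x + r) / δ - y - ((x - r) / δ - y) = 2 * r / δ := by ring
        have h4 : (0 : ℝ) ≤ 2 * r / δ := by positivity
        rcases le_total 0 (⌊(x + r) / δ - y⌋ + 1 - ⌈(x - r) / δ - y⌉) with h | h
        · have : ((⌊(x + r) / δ - y⌋ + 1 - ⌈(x - r) / δ - y⌉).toNat : ℝ) =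
              ((⌊(x + r) / δ - y⌋ + 1 - ⌈(x - r) / δ - y⌉ : ℤ) : ℝ) := by
            exact_mod_cast congrArg (Int.cast (R := ℝ)) (Int.toNat_of_nonneg h)
          rw [this]
          push_cast
          linarith
        · rw [Int.toNat_of_nonpos h]
          simp only [Nat.cast_zero]
          linarith

namespace DyadicInterval

/-- The incidence relation: `I'` is at most as long as `I` and close to it, or longer than `I` with
a discontinuity of its Haar function close to `I`. -/
def Near (m : ℕ) (I I' : DyadicInterval) : Prop :=
  (I'.1 ≤ I.1 ∧ |I'.center - I.center| ≤ (2 ^ (m + 1) + 1) * I.length) ∨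
  (I.1 < I'.1 ∧ ∃ e : Fin 3, |I.center - (I'.2 + (e : ℕ) / 2) * I'.length| ≤ 2 ^ (m + 1) * I.length)

/-- The decay in the difference `k` of the scales. -/
noncomputable def scaleDecay (k : ℤ) : ℝ≥0∞ := if 0 ≤ k then 2 ^ (-(5 / 4) * k : ℝ) else 2 ^ (k / 2 : ℝ)

theorem length_eq_of_scale {I I' : DyadicInterval} {k : ℤ} (h : I.1 - I'.1 = k) :
    I.length = 2 ^ k * I'.length := by
  unfold length
  rw [← zpow_add₀ two_ne_zero]
  congr 1
  omega

theorem Near.subset_dil {m : ℕ} {I I' : DyadicInterval} (h : Near m I I') :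
    I.toSet ⊆ I'.dil (2 * 2 ^ (m + 1) * 2 ^ (max (I.1 - I'.1) 0)) := by
  have hM : (2 : ℝ) ≤ 2 ^ (m + 1) := by
    rw [pow_succ]
    linarith [one_le_pow₀ (M₀ := ℝ) one_le_two (n := m)]
  have hI := I.length_pos
  have hI' := I'.length_pos
  intro x hx
  have hx1 := mem_dil.1 (toSet_subset_dil le_rfl I hx)
  rw [mem_dil]
  have hlen := length_eq_of_scale (I := I) (I' := I') rfl
  set M : ℝ := 2 ^ (m + 1) with hMdef
  rcases h with ⟨h1, h2⟩ | ⟨h1, e, h2⟩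
  · rw [max_eq_left (by omega), mul_assoc, ← hlen]
    rw [abs_le] at *
    constructor <;> nlinarith
  · rw [max_eq_right (by omega), zpow_zero, mul_one]
    have h3 : I.length ≤ I'.length := by
      unfold length
      exact zpow_le_zpow_right₀ one_le_two h1.le
    have he : ((e : ℕ) : ℝ) ≤ 2 := by
      have := e.2
      exact_mod_cast (by omega : (e : ℕ) ≤ 2)
    have he0 : (0 : ℝ) ≤ ((e : ℕ) : ℝ) := Nat.cast_nonneg _
    have h4 : |(I'.2 + (e : ℕ) / 2) * I'.length - I'.center| ≤ 1 / 2 * I'.length := by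
      rw [center, abs_le]
      constructor <;> nlinarith
    have h5 : M * I.length ≤ M * I'.length := by gcongr
    have h6 : 2 * I'.length ≤ M * I'.length := by gcongr
    rw [abs_le] at *
    constructor <;> nlinarith

theorem tsum_scale (k : ℤ) (f : DyadicInterval → ℝ≥0∞) :
    ∑' I : DyadicInterval, (if I.1 = k then f I else 0) = ∑' j : ℤ, f (k, j) := by
  rw [ENNReal.tsum_prod', tsum_eq_single k]
  · simp
  · intro k' hk
    simp [hk]

/-- For `k ≥ 0` there are about $2^k$ shorter intervals per length of `I`, hence the factor `2 ^ max
k 0`. For `k < 0` the interval `I'` is longer than `I` and only $O(2^m)$ of them come close. -/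
theorem tsum_near_row_le (m : ℕ) (k : ℤ) (v : ℝ≥0∞) (I : DyadicInterval) :
    ∑' I', (open Classical in if I.1 - I'.1 = k ∧ Near m I I' then v else 0) ≤
      ENNReal.ofReal (8 * 2 ^ (m + 1) * 2 ^ (max k 0)) * v := by
  classical
  have hM : (2 : ℝ) ≤ 2 ^ (m + 1) := by
    rw [pow_succ]
    linarith [one_le_pow₀ (M₀ := ℝ) one_le_two (n := m)]
  set M : ℝ := 2 ^ (m + 1) with hMdef
  have hI := I.length_pos
  have hscale : ∀ I' : DyadicInterval, (if I.1 - I'.1 = k ∧ Near m I I' then v else 0) =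
      if I'.1 = I.1 - k then (if Near m I I' then v else 0) else 0 := by
    intro I'
    by_cases h : I'.1 = I.1 - k
    · simp [h]
    · rw [if_neg h, if_neg fun h' => h (by omega)]
  simp only [hscale]
  rw [tsum_scale]
  set δ : ℝ := 2 ^ (I.1 - k) with hδ
  have hδ0 : 0 < δ := by positivity
  have hlen : I.length = 2 ^ k * δ := by
    rw [hδ, length, ← zpow_add₀ two_ne_zero]
    congr 1
    omega
  rcases le_or_gt 0 k with hk | hk
  · have hle : (1 : ℝ) ≤ 2 ^ k := one_le_zpow₀ one_le_two hk
    calc _ ≤ ∑' j : ℤ, (if |(j + (1 / 2 : ℝ)) * δ - I.center| ≤ (M + 1) * I.length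
          then v else 0) := by
          refine ENNReal.tsum_le_tsum fun j => ?_
          by_cases h : Near m I (I.1 - k, j)
          · rw [if_pos h, if_pos]
            rcases h with ⟨-, h⟩ | ⟨h, -⟩
            · exact h
            · simp only at h
              omega
          · rw [if_neg h]
            exact zero_le
      _ ≤ _ := tsum_ite_abs_le hδ0 _ _ _ (by positivity) v
      _ ≤ _ := by
          gcongr
          rw [max_eq_left hk, hlen]
          have : 2 * ((M + 1) * (2 ^ k * δ)) / δ = 2 * ((M + 1) * 2 ^ k) := by field_simp
          rw [this]
          nlinarith
  · calc _ ≤ ∑' j : ℤ, (if |(j + (1 / 2 : ℝ)) * δ - I.center| ≤ M * I.length + δ / 2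
          then v else 0) := by
          refine ENNReal.tsum_le_tsum fun j => ?_
          by_cases h : Near m I (I.1 - k, j)
          · rw [if_pos h, if_pos]
            rcases h with ⟨h, -⟩ | ⟨-, e, h⟩
            · simp only at h
              omega
            · have he : ((e : ℕ) : ℝ) ≤ 2 := by
                have := e.2
                exact_mod_cast (by omega : (e : ℕ) ≤ 2)
              have he0 : (0 : ℝ) ≤ ((e : ℕ) : ℝ) := Nat.cast_nonneg _
              have h' : |I.center - (j + (e : ℕ) / 2) * δ| ≤ M * I.length := h
              rw [abs_le] at h' ⊢
              constructor <;> nlinarith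
          · rw [if_neg h]
            exact zero_le
      _ ≤ _ := tsum_ite_abs_le hδ0 _ _ _ (by positivity) v
      _ ≤ _ := by
          gcongr
          rw [max_eq_right hk.le, hlen]
          have hle : (2 : ℝ) ^ k ≤ 1 := zpow_le_one_of_nonpos₀ one_le_two hk.le
          have : 2 * (M * (2 ^ k * δ) + δ / 2) / δ = 2 * (M * 2 ^ k) + 1 := by field_simp
          rw [this, zpow_zero]
          nlinarith

/-- No factor depends on `k`: a long `I'` contains many short `I`, but only those near one of the
three jumps of its Haar function count. -/
theorem tsum_near_col_le (m : ℕ) (k : ℤ) (v : ℝ≥0∞) (I' : DyadicInterval) :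
    ∑' I, (open Classical in if I.1 - I'.1 = k ∧ Near m I I' then v else 0) ≤
      ENNReal.ofReal (8 * 2 ^ (m + 1)) * v := by
  classical
  have hM : (2 : ℝ) ≤ 2 ^ (m + 1) := by
    rw [pow_succ]
    linarith [one_le_pow₀ (M₀ := ℝ) one_le_two (n := m)]
  set M : ℝ := 2 ^ (m + 1) with hMdef
  have hscale : ∀ I : DyadicInterval, (if I.1 - I'.1 = k ∧ Near m I I' then v else 0) =
      if I.1 = I'.1 + k then (if Near m I I' then v else 0) else 0 := by
    intro I
    by_cases h : I.1 = I'.1 + k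
    · simp [h]
    · rw [if_neg h, if_neg fun h' => h (by omega)]
  simp only [hscale]
  rw [tsum_scale]
  set δ : ℝ := 2 ^ (I'.1 + k) with hδ
  have hδ0 : 0 < δ := by positivity
  rcases le_or_gt 0 k with hk | hk
  · calc _ ≤ ∑' j : ℤ, (if |(j + (1 / 2 : ℝ)) * δ - I'.center| ≤ (M + 1) * δ
          then v else 0) := by
          refine ENNReal.tsum_le_tsum fun j => ?_
          by_cases h : Near m (I'.1 + k, j) I'
          · rw [if_pos h, if_pos]
            rcases h with ⟨-, h⟩ | ⟨h, -⟩
            · rw [abs_sub_comm]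
              exact h
            · simp only at h
              omega
          · rw [if_neg h]
            exact zero_le
      _ ≤ _ := tsum_ite_abs_le hδ0 _ _ _ (by positivity) v
      _ ≤ _ := by
          gcongr
          have : 2 * ((M + 1) * δ) / δ = 2 * (M + 1) := by field_simp
          rw [this]
          nlinarith
  · calc _ ≤ ∑' j : ℤ, ∑ e : Fin 3, (if |(j + (1 / 2 : ℝ)) * δ - (I'.2 + (e : ℕ) / 2) * I'.length|
          ≤ M * δ then v else 0) := by
          refine ENNReal.tsum_le_tsum fun j => ?_
          by_cases h : Near m (I'.1 + k, j) I'
          · rw [if_pos h]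
            rcases h with ⟨h, -⟩ | ⟨-, e, h⟩
            · simp only at h
              omega
            · refine le_trans (le_of_eq ?_) (Finset.single_le_sum (fun _ _ => zero_le)
                (Finset.mem_univ e))
              exact (if_pos h).symm
          · rw [if_neg h]
            exact zero_le
      _ = ∑ e : Fin 3, ∑' j : ℤ, (if |(j + (1 / 2 : ℝ)) * δ - (I'.2 + (e : ℕ) / 2) * I'.length|
          ≤ M * δ then v else 0) := Summable.tsum_finsetSum fun _ _ => ENNReal.summable
      _ ≤ ∑ _e : Fin 3, ENNReal.ofReal (2 * (M * δ) / δ + 1) * v :=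
          Finset.sum_le_sum fun e _ => tsum_ite_abs_le hδ0 _ _ _ (by positivity) v
      _ = ENNReal.ofReal (3 * (2 * M + 1)) * v := by
          have : 2 * (M * δ) / δ = 2 * M := by field_simp
          rw [this, Finset.sum_const, Finset.card_univ, Fintype.card_fin, nsmul_eq_mul, ← mul_assoc,
            ENNReal.ofReal_mul (by norm_num)]
          norm_num
      _ ≤ _ := mul_le_mul' (ENNReal.ofReal_le_ofReal (by linarith)) le_rfl

/-- The matrix majorizing the Haar coefficients of functions localized at distance `2^m`. -/
noncomputable def nearKernel (B : ℝ≥0) (m : ℕ) (I I' : DyadicInterval) : ℝ≥0∞ :=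
  open Classical in
  if Near m I I' then 4 * B * (2 : ℝ≥0∞) ^ (-5 * m : ℝ) * scaleDecay (I.1 - I'.1) else 0

/-- The part of `nearKernel` with a prescribed difference of scales. -/
noncomputable def nearKernelAt (B : ℝ≥0) (m : ℕ) (k : ℤ) (I I' : DyadicInterval) : ℝ≥0∞ :=
  open Classical in
  if I.1 - I'.1 = k ∧ Near m I I' then 4 * B * (2 : ℝ≥0∞) ^ (-5 * m : ℝ) * scaleDecay k else 0

theorem nearKernel_eq_tsum (B : ℝ≥0) (m : ℕ) (I I' : DyadicInterval) :
    nearKernel B m I I' = ∑' k, nearKernelAt B m k I I' := by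
  classical
  rw [tsum_eq_single (I.1 - I'.1)]
  · simp [nearKernel, nearKernelAt]
  · intro k hk
    simp [nearKernelAt, hk.symm]

/-- The bound for the part of `nearKernel` with a prescribed difference of scales. -/
noncomputable def nearWeight (B : ℝ≥0) (m : ℕ) (k : ℤ) : ℝ≥0∞ :=
  256 * B * (2 : ℝ≥0∞) ^ (-3 * m : ℝ) * 2 ^ (-(1 / 4) * |k| : ℝ)

/-- The exponent 5/4 in `scaleDecay` exceeds 1, so a quarter of a power survives the growth of the
row sums and of the spread. -/
theorem two_zpow_max_mul_scaleDecay_le (k : ℤ) :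
    (2 : ℝ≥0∞) ^ ((max k 0 : ℤ) : ℝ) * scaleDecay k ≤ 2 ^ (-(1 / 4) * |k| : ℝ) := by
  unfold scaleDecay
  split_ifs with h
  · rw [← two_rpow_add, max_eq_left h]
    have h' : (0 : ℝ) ≤ k := by exact_mod_cast h
    rw [Int.cast_abs, abs_of_nonneg h']
    gcongr
    · norm_num
    · linarith
  · push Not at h
    rw [max_eq_right h.le]
    have h' : (k : ℝ) < 0 := by exact_mod_cast h
    rw [Int.cast_abs, abs_of_neg h']
    simp only [Int.cast_zero, ENNReal.rpow_zero, one_mul]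
    gcongr
    · norm_num
    · linarith

theorem ofReal_two_rpow (x : ℝ) : ENNReal.ofReal ((2 : ℝ) ^ x) = 2 ^ x := by
  rw [← ENNReal.ofReal_rpow_of_pos two_pos]
  norm_num

theorem ofReal_two_pow (n : ℕ) : ENNReal.ofReal ((2 : ℝ) ^ n) = 2 ^ (n : ℝ) := by
  rw [← ofReal_two_rpow, Real.rpow_natCast]

theorem ofReal_two_zpow (n : ℤ) : ENNReal.ofReal ((2 : ℝ) ^ n) = 2 ^ (n : ℝ) := by
  rw [← ofReal_two_rpow, Real.rpow_intCast]

/-- With $T=2^{m_i+1}$, $P=2^{\max(k_i,0)}$ and matrix entry $v$, the dilation costs $4TP$, rows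
$8TPv$ and columns $8Tv$. The root of the product is at most $16T^2Pv$; the factor $2^{-5m_i}$ in
$v$ absorbs $T^2$ leaving $2^{-3m_i}$, and the scale decay absorbs $P$. -/
theorem isAtomicallyBounded_nearKernelAt {d : ℕ} (B : ℝ≥0) (m : Fin d → ℕ) (k : Fin d → ℤ) :
    IsAtomicallyBounded (fun R R' : DyadicRect d => ∏ i, nearKernelAt B (m i) (k i) (R i) (R' i))
      (∏ i, nearWeight B (m i) (k i)) := by
  classical
  refine isAtomicallyBounded_prod (r := fun i => 2 * 2 ^ (m i + 1) * 2 ^ (max (k i) 0))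
    (fun i => ?_) (fun i I => tsum_near_row_le (m i) (k i) _ I)
    (fun i I' => tsum_near_col_le (m i) (k i) _ I') (fun i I I' h => ?_) (fun i => ?_)
  · have h1 : (1 : ℝ) ≤ 2 ^ (m i + 1) := one_le_pow₀ one_le_two
    have h2 : (1 : ℝ) ≤ 2 ^ (max (k i) 0) := one_le_zpow₀ one_le_two (le_max_right _ _)
    nlinarith
  · unfold nearKernelAt at h
    split_ifs at h with hn
    · rw [← hn.1]
      exact hn.2.subset_dil
    · exact absurd rfl h
  · have e : ∀ c : ℝ, 0 ≤ c → ENNReal.ofReal (c * 2 ^ (m i + 1) * 2 ^ (max (k i) 0)) =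
        ENNReal.ofReal c * 2 ^ ((m i : ℝ) + 1) * 2 ^ ((max (k i) 0 : ℤ) : ℝ) := by
      intro c hc
      rw [ENNReal.ofReal_mul (by positivity), ENNReal.ofReal_mul hc, ofReal_two_pow,
        ofReal_two_zpow]
      push_cast
      rfl
    have e1 : (2 : ℝ) * (2 * 2 ^ (m i + 1) * 2 ^ (max (k i) 0)) =
      4 * 2 ^ (m i + 1) * 2 ^ (max (k i) 0) := by ring
    have e2 : ENNReal.ofReal (8 * 2 ^ (m i + 1)) = 8 * 2 ^ ((m i : ℝ) + 1) := by
      rw [ENNReal.ofReal_mul (by norm_num), ofReal_two_pow]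
      push_cast
      norm_num
    rw [e1, e 4 (by norm_num), e 8 (by norm_num), e2]
    set T := (2 : ℝ≥0∞) ^ ((m i : ℝ) + 1) with hT
    set P := (2 : ℝ≥0∞) ^ ((max (k i) 0 : ℤ) : ℝ) with hP
    set v := 4 * (B : ℝ≥0∞) * (2 : ℝ≥0∞) ^ (-5 * m i : ℝ) * scaleDecay (k i) with hv
    have hT1 : 1 ≤ T := by
      rw [hT]
      exact ENNReal.one_le_rpow (by norm_num) (by positivity)
    have hTT : T ^ 2 * (2 : ℝ≥0∞) ^ (-5 * m i : ℝ) = 4 * 2 ^ (-3 * m i : ℝ) := by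
      rw [hT, ← ENNReal.rpow_natCast, ← ENNReal.rpow_mul, ← two_rpow_add,
        show (4 : ℝ≥0∞) = 2 ^ (2 : ℝ) by rw [ENNReal.rpow_ofNat]; norm_num, ← two_rpow_add]
      congr 1
      push_cast
      ring
    have h4 : ENNReal.ofReal 4 = 4 := by norm_num
    have h8 : ENNReal.ofReal 8 = 8 := by norm_num
    rw [h4, h8]
    calc 4 * T * P * (8 * T * P * v * (8 * T * v)) = 256 * T ^ 3 * (P * v) ^ 2 := by ring
      _ ≤ 256 * T ^ 4 * (P * v) ^ 2 := by
          exact mul_le_mul' (mul_le_mul' le_rfl (pow_le_pow_right₀ hT1 (by norm_num))) le_rfl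
      _ = (16 * (T ^ 2 * P * v)) ^ 2 := by ring
      _ ≤ _ := by
          gcongr
          calc 16 * (T ^ 2 * P * v)
              = 64 * B * (T ^ 2 * (2 : ℝ≥0∞) ^ (-5 * m i : ℝ)) * (P * scaleDecay (k i)) := by
                rw [hv]; ring
            _ ≤ 64 * B * (T ^ 2 * (2 : ℝ≥0∞) ^ (-5 * m i : ℝ)) * 2 ^ (-(1 / 4) * |k i| : ℝ) := by
                gcongr
                exact two_zpow_max_mul_scaleDecay_le (k i)
            _ = _ := by
                rw [hTT, nearWeight]
                ring

/-- The sum of the weights over all differences of scales, without the decay in `m`. -/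
noncomputable def nearConst (B : ℝ≥0) : ℝ≥0∞ :=
  256 * B * ∑' k : ℤ, (2 : ℝ≥0∞) ^ (-(1 / 4) * |k| : ℝ)

theorem nearConst_lt_top (B : ℝ≥0) : nearConst B < ∞ := by
  refine ENNReal.mul_lt_top (ENNReal.mul_lt_top (by norm_num) ENNReal.coe_lt_top) ?_
  calc ∑' k : ℤ, (2 : ℝ≥0∞) ^ (-(1 / 4) * |k| : ℝ)
      ≤ ∑' k : ℤ, ((if k ≤ 0 then ((2 : ℝ≥0∞) ^ k) ^ (1 / 4 : ℝ) else 0) +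
          if 0 ≤ k then ((2 : ℝ≥0∞) ^ k) ^ (-(1 / 4) : ℝ) else 0) := by
        refine ENNReal.tsum_le_tsum fun k => ?_
        rcases le_total k 0 with h | h
        · refine le_trans (le_of_eq ?_) le_self_add
          rw [if_pos h, two_zpow_rpow, Int.cast_abs, abs_of_nonpos (by exact_mod_cast h)]
          congr 1
          ring
        · refine le_trans (le_of_eq ?_) le_add_self
          rw [if_pos h, two_zpow_rpow, Int.cast_abs, abs_of_nonneg (by exact_mod_cast h)]
          congr 1
          ring
    _ < ∞ := by
        rw [ENNReal.tsum_add, tsum_two_zpow_le, tsum_two_zpow_ge]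
        simp only [zpow_zero, ENNReal.one_rpow, mul_one]
        exact ENNReal.add_lt_top.2 ⟨geomConst_lt_top (by norm_num), geomConst_lt_top (by norm_num)⟩

theorem isAtomicallyBounded_nearKernel {d : ℕ} (B : ℝ≥0) (m : Fin d → ℕ) :
    IsAtomicallyBounded (fun R R' : DyadicRect d => ∏ i, nearKernel B (m i) (R i) (R' i))
      (∏ i, (nearConst B * (2 : ℝ≥0∞) ^ (-3 * m i : ℝ))) := by
  have h := isAtomicallyBounded_tsum fun k => isAtomicallyBounded_nearKernelAt B m k
  simp only [tsum_pi_prod fun i k => nearWeight B (m i) k] at h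
  have e1 : ∀ R R' : DyadicRect d, ∑' k : Fin d → ℤ, ∏ i, nearKernelAt B (m i) (k i) (R i) (R' i) =
      ∏ i, nearKernel B (m i) (R i) (R' i) := by
    intro R R'
    rw [tsum_pi_prod fun i k => nearKernelAt B (m i) k (R i) (R' i)]
    exact Finset.prod_congr rfl fun i _ => (nearKernel_eq_tsum B (m i) _ _).symm
  have e2 : ∀ i, ∑' k, nearWeight B (m i) k = nearConst B * (2 : ℝ≥0∞) ^ (-3 * m i : ℝ) := by
    intro i
    simp only [nearWeight, nearConst, ENNReal.tsum_mul_left]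
    ring
  simpa only [e1, e2] using h

/-- The bound for the sum over all localizations. -/
noncomputable def totalConst (d : ℕ) (B : ℝ≥0) : ℝ≥0∞ := ∏ _i : Fin d, nearConst B * geomConst 3

theorem totalConst_lt_top (d : ℕ) (B : ℝ≥0) : totalConst d B < ∞ :=
  ENNReal.prod_lt_top fun _ _ => ENNReal.mul_lt_top (nearConst_lt_top B)
    (geomConst_lt_top (by norm_num))

theorem isAtomicallyBounded_tsum_nearKernel {d : ℕ} (B : ℝ≥0) :
    IsAtomicallyBounded (fun R R' : DyadicRect d => ∑' m : Fin d → ℕ,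
      ∏ i, nearKernel B (m i) (R i) (R' i)) (totalConst d B) := by
  have h := isAtomicallyBounded_tsum fun m : Fin d → ℕ => isAtomicallyBounded_nearKernel B m
  rw [tsum_pi_prod fun _ (m : ℕ) => nearConst B * (2 : ℝ≥0∞) ^ (-3 * m : ℝ)] at h
  have e : ∑' m : ℕ, nearConst B * (2 : ℝ≥0∞) ^ (-3 * m : ℝ) = nearConst B * geomConst 3 := by
    rw [ENNReal.tsum_mul_left, geomConst]
    congr 2
    funext m
    rw [← ENNReal.rpow_natCast, ← ENNReal.rpow_mul]
  simpa only [e, totalConst] using h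

end DyadicInterval

end MultiParam

namespace MultiParam

/-! ### Haar functions of one variable -/

namespace DyadicInterval

theorem length_left (I : DyadicInterval) : I.left.length = I.length / 2 := by
  unfold left length
  rw [zpow_sub_one₀ two_ne_zero]
  ring

theorem length_right (I : DyadicInterval) : I.right.length = I.length / 2 := by
  unfold right length
  rw [zpow_sub_one₀ two_ne_zero]
  ring

theorem mem_left {I : DyadicInterval} {x : ℝ} : x ∈ I.left.toSet ↔
    (I.2 : ℝ) * I.length ≤ x ∧ x < ((I.2 : ℝ) + 1 / 2) * I.length := by
  rw [mem_toSet, length_left]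
  have : ((I.left.2 : ℤ) : ℝ) = 2 * I.2 := by simp [left]
  rw [this]
  constructor <;> rintro ⟨h1, h2⟩ <;> constructor <;> linarith

theorem mem_right {I : DyadicInterval} {x : ℝ} : x ∈ I.right.toSet ↔
    ((I.2 : ℝ) + 1 / 2) * I.length ≤ x ∧ x < ((I.2 : ℝ) + 1) * I.length := by
  rw [mem_toSet, length_right]
  have : ((I.right.2 : ℤ) : ℝ) = 2 * I.2 + 1 := by simp [right]
  rw [this]
  constructor <;> rintro ⟨h1, h2⟩ <;> constructor <;> linarith

theorem left_subset (I : DyadicInterval) : I.left.toSet ⊆ I.toSet := by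
  intro x hx
  have := I.length_pos
  rw [mem_left] at hx
  rw [mem_toSet]
  constructor <;> nlinarith

theorem right_subset (I : DyadicInterval) : I.right.toSet ⊆ I.toSet := by
  intro x hx
  have := I.length_pos
  rw [mem_right] at hx
  rw [mem_toSet]
  constructor <;> nlinarith

theorem left_union_right (I : DyadicInterval) : I.left.toSet ∪ I.right.toSet = I.toSet := by
  ext x
  rw [Set.mem_union, mem_left, mem_right, mem_toSet]
  have := I.length_pos
  constructor
  · rintro (h | h) <;> constructor <;> nlinarith
  · rintro ⟨h1, h2⟩
    rcases lt_or_ge x (((I.2 : ℝ) + 1 / 2) * I.length) with h | h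
    · exact Or.inl ⟨h1, h⟩
    · exact Or.inr ⟨h, h2⟩

theorem disjoint_left_right (I : DyadicInterval) : Disjoint I.left.toSet I.right.toSet := by
  rw [Set.disjoint_left]
  intro x h1 h2
  rw [mem_left] at h1
  rw [mem_right] at h2
  linarith

theorem haar_of_mem_left {I : DyadicInterval} {x : ℝ} (h : x ∈ I.left.toSet) :
    I.haar x = (I.length ^ (-(1 / 2) : ℝ) : ℝ) := by
  rw [haar, Set.indicator_of_mem h, Set.indicator_of_notMem
    (Set.disjoint_left.1 I.disjoint_left_right h), sub_zero, mul_one]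

theorem haar_of_mem_right {I : DyadicInterval} {x : ℝ} (h : x ∈ I.right.toSet) :
    I.haar x = -(I.length ^ (-(1 / 2) : ℝ) : ℝ) := by
  rw [haar, Set.indicator_of_mem h, Set.indicator_of_notMem
    (Set.disjoint_right.1 I.disjoint_left_right h), zero_sub, mul_neg, mul_one, Complex.ofReal_neg]

theorem haar_of_notMem {I : DyadicInterval} {x : ℝ} (h : x ∉ I.toSet) : I.haar x = 0 := by
  rw [haar, Set.indicator_of_notMem fun h' => h (I.left_subset h'),
    Set.indicator_of_notMem fun h' => h (I.right_subset h')]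
  simp

theorem norm_haar_of_mem {I : DyadicInterval} {x : ℝ} (h : x ∈ I.toSet) :
    ‖I.haar x‖ = I.length ^ (-(1 / 2) : ℝ) := by
  have h0 : 0 ≤ I.length ^ (-(1 / 2) : ℝ) := Real.rpow_nonneg I.length_pos.le _
  rw [← left_union_right] at h
  rcases h with h | h
  · rw [haar_of_mem_left h, Complex.norm_real, Real.norm_of_nonneg h0]
  · rw [haar_of_mem_right h, norm_neg, Complex.norm_real, Real.norm_of_nonneg h0]

theorem norm_haar_le (I : DyadicInterval) (x : ℝ) : ‖I.haar x‖ ≤ I.length ^ (-(1 / 2) : ℝ) := by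
  by_cases h : x ∈ I.toSet
  · rw [norm_haar_of_mem h]
  · rw [haar_of_notMem h, norm_zero]
    exact Real.rpow_nonneg I.length_pos.le _

theorem star_haar (I : DyadicInterval) (x : ℝ) : (starRingEnd ℂ) (I.haar x) = I.haar x := by
  unfold haar
  exact Complex.conj_ofReal _

theorem measurable_haar (I : DyadicInterval) : Measurable I.haar := by
  unfold haar
  exact Complex.measurable_ofReal.comp (measurable_const.mul
    ((measurable_const.indicator I.left.measurableSet_toSet).sub
      (measurable_const.indicator I.right.measurableSet_toSet)))

theorem haar_eq_indicator (I : DyadicInterval) (x : ℝ) : I.haar x =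
    (I.length ^ (-(1 / 2) : ℝ) : ℝ) * (I.left.toSet.indicator (fun _ => (1 : ℂ)) x
      - I.right.toSet.indicator (fun _ => (1 : ℂ)) x) := by
  by_cases h : x ∈ I.toSet
  · rw [← left_union_right] at h
    rcases h with h | h
    · rw [haar_of_mem_left h, Set.indicator_of_mem h, Set.indicator_of_notMem
        (Set.disjoint_left.1 I.disjoint_left_right h)]
      simp
    · rw [haar_of_mem_right h, Set.indicator_of_mem h, Set.indicator_of_notMem
        (Set.disjoint_right.1 I.disjoint_left_right h)]
      simp
  · rw [haar_of_notMem h, Set.indicator_of_notMem fun h' => h (I.left_subset h'),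
      Set.indicator_of_notMem fun h' => h (I.right_subset h')]
    simp

theorem rpow_neg_half_mul_self {a : ℝ} (ha : 0 < a) :
    a ^ (-(1 / 2) : ℝ) * a ^ (-(1 / 2) : ℝ) = a⁻¹ := by
  rw [← Real.rpow_add ha, ← Real.rpow_neg_one]
  norm_num

/-- The average of `ψ` over a dyadic interval. -/
noncomputable def average {E : Type*} [NormedAddCommGroup E] [NormedSpace ℝ E] (ψ : ℝ → E)
    (I : DyadicInterval) : E :=
  (I.length)⁻¹ • ∫ t in I.toSet, ψ t

/-- The Haar coefficient `∫ ψ h_I`. -/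
noncomputable def coef (ψ : ℝ → ℂ) (I : DyadicInterval) : ℂ := ∫ t, ψ t * I.haar t

theorem coef_eq {ψ : ℝ → ℂ} (I : DyadicInterval) (hψ : IntegrableOn ψ I.toSet) :
    coef ψ I = (I.length ^ (-(1 / 2) : ℝ) : ℝ) *
      ((∫ t in I.left.toSet, ψ t) - ∫ t in I.right.toSet, ψ t) := by
  have hl := (hψ.mono_set I.left_subset).integrable_indicator I.left.measurableSet_toSet
  have hr := (hψ.mono_set I.right_subset).integrable_indicator I.right.measurableSet_toSet
  rw [← integral_indicator I.left.measurableSet_toSet,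
    ← integral_indicator I.right.measurableSet_toSet, ← integral_sub hl hr,
    ← integral_const_mul, coef]
  refine integral_congr_ae (Filter.Eventually.of_forall fun t => ?_)
  simp only [haar_eq_indicator, Set.indicator]
  split_ifs <;> simp <;> ring

theorem integral_toSet_eq {E : Type*} [NormedAddCommGroup E] [NormedSpace ℝ E] {ψ : ℝ → E}
    (I : DyadicInterval) (hψ : IntegrableOn ψ I.toSet) :
    ∫ t in I.toSet, ψ t = (∫ t in I.left.toSet, ψ t) + ∫ t in I.right.toSet, ψ t := by
  rw [← left_union_right, setIntegral_union I.disjoint_left_right I.right.measurableSet_toSet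
    (hψ.mono_set I.left_subset) (hψ.mono_set I.right_subset)]

/-- A Haar term is a martingale difference, so Haar series telescope along the chain of dyadic
intervals containing `x`. -/
theorem coef_mul_haar {ψ : ℝ → ℂ} {I : DyadicInterval} (hψ : IntegrableOn ψ I.toSet) {x : ℝ}
    (hx : x ∈ I.toSet) :
    coef ψ I * I.haar x = average ψ (atScale (I.1 - 1) x) - average ψ I := by
  have h0 := I.length_pos
  have hsq : ((I.length ^ (-(1 / 2) : ℝ) : ℝ) : ℂ) * ((I.length ^ (-(1 / 2) : ℝ) : ℝ) : ℂ) =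
      ((I.length)⁻¹ : ℝ) := by
    rw [← Complex.ofReal_mul, rpow_neg_half_mul_self h0]
  rw [coef_eq I hψ, average, average, integral_toSet_eq I hψ]
  rw [← left_union_right] at hx
  simp only [Complex.real_smul]
  rcases hx with hx | hx
  · have : atScale (I.1 - 1) x = I.left := mem_toSet_iff.1 hx
    rw [this, haar_of_mem_left hx, length_left, mul_right_comm, hsq]
    push_cast
    field_simp
    ring
  · have : atScale (I.1 - 1) x = I.right := mem_toSet_iff.1 hx
    rw [this, haar_of_mem_right hx, length_right, mul_neg, neg_eq_neg_one_mul, mul_right_comm, hsq]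
    push_cast
    field_simp
    ring

/-! ### Pointwise convergence of Haar expansions -/

theorem norm_average_le {ψ : ℝ → ℂ} (hψ : Integrable ψ) (I : DyadicInterval) :
    ‖average ψ I‖ ≤ (I.length)⁻¹ * ∫ t, ‖ψ t‖ := by
  rw [average, norm_smul, norm_inv, Real.norm_of_nonneg I.length_pos.le]
  have := I.length_pos
  gcongr
  exact (norm_integral_le_integral_norm _).trans
    (setIntegral_le_integral hψ.norm (Filter.Eventually.of_forall fun _ => norm_nonneg _))

theorem norm_average_sub_le {ψ : ℝ → ℂ} (hψ : Integrable ψ) {L : ℝ}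
    (hL : ∀ x y, ‖ψ x - ψ y‖ ≤ L * |x - y|) {I : DyadicInterval} {x : ℝ} (hx : x ∈ I.toSet) :
    ‖average ψ I - ψ x‖ ≤ L * I.length := by
  have h0 := I.length_pos
  have hL0 : 0 ≤ L := by
    have := (norm_nonneg _).trans (hL 1 0)
    simpa using this
  have hvol : (volume.real I.toSet) = I.length := by
    rw [measureReal_def, volume_toSet, ENNReal.toReal_ofReal h0.le]
  have hconst : ψ x = (I.length)⁻¹ • ∫ _t in I.toSet, ψ x := by
    rw [setIntegral_const, hvol, smul_smul, inv_mul_cancel₀ h0.ne', one_smul]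
  have hfin : volume I.toSet < ∞ := I.volume_toSet_ne_top.lt_top
  rw [average]
  conv_lhs => rw [hconst]
  rw [← smul_sub, ← integral_sub hψ.integrableOn (integrableOn_const hfin.ne),
    norm_smul, norm_inv, Real.norm_of_nonneg h0.le]
  have hb : ‖∫ t in I.toSet, (ψ t - ψ x)‖ ≤ L * I.length * volume.real I.toSet := by
    refine norm_setIntegral_le_of_norm_le_const hfin fun t ht => (hL t x).trans ?_
    gcongr
    rw [mem_toSet] at hx ht
    rw [abs_le]
    constructor <;> nlinarith
  calc _ ≤ (I.length)⁻¹ * (L * I.length * volume.real I.toSet) := by gcongr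
    _ = L * I.length := by
        rw [hvol]
        field_simp

theorem atScale_length (k : ℤ) (x : ℝ) : (atScale k x).length = 2 ^ k := rfl

theorem tendsto_Ioc_neg_atTop : Filter.Tendsto (fun n : ℕ => Finset.Ioc (-(n : ℤ)) n)
    Filter.atTop Filter.atTop := by
  refine Filter.tendsto_atTop_finset_of_monotone (fun a b h => ?_) fun k => ?_
  · exact Finset.Ioc_subset_Ioc (by omega) (by omega)
  · exact ⟨k.natAbs + 1, by simp only [Finset.mem_Ioc]; omega⟩

theorem sum_Ioc_neg (u : ℤ → ℂ) (n : ℕ) :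
    ∑ k ∈ Finset.Ioc (-(n : ℤ)) n, (u (k - 1) - u k) = u (-n) - u n := by
  have key : ∀ (m : ℕ) (a : ℤ), ∑ k ∈ Finset.Ioc a (a + m), (u (k - 1) - u k) = u a - u (a + m) := by
    intro m a
    induction m with
    | zero => simp
    | succ m ih =>
      have : Finset.Ioc a (a + (m + 1 : ℕ)) = insert (a + (m + 1 : ℕ)) (Finset.Ioc a (a + m)) := by
        ext k
        simp only [Finset.mem_Ioc, Finset.mem_insert]
        omega
      rw [this, Finset.sum_insert (by simp), ih]
      push_cast
      have : a + ((m : ℤ) + 1) - 1 = a + m := by ring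
      rw [this]
      ring
  have := key (2 * n) (-n)
  push_cast at this
  rw [show -(n : ℤ) + 2 * n = n by ring] at this
  exact this

theorem summable_two_zpow_neg_abs : Summable fun k : ℤ => (2 : ℝ) ^ (-|k|) := by
  have h : Summable fun n : ℕ => (2 : ℝ) ^ (-(n : ℤ)) := by
    simpa using summable_geometric_two
  refine Summable.of_nat_of_neg ?_ ?_
  · simpa using h
  · simpa using h

/-- A bound for the Haar series of a Lipschitz integrable function, uniform over all points. -/
noncomputable def haarSeriesBound (ψ : ℝ → ℂ) (L : ℝ) : ℝ := 2 * L + 3 * ∫ t, ‖ψ t‖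

/-- At large scales both averages are at most the $L^1$ norm over the length; at small scales both
are close to `ψ x` by the Lipschitz bound. -/
theorem norm_average_sub_average_le {ψ : ℝ → ℂ} (hψ : Integrable ψ) {L : ℝ}
    (hL : ∀ x y, ‖ψ x - ψ y‖ ≤ L * |x - y|) (k : ℤ) (x : ℝ) :
    ‖average ψ (atScale (k - 1) x) - average ψ (atScale k x)‖ ≤
      haarSeriesBound ψ L * 2 ^ (-|k|) := by
  have hL0 : 0 ≤ L := by
    have := (norm_nonneg _).trans (hL 1 0)
    simpa using this
  have hi : 0 ≤ ∫ t, ‖ψ t‖ := integral_nonneg fun _ => norm_nonneg _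
  unfold haarSeriesBound
  rcases le_total 0 k with hk | hk
  · rw [abs_of_nonneg hk]
    calc _ ≤ ‖average ψ (atScale (k - 1) x)‖ + ‖average ψ (atScale k x)‖ := norm_sub_le _ _
      _ ≤ ((2 : ℝ) ^ (k - 1))⁻¹ * (∫ t, ‖ψ t‖) + ((2 : ℝ) ^ k)⁻¹ * ∫ t, ‖ψ t‖ :=
          add_le_add (norm_average_le hψ _) (norm_average_le hψ _)
      _ = 3 * (∫ t, ‖ψ t‖) * 2 ^ (-k) := by
          rw [zpow_sub_one₀ two_ne_zero, zpow_neg, mul_inv, inv_inv]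
          ring
      _ ≤ _ := by
          gcongr
          linarith
  · rw [abs_of_nonpos hk, neg_neg]
    calc _ = ‖(average ψ (atScale (k - 1) x) - ψ x) - (average ψ (atScale k x) - ψ x)‖ := by
          congr 1
          ring
      _ ≤ L * 2 ^ (k - 1) + L * 2 ^ k :=
          (norm_sub_le _ _).trans (add_le_add (norm_average_sub_le hψ hL (mem_atScale _ x))
            (norm_average_sub_le hψ hL (mem_atScale _ x)))
      _ = 3 / 2 * L * 2 ^ k := by
          rw [zpow_sub_one₀ two_ne_zero]
          ring
      _ ≤ _ := by
          gcongr
          linarith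

theorem atScale_injective (x : ℝ) : Function.Injective fun k => atScale k x :=
  fun _ _ h => congrArg Prod.fst h

theorem coef_mul_haar_atScale {ψ : ℝ → ℂ} (hψ : Integrable ψ) (k : ℤ) (x : ℝ) :
    coef ψ (atScale k x) * (atScale k x).haar x =
      average ψ (atScale (k - 1) x) - average ψ (atScale k x) :=
  coef_mul_haar hψ.integrableOn (mem_atScale k x)

theorem haar_of_notMem_range {x : ℝ} {I : DyadicInterval} (h : I ∉ Set.range fun k => atScale k x) :
    I.haar x = 0 :=
  haar_of_notMem fun hx => h ⟨I.1, mem_toSet_iff.1 hx⟩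

theorem tsum_enorm_coef_mul_haar_le {ψ : ℝ → ℂ} (hψ : Integrable ψ) {L : ℝ}
    (hL : ∀ x y, ‖ψ x - ψ y‖ ≤ L * |x - y|) (x : ℝ) :
    ∑' I : DyadicInterval, ‖coef ψ I * I.haar x‖ₑ ≤
      ENNReal.ofReal (haarSeriesBound ψ L * ∑' k : ℤ, (2 : ℝ) ^ (-|k|)) := by
  have hL0 : 0 ≤ L := by
    have := (norm_nonneg _).trans (hL 1 0)
    simpa using this
  have hi : 0 ≤ ∫ t, ‖ψ t‖ := integral_nonneg fun _ => norm_nonneg _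
  have hb : 0 ≤ haarSeriesBound ψ L := by
    unfold haarSeriesBound
    positivity
  rw [← (atScale_injective x).tsum_eq]
  · rw [← tsum_mul_left, ENNReal.ofReal_tsum_of_nonneg
      (fun k => mul_nonneg hb (zpow_nonneg zero_le_two _)) (summable_two_zpow_neg_abs.mul_left _)]
    refine ENNReal.tsum_le_tsum fun k => ?_
    rw [coef_mul_haar_atScale hψ, ← ofReal_norm]
    exact ENNReal.ofReal_le_ofReal (norm_average_sub_average_le hψ hL k x)
  · intro I hI
    by_contra h
    simp [haar_of_notMem_range h] at hI

/-- After telescoping, the averages tend to `ψ x` at small scales by continuity and to 0 at large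
scales by integrability. The convergence holds at every point, which allows products over the
coordinates to be expanded pointwise. -/
theorem hasSum_coef_mul_haar {ψ : ℝ → ℂ} (hψ : Integrable ψ) {L : ℝ}
    (hL : ∀ x y, ‖ψ x - ψ y‖ ≤ L * |x - y|) (x : ℝ) :
    HasSum (fun I : DyadicInterval => coef ψ I * I.haar x) (ψ x) := by
  rw [← (atScale_injective x).hasSum_iff fun I hI => by rw [haar_of_notMem_range hI, mul_zero]]
  have hcomp : ((fun I : DyadicInterval => coef ψ I * I.haar x) ∘ fun k => atScale k x) =
      fun k => average ψ (atScale (k - 1) x) - average ψ (atScale k x) :=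
    funext fun k => coef_mul_haar_atScale hψ k x
  rw [hcomp]
  have hs : Summable fun k => average ψ (atScale (k - 1) x) - average ψ (atScale k x) :=
    Summable.of_norm_bounded (summable_two_zpow_neg_abs.mul_left (haarSeriesBound ψ L))
      fun k => norm_average_sub_average_le hψ hL k x
  have h2 : Filter.Tendsto (fun n : ℕ => ((2 : ℝ) ^ n)⁻¹) Filter.atTop (nhds 0) := by
    simpa using tendsto_pow_atTop_nhds_zero_of_lt_one (r := (2 : ℝ)⁻¹) (by norm_num) (by norm_num)
  have hlim : Filter.Tendsto (fun n : ℕ => average ψ (atScale (-(n : ℤ)) x) -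
      average ψ (atScale (n : ℤ) x)) Filter.atTop (nhds (ψ x - 0)) := by
    refine Filter.Tendsto.sub ?_ ?_
    · rw [tendsto_iff_norm_sub_tendsto_zero]
      refine squeeze_zero (fun _ => norm_nonneg _)
        (fun n => norm_average_sub_le hψ hL (mem_atScale _ x)) ?_
      simpa [atScale_length] using h2.const_mul L
    · rw [tendsto_zero_iff_norm_tendsto_zero]
      refine squeeze_zero (fun _ => norm_nonneg _) (fun n => norm_average_le hψ _) ?_
      simpa [atScale_length] using h2.mul_const (∫ t, ‖ψ t‖)
  rw [sub_zero] at hlim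
  have h3 := (hs.hasSum.comp tendsto_Ioc_neg_atTop)
  simp only [Function.comp_def, sum_Ioc_neg fun k => average ψ (atScale k x)] at h3
  rw [← tendsto_nhds_unique h3 hlim]
  exact hs.hasSum

end DyadicInterval

end MultiParam

namespace MultiParam

namespace DyadicInterval

/-! ### Localized functions and their Haar coefficients -/

/-- A Lipschitz function of mean zero, small of order `2^{-20m}`, supported in the dilate
`2^{m+1} I`. -/
structure IsLocalAtom (B : ℝ) (m : ℕ) (I : DyadicInterval) (ψ : ℝ → ℂ) : Prop where
  size : ∀ x, ‖ψ x‖ ≤ B * 2 ^ (-(20 * m) : ℝ) * I.length ^ (-(1 / 2) : ℝ)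
  lip : ∀ x y, ‖ψ x - ψ y‖ ≤ B * I.length ^ (-(1 / 2) : ℝ) / I.length * |x - y|
  supp : ∀ x, x ∉ I.dil (2 ^ (m + 1)) → ψ x = 0
  mean : ∫ x, ψ x = 0

theorem continuous_of_lip {ψ : ℝ → ℂ} {L : ℝ} (hL : ∀ x y, ‖ψ x - ψ y‖ ≤ L * |x - y|) :
    Continuous ψ := by
  have hL0 : 0 ≤ L := by
    have := (norm_nonneg _).trans (hL 1 0)
    simpa using this
  refine (LipschitzWith.of_dist_le_mul (K := ⟨L, hL0⟩) fun x y => ?_).continuous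
  rw [dist_eq_norm, Real.dist_eq]
  exact hL x y

theorem IsLocalAtom.continuous {B : ℝ} {m : ℕ} {I : DyadicInterval} {ψ : ℝ → ℂ}
    (h : IsLocalAtom B m I ψ) : Continuous ψ := continuous_of_lip h.lip

theorem IsLocalAtom.integrable {B : ℝ} {m : ℕ} {I : DyadicInterval} {ψ : ℝ → ℂ}
    (h : IsLocalAtom B m I ψ) : Integrable ψ :=
  h.continuous.integrable_of_hasCompactSupport
    (HasCompactSupport.intro (isCompact_closedBall I.center (2 ^ (m + 1) * I.length)) h.supp)

theorem length_mul_rpow_neg_half (I : DyadicInterval) :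
    I.length * I.length ^ (-(1 / 2) : ℝ) = I.length ^ (1 / 2 : ℝ) := by
  conv_lhs => rw [← Real.rpow_one I.length, ← Real.rpow_mul I.length_pos.le,
    ← Real.rpow_add I.length_pos]
  norm_num

theorem volume_real_toSet (I : DyadicInterval) : volume.real I.toSet = I.length := by
  rw [measureReal_def, volume_toSet, ENNReal.toReal_ofReal I.length_pos.le]

theorem norm_coef_le_of_bound {ψ : ℝ → ℂ} {I : DyadicInterval} {C : ℝ}
    (h : ∀ t ∈ I.toSet, ‖ψ t‖ ≤ C) : ‖coef ψ I‖ ≤ C * I.length ^ (1 / 2 : ℝ) := by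
  have h0 := I.length_pos
  have hset : coef ψ I = ∫ t in I.toSet, ψ t * I.haar t := by
    refine (setIntegral_eq_integral_of_forall_compl_eq_zero fun t ht => ?_).symm
    rw [haar_of_notMem ht, mul_zero]
  rw [hset]
  calc _ ≤ C * I.length ^ (-(1 / 2) : ℝ) * volume.real I.toSet := by
        refine norm_setIntegral_le_of_norm_le_const I.volume_toSet_ne_top.lt_top fun t ht => ?_
        rw [norm_mul, norm_haar_of_mem ht]
        gcongr
        exact h t ht
    _ = _ := by
        rw [volume_real_toSet, ← length_mul_rpow_neg_half]
        ring

theorem integral_haar (I : DyadicInterval) : ∫ t, I.haar t = 0 := by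
  have h1 : ∫ t in I.left.toSet, (1 : ℂ) = (I.length / 2 : ℝ) := by
    rw [setIntegral_const, volume_real_toSet, length_left]
    simp
  have h2 : ∫ t in I.right.toSet, (1 : ℂ) = (I.length / 2 : ℝ) := by
    rw [setIntegral_const, volume_real_toSet, length_right]
    simp
  have := coef_eq (ψ := fun _ => 1) I (integrableOn_const I.volume_toSet_ne_top)
  rw [h1, h2, sub_self, mul_zero] at this
  simpa [coef] using this

theorem integrable_mul_haar {ψ : ℝ → ℂ} (hψ : Integrable ψ) (I : DyadicInterval) :
    Integrable fun t => ψ t * I.haar t :=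
  hψ.mul_bdd (c := I.length ^ (-(1 / 2) : ℝ)) (measurable_haar I).aestronglyMeasurable
    (Filter.Eventually.of_forall I.norm_haar_le)

theorem integrable_haar (I : DyadicInterval) : Integrable I.haar := by
  have h : I.haar = fun t => I.toSet.indicator (fun _ => (1 : ℂ)) t * I.haar t := by
    funext t
    by_cases ht : t ∈ I.toSet
    · simp [ht]
    · simp [ht, haar_of_notMem ht]
  rw [h]
  exact integrable_mul_haar ((integrable_indicator_iff I.measurableSet_toSet).2
    (integrableOn_const I.volume_toSet_ne_top)) I

/-- The Haar function has mean zero, so the value of `ψ` at the center may be subtracted. -/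
theorem norm_coef_le_of_lip {ψ : ℝ → ℂ} (hψ : Integrable ψ) {L : ℝ}
    (hL : ∀ x y, ‖ψ x - ψ y‖ ≤ L * |x - y|) (I : DyadicInterval) :
    ‖coef ψ I‖ ≤ L * I.length * I.length ^ (1 / 2 : ℝ) := by
  have hL0 : 0 ≤ L := by
    have := (norm_nonneg _).trans (hL 1 0)
    simpa using this
  have h0 := I.length_pos
  have heq : coef ψ I = coef (fun t => ψ t - ψ I.center) I := by
    unfold coef
    simp only [sub_mul]
    rw [integral_sub (integrable_mul_haar hψ I) ((integrable_haar I).const_mul _),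
      integral_const_mul, integral_haar, mul_zero, sub_zero]
  rw [heq]
  refine norm_coef_le_of_bound fun t ht => (hL t _).trans ?_
  have := mem_dil.1 (toSet_subset_dil le_rfl I ht)
  gcongr
  linarith

/-- The endpoints and the midpoint are the only jumps; a ball around `c` that avoids all three stays
on one piece of constancy. -/
theorem haar_eq_of_not_near {I : DyadicInterval} {c r x : ℝ}
    (h : ∀ e : Fin 3, r < |c - (I.2 + (e : ℕ) / 2) * I.length|) (hx : |x - c| ≤ r) :
    I.haar x = I.haar c := by
  have hlt : ∀ e : Fin 3, x < (I.2 + (e : ℕ) / 2) * I.length ↔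
      c < (I.2 + (e : ℕ) / 2) * I.length := by
    intro e
    have h1 := h e
    rw [abs_le] at hx
    rcases lt_abs.1 h1 with h2 | h2
    · constructor <;> intro h3 <;> linarith
    · constructor <;> intro h3 <;> linarith
  have e0 := hlt 0
  have e1 := hlt 1
  have e2 := hlt 2
  simp only [Fin.val_zero, Fin.val_one, Fin.val_two, Nat.cast_zero, Nat.cast_one, Nat.cast_ofNat,
    zero_div, add_zero, div_self (two_ne_zero (α := ℝ))] at e0 e1 e2
  have hl : x ∈ I.left.toSet ↔ c ∈ I.left.toSet := by
    rw [mem_left, mem_left, ← not_lt, ← not_lt (a := c), e0, e1]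
  have hr : x ∈ I.right.toSet ↔ c ∈ I.right.toSet := by
    rw [mem_right, mem_right, ← not_lt, ← not_lt (a := c), e1, e2]
  by_cases h1 : c ∈ I.left.toSet <;> by_cases h2 : c ∈ I.right.toSet <;>
    simp [haar, hl, hr, h1, h2]

/-- For an atom of order $m$ the size bound carries $2^{-20m}$ but only $2^{-k/2}$, the Lipschitz
bound $2^{-3k/2}$ without decay in $m$. The weights 1/4 and 3/4 give $2^{-5m}2^{-5k/4}$, enough in
both parameters. -/
theorem sup_lip_interpolate {x s l : ℝ} (hx : 0 ≤ x) (h1 : x ≤ s) (h2 : x ≤ l) :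
    x ≤ l ^ (3 / 4 : ℝ) * s ^ (1 / 4 : ℝ) := by
  calc x = x ^ (3 / 4 : ℝ) * x ^ (1 / 4 : ℝ) := by
        rw [← Real.rpow_add_of_nonneg hx (by norm_num) (by norm_num)]
        norm_num
    _ ≤ _ := mul_le_mul (Real.rpow_le_rpow hx h2 (by norm_num))
        (Real.rpow_le_rpow hx h1 (by norm_num)) (by positivity)
        (Real.rpow_nonneg (hx.trans h2) _)

/-- Against shorter intervals, size and smoothness of the atom are interpolated; against longer
ones, the size of the Haar function on the support of the atom suffices. Off the incidence relation,
disjoint supports or the mean zero of the atom make the coefficient vanish. -/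
theorem enorm_coef_le_nearKernel {B : ℝ≥0} {m : ℕ} {I : DyadicInterval} {ψ : ℝ → ℂ}
    (h : IsLocalAtom B m I ψ) (I' : DyadicInterval) : ‖coef ψ I'‖ₑ ≤ nearKernel B m I I' := by
  classical
  have hI := I.length_pos
  have hI' := I'.length_pos
  have hB : (0 : ℝ) ≤ B := B.2
  set s := I.length ^ (-(1 / 2) : ℝ) with hs
  have hs0 : 0 < s := Real.rpow_pos_of_pos hI _
  have hM : (1 : ℝ) ≤ 2 ^ (m + 1) := one_le_pow₀ one_le_two
  have hreal : ∀ k : ℤ, I.1 - I'.1 = k → s * I'.length ^ (1 / 2 : ℝ) = 2 ^ (-(k : ℝ) / 2) := by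
    intro k hk
    rw [hs, length_eq_of_scale hk, Real.mul_rpow (by positivity) hI'.le, mul_assoc,
      ← Real.rpow_add hI', ← Real.rpow_intCast, ← Real.rpow_mul zero_le_two]
    norm_num
    congr 1
    ring
  have htoreal : ∀ x : ℝ, 4 * (B : ℝ≥0∞) * (2 : ℝ≥0∞) ^ (-5 * m : ℝ) * 2 ^ x =
      ENNReal.ofReal (4 * B * 2 ^ (-5 * m : ℝ) * 2 ^ x) := by
    intro x
    rw [ENNReal.ofReal_mul (by positivity), ENNReal.ofReal_mul (by positivity),
      ENNReal.ofReal_mul (by positivity), ofReal_two_rpow, ofReal_two_rpow,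
      ENNReal.ofReal_coe_nnreal]
    norm_num
  rcases le_or_gt I'.1 I.1 with hk | hk
  · obtain ⟨k, hk'⟩ : ∃ k, I.1 - I'.1 = k := ⟨_, rfl⟩
    have hk0 : 0 ≤ k := by omega
    by_cases hn : |I'.center - I.center| ≤ (2 ^ (m + 1) + 1) * I.length
    · have hnear : Near m I I' := Or.inl ⟨hk, hn⟩
      rw [nearKernel, if_pos hnear, hk', scaleDecay, if_pos hk0, htoreal, ← ofReal_norm]
      refine ENNReal.ofReal_le_ofReal ?_
      have h1 : ‖coef ψ I'‖ ≤ B * 2 ^ (-(20 * m) : ℝ) * 2 ^ (-(k : ℝ) / 2) := by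
        refine (norm_coef_le_of_bound fun t _ => h.size t).trans (le_of_eq ?_)
        rw [← hreal k hk']
        ring
      have h2 : ‖coef ψ I'‖ ≤ B * 2 ^ (-(3 / 2) * k : ℝ) := by
        refine (norm_coef_le_of_lip h.integrable h.lip I').trans (le_of_eq ?_)
        have h3 : I'.length / I.length = 2 ^ (-(k : ℝ)) := by
          rw [length_eq_of_scale hk', Real.rpow_neg zero_le_two, Real.rpow_intCast]
          field_simp
        calc _ = B * (s * I'.length ^ (1 / 2 : ℝ)) * (I'.length / I.length) := by ring
          _ = _ := by
            rw [hreal k hk', h3, mul_assoc, ← Real.rpow_add two_pos]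
            congr 2
            ring
      refine (sup_lip_interpolate (norm_nonneg _) h1 h2).trans ?_
      rw [Real.mul_rpow hB (by positivity), Real.mul_rpow (by positivity) (by positivity),
        Real.mul_rpow hB (by positivity), ← Real.rpow_mul zero_le_two, ← Real.rpow_mul zero_le_two,
        ← Real.rpow_mul zero_le_two]
      calc _ = ((B : ℝ) ^ (3 / 4 : ℝ) * (B : ℝ) ^ (1 / 4 : ℝ)) *
            (2 ^ (-(20 * m) * (1 / 4) : ℝ) *
              (2 ^ (-(3 / 2) * k * (3 / 4) : ℝ) * 2 ^ (-(k : ℝ) / 2 * (1 / 4)))) := by ring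
        _ = B * (2 ^ (-5 * m : ℝ) * 2 ^ (-(5 / 4) * k : ℝ)) := by
            rw [← Real.rpow_add_of_nonneg hB (by norm_num) (by norm_num), ← Real.rpow_add two_pos,
              show (3 / 4 + 1 / 4 : ℝ) = 1 by norm_num, Real.rpow_one]
            congr 3 <;> ring
        _ ≤ _ := by
            have h5 : 0 ≤ B * (2 ^ (-5 * m : ℝ) * 2 ^ (-(5 / 4) * k : ℝ)) := by positivity
            linarith
    -- A short interval that is not close to `I` misses the support of the atom.
    · push Not at hn
      have hlen : I'.length ≤ I.length := by
        unfold length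
        exact zpow_le_zpow_right₀ one_le_two hk
      have : ‖coef ψ I'‖ ≤ 0 * I'.length ^ (1 / 2 : ℝ) := by
        refine norm_coef_le_of_bound fun t ht => ?_
        rw [h.supp t, norm_zero]
        rw [mem_dil, not_le]
        have h1 := mem_dil.1 (toSet_subset_dil le_rfl I' ht)
        have h2 := abs_sub_le I'.center t I.center
        rw [abs_sub_comm I'.center t] at h2
        nlinarith
      rw [zero_mul] at this
      rw [norm_le_zero_iff.1 this, enorm_zero]
      exact zero_le
  · obtain ⟨k, hk'⟩ : ∃ k, I.1 - I'.1 = k := ⟨_, rfl⟩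
    have hk0 : k < 0 := by omega
    by_cases hn : ∃ e : Fin 3, |I.center - (I'.2 + (e : ℕ) / 2) * I'.length| ≤
        2 ^ (m + 1) * I.length
    · have hnear : Near m I I' := Or.inr ⟨hk, hn⟩
      rw [nearKernel, if_pos hnear, hk', scaleDecay, if_neg (not_le.2 hk0), htoreal, ← ofReal_norm]
      refine ENNReal.ofReal_le_ofReal ?_
      have hset : coef ψ I' = ∫ t in I.dil (2 ^ (m + 1)), ψ t * I'.haar t := by
        refine (setIntegral_eq_integral_of_forall_compl_eq_zero fun t ht => ?_).symm
        rw [h.supp t ht, zero_mul]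
      have hvol : volume (I.dil (2 ^ (m + 1))) = ENNReal.ofReal (2 * 2 ^ (m + 1) * I.length) := by
        rw [volume_dil (by positivity), volume_toSet, ← ENNReal.ofReal_mul (by positivity)]
      have hscale : I'.length ^ (-(1 / 2) : ℝ) * s * I.length = 2 ^ ((k : ℝ) / 2) := by
        have h6 : I'.length ^ (-(1 / 2) : ℝ) = (I'.length ^ (1 / 2 : ℝ))⁻¹ := Real.rpow_neg hI'.le _
        have h7 : s * s * I.length = 1 := by
          rw [hs, rpow_neg_half_mul_self hI, inv_mul_cancel₀ hI.ne']
        have h8 : 0 < I'.length ^ (1 / 2 : ℝ) := Real.rpow_pos_of_pos hI' _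
        have h9 : (2 : ℝ) ^ ((k : ℝ) / 2) = (2 ^ (-(k : ℝ) / 2))⁻¹ := by
          rw [← Real.rpow_neg zero_le_two]
          congr 1
          ring
        rw [h6, h9, ← hreal k hk', mul_inv]
        field_simp
        linarith
      calc ‖coef ψ I'‖ ≤ B * 2 ^ (-(20 * m) : ℝ) * s * I'.length ^ (-(1 / 2) : ℝ) *
            volume.real (I.dil (2 ^ (m + 1))) := by
            rw [hset]
            refine norm_setIntegral_le_of_norm_le_const (by rw [hvol]; exact ENNReal.ofReal_lt_top)
              fun t _ => ?_
            rw [norm_mul]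
            gcongr
            · exact h.size t
            · exact norm_haar_le I' t
        _ = B * (2 ^ (-(20 * m) : ℝ) * (4 * 2 ^ (m : ℝ))) *
              (I'.length ^ (-(1 / 2) : ℝ) * s * I.length) := by
            rw [measureReal_def, hvol, ENNReal.toReal_ofReal (by positivity), Real.rpow_natCast]
            ring
        _ = 4 * B * 2 ^ (-(20 * m) + m : ℝ) * 2 ^ ((k : ℝ) / 2) := by
            rw [hscale, Real.rpow_add two_pos]
            ring
        _ ≤ _ := by
            gcongr
            · exact one_le_two
            · have : (0 : ℝ) ≤ m := Nat.cast_nonneg m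
              linarith
    -- No jump of the Haar function is near the support, so it is constant there and the mean of the
    -- atom is zero.
    · push Not at hn
      have : coef ψ I' = 0 := by
        have h1 : ∀ t, ψ t * I'.haar t = ψ t * I'.haar I.center := by
          intro t
          by_cases ht : t ∈ I.dil (2 ^ (m + 1))
          · rw [haar_eq_of_not_near hn (mem_dil.1 ht)]
          · rw [h.supp t ht, zero_mul, zero_mul]
        unfold coef
        simp only [h1]
        rw [integral_mul_const, h.mean, zero_mul]
      rw [this, enorm_zero]
      exact zero_le

end DyadicInterval

end MultiParam

namespace MultiParam

namespace DyadicInterval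

/-! ### Decomposition of adapted functions into localized ones -/

/-- A piecewise linear cutoff, equal to `1` on the dilate `2^m I` and to `0` off `2^{m+1} I`. -/
noncomputable def cutoff (I : DyadicInterval) (m : ℕ) (x : ℝ) : ℝ :=
  max 0 (min 1 (2 - |x - I.center| / (2 ^ m * I.length)))

theorem cutoff_nonneg (I : DyadicInterval) (m : ℕ) (x : ℝ) : 0 ≤ cutoff I m x := le_max_left _ _

theorem cutoff_le_one (I : DyadicInterval) (m : ℕ) (x : ℝ) : cutoff I m x ≤ 1 :=
  max_le zero_le_one (min_le_left _ _)

theorem cutoff_eq_one {I : DyadicInterval} {m : ℕ} {x : ℝ} (h : |x - I.center| ≤ 2 ^ m * I.length) :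
    cutoff I m x = 1 := by
  have hI := I.length_pos
  have h1 : |x - I.center| / (2 ^ m * I.length) ≤ 1 := (div_le_one (by positivity)).2 h
  rw [cutoff, min_eq_left (by linarith), max_eq_right zero_le_one]

theorem cutoff_eq_zero {I : DyadicInterval} {m : ℕ} {x : ℝ}
    (h : 2 ^ (m + 1) * I.length ≤ |x - I.center|) : cutoff I m x = 0 := by
  have hI := I.length_pos
  have h1 : 2 ≤ |x - I.center| / (2 ^ m * I.length) := by
    rw [le_div_iff₀ (by positivity)]
    rw [pow_succ] at h
    linarith
  rw [cutoff, max_eq_left]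
  exact (min_le_right _ _).trans (by linarith)

theorem cutoff_mono (I : DyadicInterval) (m : ℕ) (x : ℝ) : cutoff I m x ≤ cutoff I (m + 1) x := by
  have hI := I.length_pos
  unfold cutoff
  gcongr
  · exact one_le_two
  · omega

theorem abs_cutoff_sub_le (I : DyadicInterval) (m : ℕ) (x y : ℝ) :
    |cutoff I m x - cutoff I m y| ≤ |x - y| / I.length := by
  have hI := I.length_pos
  unfold cutoff
  refine (abs_max_sub_max_le_max _ _ _ _).trans (max_le (by simp; positivity) ?_)
  refine (abs_min_sub_min_le_max _ _ _ _).trans (max_le (by simp; positivity) ?_)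
  have e : 2 - |x - I.center| / (2 ^ m * I.length) - (2 - |y - I.center| / (2 ^ m * I.length)) =
      (|y - I.center| - |x - I.center|) / (2 ^ m * I.length) := by ring
  rw [e, abs_div, abs_of_pos (show 0 < 2 ^ m * I.length by positivity)]
  have h1 : |(|y - I.center| - |x - I.center|)| ≤ |x - y| := by
    refine (abs_abs_sub_abs_le_abs_sub _ _).trans (le_of_eq ?_)
    rw [abs_sub_comm x y]
    congr 1
    ring
  have h2 : I.length ≤ 2 ^ m * I.length :=
    le_mul_of_one_le_left hI.le (one_le_pow₀ one_le_two)
  gcongr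

/-- The annular cutoffs: the successive differences of `cutoff`. -/
noncomputable def annulus (I : DyadicInterval) : ℕ → ℝ → ℝ
  | 0 => cutoff I 0
  | m + 1 => fun x => cutoff I (m + 1) x - cutoff I m x

theorem sum_annulus (I : DyadicInterval) (n : ℕ) (x : ℝ) :
    ∑ m ∈ Finset.range (n + 1), annulus I m x = cutoff I n x := by
  induction n with
  | zero => simp [annulus]
  | succ n ih =>
    rw [Finset.sum_range_succ, ih]
    simp [annulus]

theorem abs_annulus_le_one (I : DyadicInterval) (m : ℕ) (x : ℝ) : |annulus I m x| ≤ 1 := by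
  cases m with
  | zero =>
    rw [annulus, abs_of_nonneg (cutoff_nonneg I 0 x)]
    exact cutoff_le_one I 0 x
  | succ m =>
    have h1 := cutoff_mono I m x
    have h2 := cutoff_nonneg I m x
    have h3 := cutoff_le_one I (m + 1) x
    rw [annulus, abs_of_nonneg (by linarith)]
    linarith

theorem abs_annulus_sub_le (I : DyadicInterval) (m : ℕ) (x y : ℝ) :
    |annulus I m x - annulus I m y| ≤ 2 * (|x - y| / I.length) := by
  have hI := I.length_pos
  cases m with
  | zero =>
    refine (abs_cutoff_sub_le I 0 x y).trans ?_
    have : 0 ≤ |x - y| / I.length := by positivity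
    linarith
  | succ m =>
    have e : annulus I (m + 1) x - annulus I (m + 1) y =
      (cutoff I (m + 1) x - cutoff I (m + 1) y) - (cutoff I m x - cutoff I m y) := by
      simp only [annulus]
      ring
    rw [e]
    refine (abs_sub _ _).trans ?_
    have h1 := abs_cutoff_sub_le I (m + 1) x y
    have h2 := abs_cutoff_sub_le I m x y
    linarith

theorem annulus_eq_zero {I : DyadicInterval} {m : ℕ} {x : ℝ}
    (h : 2 ^ (m + 1) * I.length ≤ |x - I.center|) : annulus I m x = 0 := by
  have hI := I.length_pos
  cases m with
  | zero => exact cutoff_eq_zero h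
  | succ m =>
    simp only [annulus]
    rw [cutoff_eq_zero h, cutoff_eq_zero, sub_zero]
    refine le_trans ?_ h
    gcongr
    · exact one_le_two
    · omega

theorem annulus_eq_zero_of_le {I : DyadicInterval} {m : ℕ} {x : ℝ}
    (h : |x - I.center| ≤ 2 ^ m * I.length) : annulus I (m + 1) x = 0 := by
  have hI := I.length_pos
  simp only [annulus]
  rw [cutoff_eq_one h, cutoff_eq_one, sub_self]
  refine h.trans ?_
  gcongr
  · exact one_le_two
  · omega

theorem continuous_cutoff (I : DyadicInterval) (m : ℕ) : Continuous (cutoff I m) := by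
  unfold cutoff
  fun_prop

theorem continuous_annulus (I : DyadicInterval) (m : ℕ) : Continuous (annulus I m) := by
  cases m with
  | zero => exact continuous_cutoff I 0
  | succ m => exact (continuous_cutoff I (m + 1)).sub (continuous_cutoff I m)

theorem integrable_cutoff (I : DyadicInterval) (m : ℕ) : Integrable (cutoff I m) := by
  refine (continuous_cutoff I m).integrable_of_hasCompactSupport
    (HasCompactSupport.intro (isCompact_closedBall I.center (2 ^ (m + 1) * I.length))
      fun x hx => cutoff_eq_zero ?_)
  rw [Metric.mem_closedBall, Real.dist_eq, not_le] at hx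
  exact hx.le

theorem two_mul_length_le_integral_cutoff (I : DyadicInterval) :
    2 * I.length ≤ ∫ x, cutoff I 0 x := by
  have hI := I.length_pos
  have h1 : volume.real (I.dil 1) = 2 * I.length := by
    rw [measureReal_def, volume_dil zero_le_one, volume_toSet, ← ENNReal.ofReal_mul (by norm_num),
      ENNReal.toReal_ofReal (by positivity)]
    ring
  have h2 : ∫ x in I.dil 1, cutoff I 0 x = 2 * I.length := by
    rw [← h1, setIntegral_congr_fun (g := fun _ => (1 : ℝ)) (I.measurableSet_dil 1)]
    · simp [Measure.real]
    · intro x hx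
      refine cutoff_eq_one ?_
      simpa using mem_dil.1 hx
  rw [← h2]
  exact setIntegral_le_integral (integrable_cutoff I 0)
    (Filter.Eventually.of_forall (cutoff_nonneg I 0))

theorem inv_integral_cutoff_le (I : DyadicInterval) :
    (∫ x, cutoff I 0 x)⁻¹ ≤ (2 * I.length)⁻¹ := by
  have hI := I.length_pos
  gcongr
  exact two_mul_length_le_integral_cutoff I

/-- The pieces of `g` on dyadic annuli are corrected to mean zero by multiples of one fixed bump at
scale `I`. The multiples sum to the mean of `g`, which is zero, so the corrections cancel in the
limit. Integrating over an annulus of length about $2^m|I|$ costs one factor $2^m$: the exponent 21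
becomes the decay $2^{-20m}$. -/
theorem exists_local_atoms {K : ℝ} (hK : 0 ≤ K) {I : DyadicInterval} {g : ℝ → ℂ}
    (hdiff : Differentiable ℝ g)
    (hsize : ∀ x, ‖g x‖ ≤ K * I.length ^ (-(1 / 2) : ℝ) *
      ((1 + |x - I.center| / I.length) ^ 21)⁻¹)
    (hderiv : ∀ x, ‖deriv g x‖ ≤ K * I.length ^ (-1 - 1 / 2 : ℝ) *
      ((1 + |x - I.center| / I.length) ^ 21)⁻¹)
    (hint : Integrable g) (hmean : ∫ x, g x = 0) :
    ∃ ψ : ℕ → ℝ → ℂ, (∀ m, IsLocalAtom (2 ^ 23 * K) m I (ψ m)) ∧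
      ∀ x, Filter.Tendsto (fun n => ∑ m ∈ Finset.range n, ψ m x) Filter.atTop (nhds (g x)) := by
  have hI := I.length_pos
  set ℓ := I.length with hℓ
  set c := I.center with hc
  set s := ℓ ^ (-(1 / 2) : ℝ) with hs
  have hs0 : 0 < s := Real.rpow_pos_of_pos hI _
  have hsℓ : ℓ ^ (-1 - 1 / 2 : ℝ) = s / ℓ := by
    rw [hs, show (-1 - 1 / 2 : ℝ) = -(1 / 2) + (-1) by norm_num, Real.rpow_add hI,
      Real.rpow_neg_one]
    exact (div_eq_mul_inv _ _).symm
  have hw1 : ∀ x, ((1 + |x - c| / ℓ) ^ 21)⁻¹ ≤ 1 := fun x =>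
    inv_le_one_of_one_le₀ (one_le_pow₀ (by
      have : 0 ≤ |x - c| / ℓ := by positivity
      linarith))
  have hgb : ∀ x, ‖g x‖ ≤ K * s := fun x => (hsize x).trans
    (mul_le_of_le_one_right (by positivity) (hw1 x))
  have hglip : ∀ x y, ‖g x - g y‖ ≤ K * (s / ℓ) * |x - y| := by
    intro x y
    have := Convex.norm_image_sub_le_of_norm_deriv_le (𝕜 := ℝ) (f := g) (s := Set.univ)
      (C := K * (s / ℓ)) (fun z _ => hdiff z) (fun z _ => by
        refine (hderiv z).trans ?_
        rw [hsℓ]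
        exact mul_le_of_le_one_right (by positivity) (hw1 z)) convex_univ
        (Set.mem_univ y) (Set.mem_univ x)
    simpa [Real.norm_eq_abs] using this
  -- On the annulus of order `m + 1` the distance to the center is at least $2^m|I|$; passing from
  -- $2^{-21m}$ to $2^{-21(m+1)}$ costs the constant `2 ^ 21`.
  have hub : ∀ m x, ‖(annulus I m x : ℂ) * g x‖ ≤ 2 ^ 21 * K * s * (2 ^ (21 * m))⁻¹ := by
    intro m x
    rw [norm_mul, Complex.norm_real, Real.norm_eq_abs]
    cases m with
    | zero =>
      refine (mul_le_mul (abs_annulus_le_one I 0 x) (hgb x) (norm_nonneg _) zero_le_one).trans ?_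
      have : 0 ≤ K * s := by positivity
      simp only [mul_zero, pow_zero, inv_one, mul_one, one_mul]
      nlinarith
    | succ m =>
      by_cases h : |x - c| ≤ 2 ^ m * ℓ
      · rw [annulus_eq_zero_of_le h]
        simp only [abs_zero, zero_mul]
        positivity
      · push Not at h
        refine (mul_le_mul (abs_annulus_le_one I (m + 1) x) (hsize x) (norm_nonneg _)
          zero_le_one).trans ?_
        have h1 : (2 : ℝ) ^ m ≤ 1 + |x - c| / ℓ := by
          have : (2 : ℝ) ^ m ≤ |x - c| / ℓ := by
            rw [le_div_iff₀ hI]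
            exact h.le
          linarith
        have h2 : ((1 + |x - c| / ℓ) ^ 21)⁻¹ ≤ ((2 ^ m) ^ 21)⁻¹ := by gcongr
        calc 1 * (K * s * ((1 + |x - c| / ℓ) ^ 21)⁻¹) ≤ K * s * ((2 ^ m) ^ 21)⁻¹ := by
              rw [one_mul]
              gcongr
          _ = _ := by
              rw [show 21 * (m + 1) = m * 21 + 21 by ring, pow_add, pow_mul, mul_inv]
              field_simp
  have hui : ∀ m, Integrable fun x => (annulus I m x : ℂ) * g x := fun m =>
    hint.bdd_mul (c := 1) (Complex.continuous_ofReal.comp (continuous_annulus I m)).aestronglyMeasurable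
      (Filter.Eventually.of_forall fun x => by
        rw [Complex.norm_real, Real.norm_eq_abs]
        exact abs_annulus_le_one I m x)
  set b : ℕ → ℂ := fun m => ∫ x, (annulus I m x : ℂ) * g x with hb
  have hbb : ∀ m, ‖b m‖ ≤ 2 ^ 21 * K * s * (2 ^ (20 * m))⁻¹ * (4 * ℓ) := by
    intro m
    have hset : b m = ∫ x in I.dil (2 ^ (m + 1)), (annulus I m x : ℂ) * g x := by
      refine (setIntegral_eq_integral_of_forall_compl_eq_zero fun x hx => ?_).symm
      rw [mem_dil, not_le] at hx
      rw [annulus_eq_zero hx.le]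
      simp
    have hvol : volume (I.dil (2 ^ (m + 1))) = ENNReal.ofReal (2 * 2 ^ (m + 1) * ℓ) := by
      rw [volume_dil (by positivity), volume_toSet, ← ENNReal.ofReal_mul (by positivity)]
    rw [hset]
    refine (norm_setIntegral_le_of_norm_le_const (by rw [hvol]; exact ENNReal.ofReal_lt_top)
      fun x _ => hub m x).trans (le_of_eq ?_)
    rw [measureReal_def, hvol, ENNReal.toReal_ofReal (by positivity),
      show 21 * m = 20 * m + m by ring, pow_add, mul_inv]
    field_simp
    ring
  set Z := ∫ x, cutoff I 0 x with hZ
  have hZ2 : 2 * ℓ ≤ Z := two_mul_length_le_integral_cutoff I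
  have hZ0 : 0 < Z := by linarith
  have hZi : Z⁻¹ ≤ (2 * ℓ)⁻¹ := inv_integral_cutoff_le I
  have h2021 : ∀ m : ℕ, ((2 : ℝ) ^ (21 * m))⁻¹ ≤ (2 ^ (20 * m))⁻¹ := fun m => by
    gcongr
    · exact one_le_two
    · norm_num
  have h20 : ∀ m : ℕ, ((2 : ℝ) ^ (20 * m))⁻¹ ≤ 1 := fun m =>
    inv_le_one_of_one_le₀ (one_le_pow₀ one_le_two)
  -- Adding the correction gives the constants $3\cdot 2^{21}$ for the size and $3+2\cdot 2^{21}$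
  -- for the Lipschitz bound, both at most `2 ^ 23`.
  refine ⟨fun m x => (annulus I m x : ℂ) * g x - b m * (Z⁻¹ * cutoff I 0 x : ℝ),
    fun m => ⟨fun x => ?_, fun x y => ?_, fun x hx => ?_, ?_⟩, fun x => ?_⟩
  · have hpow : (2 : ℝ) ^ (-(20 * m) : ℝ) = (2 ^ (20 * m))⁻¹ := by
      rw [Real.rpow_neg zero_le_two]
      congr 1
      rw [← Real.rpow_natCast]
      push_cast
      rfl
    rw [hpow]
    have h1 : ‖b m * ((Z⁻¹ * cutoff I 0 x : ℝ) : ℂ)‖ ≤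
        2 ^ 21 * K * s * (2 ^ (20 * m))⁻¹ * (4 * ℓ) * ((2 * ℓ)⁻¹ * 1) := by
      rw [norm_mul, Complex.norm_real, Real.norm_eq_abs,
        abs_of_nonneg (mul_nonneg (inv_nonneg.2 hZ0.le) (cutoff_nonneg I 0 x))]
      gcongr
      · exact mul_nonneg (inv_nonneg.2 hZ0.le) (cutoff_nonneg I 0 x)
      · exact hbb m
      · exact cutoff_nonneg I 0 x
      · exact cutoff_le_one I 0 x
    calc _ ≤ 2 ^ 21 * K * s * (2 ^ (21 * m))⁻¹ +
          2 ^ 21 * K * s * (2 ^ (20 * m))⁻¹ * (4 * ℓ) * ((2 * ℓ)⁻¹ * 1) :=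
          (norm_sub_le _ _).trans (add_le_add (hub m x) h1)
      _ ≤ 2 ^ 21 * K * s * (2 ^ (20 * m))⁻¹ +
          2 ^ 21 * K * s * (2 ^ (20 * m))⁻¹ * (4 * ℓ) * ((2 * ℓ)⁻¹ * 1) :=
          add_le_add (mul_le_mul_of_nonneg_left (h2021 m) (by positivity)) le_rfl
      _ = 3 * 2 ^ 21 * K * s * (2 ^ (20 * m))⁻¹ := by
          field_simp
          ring
      _ ≤ _ := by
          have : 0 ≤ K * s * (2 ^ (20 * m))⁻¹ := by positivity
          nlinarith
  · have h1 : ‖(annulus I m x : ℂ) * g x - (annulus I m y : ℂ) * g y‖ ≤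
        2 * (|x - y| / ℓ) * (K * s) + 1 * (K * (s / ℓ) * |x - y|) := by
      have e : (annulus I m x : ℂ) * g x - (annulus I m y : ℂ) * g y =
          ((annulus I m x - annulus I m y : ℝ) : ℂ) * g x +
            (annulus I m y : ℂ) * (g x - g y) := by
        push_cast
        ring
      rw [e]
      refine (norm_add_le _ _).trans ?_
      rw [norm_mul, norm_mul, Complex.norm_real, Complex.norm_real, Real.norm_eq_abs,
        Real.norm_eq_abs]
      gcongr
      · exact abs_annulus_sub_le I m x y
      · exact hgb x
      · exact abs_annulus_le_one I m y
      · exact hglip x y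
    have h2 : ‖b m * ((Z⁻¹ * cutoff I 0 x : ℝ) : ℂ) - b m * ((Z⁻¹ * cutoff I 0 y : ℝ) : ℂ)‖ ≤
        2 ^ 21 * K * s * 1 * (4 * ℓ) * ((2 * ℓ)⁻¹ * (|x - y| / ℓ)) := by
      rw [← mul_sub, ← Complex.ofReal_sub, ← mul_sub, norm_mul, Complex.norm_real,
        Real.norm_eq_abs, abs_mul, abs_of_pos (inv_pos.2 hZ0)]
      gcongr
      · refine (hbb m).trans ?_
        gcongr
        exact h20 m
      · exact abs_cutoff_sub_le I 0 x y
    calc _ = ‖((annulus I m x : ℂ) * g x - (annulus I m y : ℂ) * g y) -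
          (b m * ((Z⁻¹ * cutoff I 0 x : ℝ) : ℂ) - b m * ((Z⁻¹ * cutoff I 0 y : ℝ) : ℂ))‖ := by
          congr 1
          ring
      _ ≤ _ := (norm_sub_le _ _).trans (add_le_add h1 h2)
      _ = (3 + 2 * 2 ^ 21) * (K * (s / ℓ) * |x - y|) := by
          field_simp
          ring
      _ ≤ 2 ^ 23 * (K * (s / ℓ) * |x - y|) := by
          gcongr
          norm_num
      _ = _ := by ring
  · rw [mem_dil, not_le] at hx
    beta_reduce
    rw [annulus_eq_zero hx.le, cutoff_eq_zero]
    · simp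
    · refine le_trans ?_ hx.le
      gcongr
      · exact one_le_two
      · omega
  · rw [integral_sub (hui m), integral_const_mul, integral_complex_ofReal, integral_const_mul,
      inv_mul_cancel₀ hZ0.ne']
    · simp [hb]
    · exact ((integrable_cutoff I 0).const_mul Z⁻¹).ofReal.const_mul (b m)
  · have hsum : ∀ n, ∑ m ∈ Finset.range (n + 1), ((annulus I m x : ℂ) * g x -
        b m * ((Z⁻¹ * cutoff I 0 x : ℝ) : ℂ)) =
        (cutoff I n x : ℂ) * g x - (∫ y, (cutoff I n y : ℂ) * g y) *
          ((Z⁻¹ * cutoff I 0 x : ℝ) : ℂ) := by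
      intro n
      rw [Finset.sum_sub_distrib, ← Finset.sum_mul, ← Finset.sum_mul, ← Complex.ofReal_sum,
        sum_annulus, hb]
      dsimp only
      rw [← integral_finsetSum _ fun m _ => hui m]
      congr 3
      funext y
      rw [← Finset.sum_mul, ← Complex.ofReal_sum, sum_annulus]
    -- The annular cutoffs sum to `cutoff I n` over `range (n + 1)`, hence the shift by one.
    rw [← Filter.tendsto_add_atTop_iff_nat 1]
    simp only [hsum]
    have hcut : ∀ y, Filter.Tendsto (fun n => (cutoff I n y : ℂ) * g y) Filter.atTop
        (nhds (g y)) := by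
      intro y
      obtain ⟨n₀, hn₀⟩ := pow_unbounded_of_one_lt (|y - c| / ℓ) one_lt_two
      refine tendsto_const_nhds.congr' ?_
      filter_upwards [Filter.eventually_ge_atTop n₀] with n hn
      rw [cutoff_eq_one, Complex.ofReal_one, one_mul]
      rw [div_lt_iff₀ hI] at hn₀
      refine hn₀.le.trans ?_
      gcongr
      exact one_le_two
    have hlim : Filter.Tendsto (fun n => ∫ y, (cutoff I n y : ℂ) * g y) Filter.atTop
        (nhds (∫ y, g y)) := by
      refine tendsto_integral_of_dominated_convergence (fun y => ‖g y‖) (fun n => ?_) hint.norm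
        (fun n => Filter.Eventually.of_forall fun y => ?_) (Filter.Eventually.of_forall hcut)
      · exact (Complex.continuous_ofReal.comp
          (continuous_cutoff I n)).aestronglyMeasurable.mul hint.aestronglyMeasurable
      · rw [norm_mul, Complex.norm_real, Real.norm_eq_abs, abs_of_nonneg (cutoff_nonneg I n y)]
        exact mul_le_of_le_one_left (norm_nonneg _) (cutoff_le_one I n y)
    rw [hmean] at hlim
    simpa using (hcut x).sub (hlim.mul_const ((Z⁻¹ * cutoff I 0 x : ℝ) : ℂ))

end DyadicInterval

end MultiParam

namespace MultiParam

/-! ### Expansions of product functions -/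

theorem hasSum_pi_prod {κ : Type*} {d : ℕ} {f : Fin d → κ → ℂ} {a : Fin d → ℂ}
    (h : ∀ i, HasSum (f i) (a i)) :
    HasSum (fun k : Fin d → κ => ∏ i, f i (k i)) (∏ i, a i) := by
  induction d with
  | zero => simp
  | succ d ih =>
    rw [← (Fin.consEquiv fun _ : Fin (d + 1) => κ).hasSum_iff, Fin.prod_univ_succ]
    have h1 := ih fun i => h i.succ
    have h0 : Summable fun x : κ × (Fin d → κ) => f 0 x.1 * ∏ i, f (Fin.succ i) (x.2 i) :=
      summable_mul_of_summable_norm (f := f 0)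
        (g := fun k : Fin d → κ => ∏ i, f (Fin.succ i) (k i)) (h 0).summable.norm h1.summable.norm
    have h2 := HasSum.mul (h 0) h1 h0
    have h3 : ((fun k : Fin (d + 1) → κ => ∏ i, f i (k i)) ∘ Fin.consEquiv fun _ => κ) =
        fun x : κ × (Fin d → κ) => f 0 x.1 * ∏ i, f (Fin.succ i) (x.2 i) := by
      funext k
      simp [Fin.consEquiv, Fin.prod_univ_succ]
    rw [h3]
    exact h2

variable {d : ℕ}

/-- The product function `∏ u_i(x_i)`. -/
def tensor (u : Fin d → ℝ → ℂ) (x : Fin d → ℝ) : ℂ := ∏ i, u i (x i)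

theorem measurable_tensor {u : Fin d → ℝ → ℂ} (h : ∀ i, Measurable (u i)) :
    Measurable (tensor u) :=
  Finset.measurable_prod _ fun i _ => (h i).comp (measurable_pi_apply i)

theorem enorm_finset_prod {ι : Type*} (s : Finset ι) (a : ι → ℂ) :
    ‖∏ i ∈ s, a i‖ₑ = ∏ i ∈ s, ‖a i‖ₑ := by
  simp only [enorm_eq_nnnorm, nnnorm_prod, ENNReal.ofNNReal_finsetProd]

theorem enorm_tensor (u : Fin d → ℝ → ℂ) (x : Fin d → ℝ) :
    ‖tensor u x‖ₑ = ∏ i, ‖u i (x i)‖ₑ := by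
  unfold tensor
  rw [enorm_finset_prod]

theorem DyadicRect.measurable_haar (R : DyadicRect d) : Measurable R.haar :=
  measurable_tensor fun i => (R i).measurable_haar

theorem DyadicRect.star_haar (R : DyadicRect d) (x : Fin d → ℝ) :
    (starRingEnd ℂ) (R.haar x) = R.haar x := by
  unfold DyadicRect.haar
  rw [map_prod]
  exact Finset.prod_congr rfl fun i _ => (R i).star_haar (x i)

theorem enorm_pairing_le_tsum {κ : Type*} [Countable κ] {f Φ : (Fin d → ℝ) → ℂ}
    {F : κ → (Fin d → ℝ) → ℂ} (hf : AEStronglyMeasurable f) (hF : ∀ k, Measurable (F k))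
    (hs : ∀ x, HasSum (fun k => F k x) (Φ x)) (hfin : ∑' k, ∫⁻ x, ‖f x‖ₑ * ‖F k x‖ₑ ≠ ∞) :
    ‖pairing f Φ‖ₑ ≤ ∑' k, ‖pairing f (F k)‖ₑ := by
  have h1 : pairing f Φ = ∑' k, pairing f (F k) := by
    unfold pairing
    rw [← integral_tsum]
    · refine integral_congr_ae (Filter.Eventually.of_forall fun x => ?_)
      exact (((hs x).star).mul_left (f x)).tsum_eq.symm
    · intro k
      exact hf.mul (continuous_star.measurable.comp (hF k)).aestronglyMeasurable
    · simpa only [enorm_mul, RCLike.enorm_conj] using hfin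
  rw [h1]
  exact enorm_tsum_le_tsum_enorm

/-! ### Haar expansion of the pairing with a product of local atoms -/

theorem DyadicInterval.IsLocalAtom.measurable {B : ℝ} {m : ℕ} {I : DyadicInterval} {ψ : ℝ → ℂ}
    (h : IsLocalAtom B m I ψ) : Measurable ψ := h.continuous.measurable

open DyadicInterval in
-- Each factor is expanded in its Haar series. The product series is absolutely summable uniformly
-- in `x`, so for integrable `f` it may be paired term by term.
theorem enorm_pairing_tensor_le {B : ℝ≥0} {m : Fin d → ℕ} {R : DyadicRect d}
    {ψ : Fin d → ℝ → ℂ} (hψ : ∀ i, IsLocalAtom B (m i) (R i) (ψ i))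
    {f : (Fin d → ℝ) → ℂ} (hf : Integrable f) :
    ‖pairing f (tensor ψ)‖ₑ ≤
      kernelOp (fun R R' : DyadicRect d => ∏ i, nearKernel B (m i) (R i) (R' i))
        (fun R' => ‖pairing f R'.haar‖ₑ) R := by
  have hmeas : ∀ (R' : DyadicRect d) i, Measurable fun t => coef (ψ i) (R' i) * (R' i).haar t :=
    fun R' i => (R' i).measurable_haar.const_mul _
  have h1 : ‖pairing f (tensor ψ)‖ₑ ≤ ∑' R' : DyadicRect d,
      ‖pairing f (tensor fun i t => coef (ψ i) (R' i) * (R' i).haar t)‖ₑ := by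
    refine enorm_pairing_le_tsum hf.1 (fun R' => measurable_tensor (hmeas R')) (fun x => ?_) ?_
    · exact hasSum_pi_prod (f := fun i (I : DyadicInterval) => coef (ψ i) I * I.haar (x i))
        fun i => hasSum_coef_mul_haar (hψ i).integrable (hψ i).lip (x i)
    · rw [← lintegral_tsum]
      · simp only [ENNReal.tsum_mul_left, enorm_tensor]
        have hb : ∀ x : Fin d → ℝ, ∑' R' : DyadicRect d,
            ∏ i, ‖coef (ψ i) (R' i) * (R' i).haar (x i)‖ₑ ≤
            ∏ i, ENNReal.ofReal (haarSeriesBound (ψ i)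
              (B * (R i).length ^ (-(1 / 2) : ℝ) / (R i).length) * ∑' k : ℤ, (2 : ℝ) ^ (-|k|)) := by
          intro x
          rw [tsum_pi_prod fun i (I : DyadicInterval) => ‖coef (ψ i) I * I.haar (x i)‖ₑ]
          exact Finset.prod_le_prod' fun i _ =>
            tsum_enorm_coef_mul_haar_le (hψ i).integrable (hψ i).lip (x i)
        refine ((lintegral_mono fun x => mul_le_mul' le_rfl (hb x)).trans_lt ?_).ne
        rw [lintegral_mul_const'' _ hf.1.enorm]
        exact ENNReal.mul_lt_top hf.2 (ENNReal.prod_lt_top fun _ _ => ENNReal.ofReal_lt_top)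
      · exact fun R' => hf.1.enorm.mul (measurable_tensor (hmeas R')).enorm.aemeasurable
  refine h1.trans (ENNReal.tsum_le_tsum fun R' => ?_)
  have h2 : pairing f (tensor fun i t => coef (ψ i) (R' i) * (R' i).haar t) =
      (starRingEnd ℂ) (∏ i, coef (ψ i) (R' i)) * pairing f R'.haar := by
    unfold pairing
    rw [← integral_const_mul]
    refine integral_congr_ae (Filter.Eventually.of_forall fun x => ?_)
    simp only [tensor, DyadicRect.haar, Finset.prod_mul_distrib, map_mul]
    ring
  rw [h2, enorm_mul, RCLike.enorm_conj, enorm_finset_prod]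
  exact mul_le_mul' (Finset.prod_le_prod' fun i _ => enorm_coef_le_nearKernel (hψ i) (R' i)) le_rfl

/-! ### Atomic decomposition of adapted functions -/

open DyadicInterval in
theorem IsAdapted.integrable {K : ℝ} {I : DyadicInterval} {g : ℝ → ℂ} (h : IsAdapted K 21 I g) :
    Integrable g := by
  have h1 : Integrable fun x : ℝ => (1 + ‖x‖) ^ (-(21 : ℕ) : ℝ) :=
    integrable_one_add_norm (by simp)
  have h2 := (h1.comp_div I.length_pos.ne').comp_sub_right I.center
  refine Integrable.mono' (h2.const_mul (K * I.length ^ (-(1 / 2) : ℝ)))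
    h.differentiable.continuous.aestronglyMeasurable (Filter.Eventually.of_forall fun x => ?_)
  refine (h.size x).trans (le_of_eq ?_)
  have h3 : ‖(x - I.center) / I.length‖ = |x - I.center| / I.length := by
    rw [Real.norm_eq_abs, abs_div, abs_of_pos I.length_pos]
  have h4 : 0 ≤ 1 + |x - I.center| / I.length := by
    have := I.length_pos
    positivity
  rw [h3, Real.rpow_neg h4, Real.rpow_natCast]

open DyadicInterval in
theorem hasSum_of_tendsto_atoms {B : ℝ} {I : DyadicInterval} {ψ : ℕ → ℝ → ℂ} {g : ℝ → ℂ}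
    (h : ∀ m, IsLocalAtom B m I (ψ m))
    (ht : ∀ x, Filter.Tendsto (fun n => ∑ m ∈ Finset.range n, ψ m x) Filter.atTop (nhds (g x)))
    (x : ℝ) : HasSum (fun m => ψ m x) (g x) := by
  have hs : Summable fun m => ψ m x := by
    have hg : Summable fun m : ℕ => ((2 : ℝ)⁻¹ ^ 20) ^ m :=
      summable_geometric_of_lt_one (by positivity) (by norm_num)
    refine Summable.of_norm_bounded ((hg.mul_left B).mul_right (I.length ^ (-(1 / 2) : ℝ)))
      fun m => ?_
    refine ((h m).size x).trans (le_of_eq ?_)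
    rw [Real.rpow_neg zero_le_two, ← pow_mul, inv_pow]
    norm_cast
  rw [← tendsto_nhds_unique hs.hasSum.tendsto_sum_nat (ht x)]
  exact hs.hasSum

open DyadicInterval in
-- The zeros are assumed for the product, the atoms need them for the factors. At a point where `φ`
-- does not vanish, the integral over the `j`th variable is the mean of the `j`th factor times a
-- nonzero number. If `φ` vanishes identically, zero atoms serve.
theorem IsAdaptedRect.exists_atoms {K : ℝ} {R : DyadicRect d} {φ : (Fin d → ℝ) → ℂ}
    (h : IsAdaptedRect K 21 R φ) (hz : ∀ j, HasZero j φ) :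
    ∃ ψ : Fin d → ℕ → ℝ → ℂ,
      (∀ i m, IsLocalAtom (2 ^ 23 * ‖K‖₊ : ℝ≥0) m (R i) (ψ i m)) ∧
      ∀ x, HasSum (fun m : Fin d → ℕ => tensor (fun i => ψ i (m i)) x) (φ x) := by
  classical
  obtain ⟨g, hg, hφ⟩ := h
  have hB : ((2 ^ 23 * ‖K‖₊ : ℝ≥0) : ℝ) = 2 ^ 23 * |K| := by simp
  rw [hB]
  by_cases h0 : ∃ x, φ x ≠ 0
  · obtain ⟨x, hx⟩ := h0
    rw [hφ, Finset.prod_ne_zero_iff] at hx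
    have hmean : ∀ j, ∫ t, g j t = 0 := by
      intro j
      have h1 := hz j x
      have h2 : ∀ t, φ (Function.update x j t) =
          g j t * ∏ i ∈ Finset.univ.erase j, g i (x i) := by
        intro t
        rw [hφ, ← Finset.mul_prod_erase _ _ (Finset.mem_univ j), Function.update_self]
        congr 1
        refine Finset.prod_congr rfl fun i hi => ?_
        rw [Function.update_of_ne (Finset.ne_of_mem_erase hi)]
      simp only [h2] at h1
      rw [integral_mul_const] at h1
      exact (mul_eq_zero.1 h1).resolve_right
        (Finset.prod_ne_zero_iff.2 fun i _ => hx i (Finset.mem_univ i))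
    have key : ∀ i, ∃ ψ : ℕ → ℝ → ℂ, (∀ m, IsLocalAtom (2 ^ 23 * |K|) m (R i) (ψ m)) ∧
        ∀ x, Filter.Tendsto (fun n => ∑ m ∈ Finset.range n, ψ m x) Filter.atTop
          (nhds (g i x)) := by
      intro i
      have hI := (R i).length_pos
      refine exists_local_atoms (abs_nonneg K) (hg i).differentiable (fun x => ?_) (fun x => ?_)
        (hg i).integrable (hmean i)
      · refine ((hg i).size x).trans ?_
        gcongr
        exact le_abs_self K
      · refine ((hg i).size_deriv x).trans ?_
        gcongr
        exact le_abs_self K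
    choose ψ hψ ht using key
    refine ⟨ψ, hψ, fun x => ?_⟩
    rw [hφ]
    exact hasSum_pi_prod (f := fun i m => ψ i m (x i))
      fun i => hasSum_of_tendsto_atoms (hψ i) (ht i) (x i)
  · push Not at h0
    refine ⟨fun _ _ _ => 0, fun i m => ⟨fun x => ?_, fun x y => ?_, fun _ _ => rfl, by simp⟩,
      fun x => ?_⟩
    · have hI := (R i).length_pos
      simp only [norm_zero]
      positivity
    · have hI := (R i).length_pos
      simp only [sub_zero, norm_zero]
      positivity
    -- In dimension zero the empty product is 1, so `φ` cannot vanish.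
    · rcases isEmpty_or_nonempty (Fin d) with he | ⟨⟨i⟩⟩
      · exfalso
        have := h0 x
        rw [hφ] at this
        simp at this
      · rw [h0 x]
        have : ∀ m : Fin d → ℕ, tensor (fun (_ : Fin d) (_ : ℝ) => (0 : ℂ)) x = 0 := fun _ =>
          Finset.prod_eq_zero (Finset.mem_univ i) rfl
        convert (hasSum_zero : HasSum (fun _ : Fin d → ℕ => (0 : ℂ)) 0) using 2 with m
        exact this m

/-! ### Summing the atoms against a function -/

/-- The supremum bound for a product of local atoms. -/
noncomputable def atomBound (B : ℝ≥0) (R : DyadicRect d) (m : Fin d → ℕ) : ℝ≥0∞ :=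
  ∏ i, (B * ENNReal.ofReal ((R i).length ^ (-(1 / 2) : ℝ))) * ((2 : ℝ≥0∞) ^ (-20 : ℝ)) ^ m i

open DyadicInterval in
theorem enorm_tensor_le {B : ℝ≥0} {m : Fin d → ℕ} {R : DyadicRect d}
    {ψ : Fin d → ℝ → ℂ} (hψ : ∀ i, IsLocalAtom B (m i) (R i) (ψ i)) (x : Fin d → ℝ) :
    ‖tensor ψ x‖ₑ ≤
      (R.dil fun i => 2 ^ (m i + 1)).indicator (fun _ => atomBound B R m) x := by
  by_cases hx : x ∈ R.dil fun i => 2 ^ (m i + 1)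
  · rw [Set.indicator_of_mem hx, enorm_tensor, atomBound]
    refine Finset.prod_le_prod' fun i _ => ?_
    rw [← ofReal_norm]
    refine (ENNReal.ofReal_le_ofReal ((hψ i).size (x i))).trans (le_of_eq ?_)
    rw [ENNReal.ofReal_mul (by positivity), ENNReal.ofReal_mul (by positivity),
      ENNReal.ofReal_coe_nnreal, ofReal_two_rpow, ← ENNReal.rpow_natCast, ← ENNReal.rpow_mul,
      mul_right_comm]
    norm_num
  · rw [Set.indicator_of_notMem hx]
    have : ∃ i, x i ∉ (R i).dil (2 ^ (m i + 1)) := by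
      by_contra! h
      exact hx fun i _ => h i
    obtain ⟨i, hi⟩ := this
    rw [tensor, Finset.prod_eq_zero (Finset.mem_univ i) ((hψ i).supp _ hi)]
    simp

theorem tsum_atomBound_lt_top (B : ℝ≥0) (R : DyadicRect d) :
    ∑' m : Fin d → ℕ, atomBound B R m < ∞ := by
  unfold atomBound
  rw [tsum_pi_prod fun i (m : ℕ) => (B * ENNReal.ofReal ((R i).length ^ (-(1 / 2) : ℝ))) *
    ((2 : ℝ≥0∞) ^ (-20 : ℝ)) ^ m]
  refine ENNReal.prod_lt_top fun i _ => ?_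
  rw [ENNReal.tsum_mul_left]
  exact ENNReal.mul_lt_top (ENNReal.mul_lt_top ENNReal.coe_lt_top ENNReal.ofReal_lt_top)
    (geomConst_lt_top (s := 20) (by norm_num))

theorem tsum_atomBound_mul_volume_lt_top (B : ℝ≥0) (R : DyadicRect d) :
    ∑' m : Fin d → ℕ, atomBound B R m * volume (R.dil fun i => 2 ^ (m i + 1)) < ∞ := by
  have h : ∀ m : Fin d → ℕ, atomBound B R m * volume (R.dil fun i => 2 ^ (m i + 1)) =
      ∏ i, (B * ENNReal.ofReal ((R i).length ^ (-(1 / 2) : ℝ)) * (4 * volume (R i).toSet)) *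
        ((2 : ℝ≥0∞) ^ (-19 : ℝ)) ^ m i := by
    intro m
    rw [atomBound, DyadicRect.dil, volume_pi_pi, ← Finset.prod_mul_distrib]
    refine Finset.prod_congr rfl fun i _ => ?_
    rw [DyadicInterval.volume_dil (by positivity), show (2 : ℝ) * 2 ^ (m i + 1) = 4 * 2 ^ m i by ring,
      ENNReal.ofReal_mul (by norm_num), ENNReal.ofReal_pow (by norm_num),
      show (-19 : ℝ) = -20 + 1 by norm_num, two_rpow_add, mul_pow, ENNReal.rpow_one,
      ENNReal.ofReal_ofNat, ENNReal.ofReal_ofNat]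
    ring
  simp only [h]
  rw [tsum_pi_prod fun i (m : ℕ) =>
    (B * ENNReal.ofReal ((R i).length ^ (-(1 / 2) : ℝ)) * (4 * volume (R i).toSet)) *
        ((2 : ℝ≥0∞) ^ (-19 : ℝ)) ^ m]
  refine ENNReal.prod_lt_top fun i _ => ?_
  rw [ENNReal.tsum_mul_left]
  refine ENNReal.mul_lt_top (ENNReal.mul_lt_top
    (ENNReal.mul_lt_top ENNReal.coe_lt_top ENNReal.ofReal_lt_top)
    (ENNReal.mul_lt_top (by norm_num) (DyadicInterval.volume_toSet_ne_top _).lt_top))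
    (geomConst_lt_top (s := 19) (by norm_num))

/-- A measurable function dominated by the sum of a constant and an integrable function. -/
def IsSumBounded (f : (Fin d → ℝ) → ℂ) : Prop :=
  AEStronglyMeasurable f ∧ ∃ (C : ℝ≥0∞) (u : (Fin d → ℝ) → ℝ≥0∞), C ≠ ∞ ∧ ∫⁻ x, u x ≠ ∞ ∧
    ∀ᵐ x, ‖f x‖ₑ ≤ C + u x

/-- For finite `p`, $|f|\le 1+|f|^p$. The constant pairs with the $L^1$ norms of the atoms and the
integrable part with their sup norms; both are summable over the orders. -/
theorem isSumBounded_of_memLp {p : ℝ≥0∞} (hp : 1 ≤ p) {f : (Fin d → ℝ) → ℂ} (hf : MemLp f p) :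
    IsSumBounded f := by
  refine ⟨hf.1, ?_⟩
  rcases eq_or_ne p ∞ with rfl | hpt
  · refine ⟨eLpNorm f ∞ volume, fun _ => 0, hf.2.ne, by simp, ?_⟩
    simp only [add_zero, eLpNorm_exponent_top]
    exact enorm_ae_le_eLpNormEssSup _ _
  · have hp0 : p ≠ 0 := (one_pos.trans_le hp).ne'
    have h1 : 1 ≤ p.toReal := by
      rw [← ENNReal.toReal_one]
      exact ENNReal.toReal_mono hpt hp
    refine ⟨1, fun x => ‖f x‖ₑ ^ p.toReal, by simp,
      (lintegral_rpow_enorm_lt_top_of_eLpNorm_lt_top hp0 hpt hf.2).ne,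
      Filter.Eventually.of_forall fun x => ?_⟩
    rcases le_total ‖f x‖ₑ 1 with h | h
    · exact h.trans le_self_add
    · refine le_trans ?_ le_add_self
      conv_lhs => rw [← ENNReal.rpow_one ‖f x‖ₑ]
      exact ENNReal.rpow_le_rpow_of_exponent_le h h1

open DyadicInterval in
theorem enorm_pairing_le_tsum_atoms {B : ℝ≥0} {R : DyadicRect d} {ψ : Fin d → ℕ → ℝ → ℂ}
    (hψ : ∀ i m, IsLocalAtom B m (R i) (ψ i m)) {φ : (Fin d → ℝ) → ℂ}
    (hφ : ∀ x, HasSum (fun m : Fin d → ℕ => tensor (fun i => ψ i (m i)) x) (φ x))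
    {f : (Fin d → ℝ) → ℂ} (hf : IsSumBounded f) :
    ‖pairing f φ‖ₑ ≤ ∑' m : Fin d → ℕ, ‖pairing f (tensor fun i => ψ i (m i))‖ₑ := by
  obtain ⟨hfm, C, u, hC, hu, hfu⟩ := hf
  refine enorm_pairing_le_tsum hfm (fun m => measurable_tensor fun i => (hψ i (m i)).measurable)
    hφ ?_
  have hb : ∀ m : Fin d → ℕ, ∫⁻ x, ‖f x‖ₑ * ‖tensor (fun i => ψ i (m i)) x‖ₑ ≤
      C * (atomBound B R m * volume (R.dil fun i => 2 ^ (m i + 1))) +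
        atomBound B R m * ∫⁻ x, u x := by
    intro m
    have ht : atomBound B R m ≠ ∞ := ((ENNReal.le_tsum m).trans_lt (tsum_atomBound_lt_top B R)).ne
    have hmeas := (measurable_const : Measurable fun _ : Fin d → ℝ => atomBound B R m).indicator
      (R.measurableSet_dil fun i => 2 ^ (m i + 1))
    calc ∫⁻ x, ‖f x‖ₑ * ‖tensor (fun i => ψ i (m i)) x‖ₑ
        ≤ ∫⁻ x, (C * (R.dil fun i => 2 ^ (m i + 1)).indicator (fun _ => atomBound B R m) x +
            atomBound B R m * u x) := by
          refine lintegral_mono_ae (hfu.mono fun x hx => ?_)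
          have h1 := enorm_tensor_le (fun i => hψ i (m i)) x
          refine (mul_le_mul' hx h1).trans ?_
          rw [add_mul, mul_comm (u x)]
          exact add_le_add le_rfl (mul_le_mul' (Set.indicator_le_self _ _ _) le_rfl)
      _ = _ := by
          rw [lintegral_add_left (hmeas.const_mul C), lintegral_const_mul _ hmeas,
            lintegral_const_mul' _ _ ht, lintegral_indicator_const (R.measurableSet_dil _)]
  refine ((ENNReal.tsum_le_tsum hb).trans_lt ?_).ne
  rw [ENNReal.tsum_add, ENNReal.tsum_mul_left, ENNReal.tsum_mul_right]
  exact ENNReal.add_lt_top.2 ⟨ENNReal.mul_lt_top hC.lt_top (tsum_atomBound_mul_volume_lt_top B R),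
    ENNReal.mul_lt_top (tsum_atomBound_lt_top B R) hu.lt_top⟩

end MultiParam

namespace MultiParam

/-! ### Stopped energy of Haar coefficients on the line -/

namespace DyadicInterval

/-- The dyadic interval of twice the length that contains `J`. -/
def parent (J : DyadicInterval) : DyadicInterval := (J.1 + 1, J.2 / 2)

theorem parent_left (I : DyadicInterval) : parent (left I) = I := by
  unfold parent left
  ext <;> simp

theorem parent_right (I : DyadicInterval) : parent (right I) = I := by
  unfold parent right
  ext
  · simp
  · show (2 * I.2 + 1) / 2 = I.2
    omega

theorem left_parent_or_right_parent (J : DyadicInterval) :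
    left (parent J) = J ∨ right (parent J) = J := by
  unfold parent left right
  rcases Int.emod_two_eq_zero_or_one J.2 with h | h
  · left
    ext
    · simp
    · show 2 * (J.2 / 2) = J.2
      omega
  · right
    ext
    · simp
    · show 2 * (J.2 / 2) + 1 = J.2
      omega

theorem subset_parent (J : DyadicInterval) : J.toSet ⊆ (parent J).toSet := by
  rcases left_parent_or_right_parent J with h | h
  · conv_lhs => rw [← h]
    exact left_subset _
  · conv_lhs => rw [← h]
    exact right_subset _

theorem tsum_indicator_le_lintegral {S : Set DyadicInterval} (hS : S.PairwiseDisjoint toSet)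
    {b : DyadicInterval → ℝ≥0∞} {w : ℝ → ℝ≥0∞} (h : ∀ J ∈ S, ∀ x ∈ J.toSet, b J ≤ w x) :
    ∑' J, S.indicator (fun J => volume J.toSet * b J) J ≤ ∫⁻ x, w x := by
  rw [← tsum_subtype]
  calc ∑' J : S, volume (J : DyadicInterval).toSet * b J
      ≤ ∑' J : S, ∫⁻ x in (J : DyadicInterval).toSet, w x := by
        refine ENNReal.tsum_le_tsum fun J => ?_
        rw [mul_comm, ← setLIntegral_const]
        exact setLIntegral_mono' J.1.measurableSet_toSet fun x hx => h J.1 J.2 x hx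
    _ = ∫⁻ x in ⋃ J ∈ S, J.toSet, w x :=
        (lintegral_biUnion (Set.to_countable S) (fun J _ => J.measurableSet_toSet) hS w).symm
    _ ≤ _ := setLIntegral_le_lintegral _ _

/-- If two of these intervals met and one were longer, it would contain the parent of the other,
which lies in `S`, and so belong to `S` itself. -/
theorem pairwiseDisjoint_stopped {S : Set DyadicInterval}
    (hS : ∀ I ∈ S, ∀ J : DyadicInterval, I.toSet ⊆ J.toSet → J ∈ S) :
    {J | J ∉ S ∧ parent J ∈ S}.PairwiseDisjoint toSet := by
  have key : ∀ I J : DyadicInterval, parent I ∈ S → J ∉ S → ∀ x, x ∈ I.toSet → x ∈ J.toSet →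
      J.1 ≤ I.1 := by
    intro I J hI hJ x hxI hxJ
    by_contra! h
    exact hJ (hS _ hI J (toSet_subset_of_mem (by show I.1 + 1 ≤ J.1; omega) hxJ
      (subset_parent I hxI)))
  intro I hI J hJ hne
  rw [Function.onFun, Set.disjoint_left]
  intro x hxI hxJ
  exact hne (eq_of_mem_of_mem (le_antisymm (key J I hJ.2 hI.1 x hxJ hxI)
    (key I J hI.2 hJ.1 x hxI hxJ)) hxI hxJ)

theorem tsum_even_add_odd_le (b : ℤ → ℝ≥0∞) : ∑' j : ℤ, (b (2 * j) + b (2 * j + 1)) ≤ ∑' n, b n := by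
  have hinj : Function.Injective fun q : Bool × ℤ => cond q.1 (2 * q.2 + 1) (2 * q.2) := by
    rintro ⟨a, j⟩ ⟨a', j'⟩ h
    cases a <;> cases a' <;> simp at h ⊢ <;> omega
  refine le_trans (le_of_eq ?_) (ENNReal.tsum_comp_le_tsum_of_injective hinj b)
  rw [ENNReal.tsum_prod (f := fun a j => b (cond a (2 * j + 1) (2 * j))), tsum_bool,
    ENNReal.tsum_add]
  simp

/-- Energy telescopes from coarse to fine scales: by `hsplit` the mass at an interval plus its
energy passes to its children, which either remain in `S` or are stopped. The total is bounded by
the mass left at the finest scale plus the mass of all stopped intervals; each family is disjoint,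
hence the factor 2. -/
theorem tsum_indicator_energy_le {S : Set DyadicInterval}
    (hS : ∀ I ∈ S, ∀ J : DyadicInterval, I.toSet ⊆ J.toSet → J ∈ S)
    {b e : DyadicInterval → ℝ≥0∞} {w : ℝ → ℝ≥0∞}
    (hsplit : ∀ I : DyadicInterval, volume I.toSet * b I + e I ≤
      volume I.left.toSet * b I.left + volume I.right.toSet * b I.right)
    (hw : ∀ I ∈ S, ∀ x ∈ I.toSet, b I ≤ w x)
    (hchild : ∀ J, parent J ∈ S → ∀ x ∈ J.toSet, b J ≤ w x) :
    ∑' I, S.indicator e I ≤ 2 * ∫⁻ x, w x := by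
  classical
  set v : DyadicInterval → ℝ≥0∞ := fun J => volume J.toSet * b J with hv
  set S' : Set DyadicInterval := {J | J ∉ S ∧ parent J ∈ S} with hS'
  set T : ℤ → ℝ≥0∞ := fun k => ∑' j : ℤ, S.indicator v (k, j) with hT
  set P : ℤ → ℝ≥0∞ := fun k => ∑' j : ℤ, S'.indicator v (k, j) with hP
  set D : ℤ → ℝ≥0∞ := fun k => ∑' j : ℤ, S.indicator e (k, j) with hD
  have hTw : ∀ k, T k ≤ ∫⁻ x, w x := by
    intro k
    have h1 : ∀ j : ℤ, S.indicator v (k, j) = {J | J ∈ S ∧ J.1 = k}.indicator v (k, j) := by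
      intro j
      by_cases h : ((k, j) : DyadicInterval) ∈ S
      · rw [Set.indicator_of_mem h, Set.indicator_of_mem
          (show ((k, j) : DyadicInterval) ∈ {J : DyadicInterval | J ∈ S ∧ J.1 = k} from ⟨h, rfl⟩)]
      · rw [Set.indicator_of_notMem h, Set.indicator_of_notMem (fun h' => h h'.1)]
    simp only [hT, h1]
    refine (ENNReal.tsum_comp_le_tsum_of_injective (f := fun j : ℤ => ((k, j) : DyadicInterval))
      (fun a c h => by simpa using h) ({J | J ∈ S ∧ J.1 = k}.indicator v)).trans ?_
    refine tsum_indicator_le_lintegral ?_ fun J hJ => hw J hJ.1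
    intro I hI J hJ hne
    rw [Function.onFun, Set.disjoint_left]
    exact fun x hxI hxJ => hne (eq_of_mem_of_mem (hI.2.trans hJ.2.symm) hxI hxJ)
  have hPw : ∑' k, P k ≤ ∫⁻ x, w x := by
    rw [hP, ← ENNReal.tsum_prod (f := fun k j => S'.indicator v (k, j))]
    exact tsum_indicator_le_lintegral (pairwiseDisjoint_stopped hS) fun J hJ => hchild J hJ.2
  have hstep : ∀ k, T k + D k ≤ T (k - 1) + P (k - 1) := by
    intro k
    simp only [hT, hD, hP, ← ENNReal.tsum_add]
    refine le_trans (ENNReal.tsum_le_tsum fun j => ?_) (tsum_even_add_odd_le fun n =>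
      S.indicator v (k - 1, n) + S'.indicator v (k - 1, n))
    by_cases h : ((k, j) : DyadicInterval) ∈ S
    · have hmem : ∀ J, parent J = (k, j) → v J ≤ S.indicator v J + S'.indicator v J := by
        intro J hJ
        by_cases hJS : J ∈ S
        · rw [Set.indicator_of_mem hJS]
          exact le_self_add
        · rw [Set.indicator_of_mem (show J ∈ S' from ⟨hJS, by rwa [hJ]⟩)]
          exact le_add_self
      rw [Set.indicator_of_mem h, Set.indicator_of_mem h]
      exact (hsplit (k, j)).trans (add_le_add (hmem (left (k, j)) (parent_left _))
        (hmem (right (k, j)) (parent_right _)))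
    · rw [Set.indicator_of_notMem h, Set.indicator_of_notMem h, add_zero]
      exact zero_le
  have hchain : ∀ (a : ℤ) (n : ℕ), T a + ∑ i ∈ Finset.range n, D (a - i) ≤
      T (a - n) + ∑ i ∈ Finset.range n, P (a - 1 - i) := by
    intro a n
    induction n with
    | zero => simp
    | succ n ih =>
      rw [Finset.sum_range_succ, Finset.sum_range_succ, ← add_assoc]
      calc _ ≤ T (a - n) + ∑ i ∈ Finset.range n, P (a - 1 - i) + D (a - n) := by gcongr
        _ = (T (a - n) + D (a - n)) + ∑ i ∈ Finset.range n, P (a - 1 - i) := by ring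
        _ ≤ (T (a - n - 1) + P (a - n - 1)) + ∑ i ∈ Finset.range n, P (a - 1 - i) :=
            add_le_add (hstep _) le_rfl
        _ = _ := by
            rw [show a - ((n + 1 : ℕ) : ℤ) = a - n - 1 by push_cast; ring,
              show a - 1 - (n : ℤ) = a - n - 1 by ring]
            ring
  rw [ENNReal.tsum_prod', ENNReal.tsum_eq_iSup_sum]
  refine iSup_le fun s => ?_
  obtain ⟨a, ha⟩ := s.bddAbove
  obtain ⟨c, hc⟩ := s.bddBelow
  have hinj : Function.Injective fun i : ℕ => a - (i : ℤ) := fun i i' h => by simpa using h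
  have hsub : s ⊆ (Finset.range ((a - c).toNat + 1)).image fun i : ℕ => a - (i : ℤ) := by
    intro k hk
    have h1 : k ≤ a := ha hk
    have h2 : c ≤ k := hc hk
    rw [Finset.mem_image]
    refine ⟨(a - k).toNat, ?_, ?_⟩
    · rw [Finset.mem_range]
      omega
    · omega
  calc ∑ k ∈ s, D k ≤ ∑ k ∈ (Finset.range ((a - c).toNat + 1)).image fun i : ℕ => a - (i : ℤ), D k :=
        Finset.sum_le_sum_of_subset hsub
    _ = ∑ i ∈ Finset.range ((a - c).toNat + 1), D (a - i) := Finset.sum_image hinj.injOn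
    _ ≤ _ := le_add_self.trans (hchain a _)
    _ ≤ (∫⁻ x, w x) + ∫⁻ x, w x := by
        refine add_le_add (hTw _) (((ENNReal.sum_le_tsum _).trans
          (ENNReal.tsum_comp_le_tsum_of_injective (f := fun i : ℕ => a - 1 - (i : ℤ))
            (fun i i' h => by simpa using h) P)).trans hPw)
    _ = _ := (two_mul _).symm

/-! ### Distribution estimate implies an `L^p` estimate -/

/-- The square of the square function of a family of squared coefficients on the line. -/
noncomputable def sqSum (e : DyadicInterval → ℝ≥0∞) (x : ℝ) : ℝ≥0∞ :=
  ∑' I : DyadicInterval, I.toSet.indicator (fun _ => e I / volume I.toSet) x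

theorem measurable_sqSum (e : DyadicInterval → ℝ≥0∞) : Measurable (sqSum e) :=
  Measurable.tsum fun I => measurable_const.indicator I.measurableSet_toSet

/-- Only intervals that meet the set where `M` is at most `t` contribute. -/
theorem setLIntegral_sqSum_le (e : DyadicInterval → ℝ≥0∞) (M : ℝ → ℝ≥0∞)
    (t : ℝ≥0∞) : ∫⁻ x in {x | M x ≤ t}, sqSum e x ≤
      ∑' I, {I : DyadicInterval | ∃ x ∈ I.toSet, M x ≤ t}.indicator e I := by
  unfold sqSum
  rw [lintegral_tsum fun I => (measurable_const.indicator I.measurableSet_toSet).aemeasurable]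
  refine ENNReal.tsum_le_tsum fun I => ?_
  rw [lintegral_indicator_const I.measurableSet_toSet]
  by_cases h : ∃ x ∈ I.toSet, M x ≤ t
  · rw [Set.indicator_of_mem (show I ∈ {I : DyadicInterval | ∃ x ∈ I.toSet, M x ≤ t} from h)]
    calc _ ≤ e I / volume I.toSet * volume I.toSet :=
          mul_le_mul' le_rfl (Measure.restrict_apply_le _ _)
      _ = e I := ENNReal.div_mul_cancel I.volume_toSet_ne_zero I.volume_toSet_ne_top
  · rw [Set.indicator_of_notMem (show I ∉ {I : DyadicInterval | ∃ x ∈ I.toSet, M x ≤ t} from h),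
      Measure.restrict_apply I.measurableSet_toSet]
    have : I.toSet ∩ {x | M x ≤ t} = ∅ := by
      ext x
      simp only [Set.mem_inter_iff, Set.mem_empty_iff_false, iff_false]
      exact fun hx => h ⟨x, hx.1, hx.2⟩
    simp [this]

/-- The terms grow like $2^{jp}$ below $a$ and decay like $a^22^{j(p-2)}$ above it. -/
theorem tsum_layer_min_sq_le {p : ℝ} (h1 : 1 < p) (h2 : p ≤ 2) (a : ℝ≥0∞) :
    ∑' j : ℤ, ((2 : ℝ≥0∞) ^ j) ^ (p - 2) * min a (2 ^ j) ^ 2 ≤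
      (geomConst p + geomConst (2 - p)) * a ^ p := by
  have h0 : 0 < p := by linarith
  rcases eq_or_ne a 0 with rfl | ha0
  · simp [h0]
  rcases eq_or_ne a ∞ with rfl | hat
  · rw [ENNReal.top_rpow_of_pos h0, ENNReal.mul_top]
    · exact le_top
    · exact (one_pos.trans_le ((one_le_geomConst p).trans le_self_add)).ne'
  obtain ⟨n, hn1, hn2⟩ := ENNReal.exists_mem_Ioc_zpow ha0 hat (y := 2) (by norm_num) (by norm_num)
  have hterm : ∀ j : ℤ, ((2 : ℝ≥0∞) ^ j) ^ (p - 2) * min a (2 ^ j) ^ 2 ≤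
      (if (2 : ℝ≥0∞) ^ j < a then ((2 : ℝ≥0∞) ^ j) ^ p else 0) +
        a ^ 2 * (if n + 1 ≤ j then ((2 : ℝ≥0∞) ^ j) ^ (-(2 - p)) else 0) := by
    intro j
    by_cases hj : (2 : ℝ≥0∞) ^ j < a
    · rw [if_pos hj, min_eq_right hj.le]
      refine le_trans (le_of_eq ?_) le_self_add
      rw [← ENNReal.rpow_natCast, ← ENNReal.rpow_add _ _ (two_zpow_ne_zero j) (two_zpow_ne_top j)]
      norm_num
    · have hj' := hj
      rw [not_lt] at hj
      have hnj : n + 1 ≤ j := by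
        by_contra! hlt
        have : (2 : ℝ≥0∞) ^ j ≤ 2 ^ n := ENNReal.zpow_le_of_le (by norm_num) (by omega)
        exact absurd (hn1.trans_le (hj.trans this)) (lt_irrefl _)
      rw [if_neg hj', if_pos hnj, min_eq_left hj, zero_add, mul_comm, neg_sub]
  refine (ENNReal.tsum_le_tsum hterm).trans ?_
  rw [ENNReal.tsum_add, ENNReal.tsum_mul_left, tsum_two_zpow_ge, add_mul]
  refine add_le_add (tsum_layer_le h0 a) ?_
  rw [mul_left_comm]
  refine mul_le_mul' le_rfl ?_
  calc a ^ 2 * ((2 : ℝ≥0∞) ^ (n + 1)) ^ (-(2 - p)) ≤ a ^ 2 * a ^ (-(2 - p)) := by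
        refine mul_le_mul' le_rfl ?_
        rw [ENNReal.rpow_neg, ENNReal.rpow_neg, ENNReal.inv_le_inv]
        exact ENNReal.rpow_le_rpow hn2 (by linarith)
    _ = a ^ p := by
        rw [← ENNReal.rpow_natCast, ← ENNReal.rpow_add _ _ ha0 hat]
        norm_num

theorem rpow_le_tsum_layer_above {p : ℝ} (hp : p < 2) {a : ℝ≥0∞} (ha0 : a ≠ 0) (hat : a ≠ ∞) :
    a ^ (p - 2) ≤ 2 ^ (2 - p) * ∑' j : ℤ, if a ≤ 2 ^ j then ((2 : ℝ≥0∞) ^ j) ^ (p - 2) else 0 := by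
  obtain ⟨n, hn1, hn2⟩ := ENNReal.exists_mem_Ioc_zpow ha0 hat (y := 2) (by norm_num) (by norm_num)
  calc a ^ (p - 2) ≤ ((2 : ℝ≥0∞) ^ n) ^ (p - 2) := by
        rw [← neg_sub, ENNReal.rpow_neg, ENNReal.rpow_neg, ENNReal.inv_le_inv]
        exact ENNReal.rpow_le_rpow hn1.le (by linarith)
    _ = 2 ^ (2 - p) * ((2 : ℝ≥0∞) ^ (n + 1)) ^ (p - 2) := by
        rw [two_zpow_rpow, two_zpow_rpow, ← two_rpow_add]
        congr 1
        push_cast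
        ring
    _ ≤ _ := by
        refine mul_le_mul' le_rfl (le_trans (le_of_eq ?_) (ENNReal.le_tsum (n + 1)))
        rw [if_pos hn2]

/-- Weighting the hypothesis at $t=2^j$ by $2^{j(p-2)}$ and summing bounds $\int GW$ by $\int M^p$,
where $W$ dominates a multiple of $M^{p-2}$. Hölder's inequality with exponents $2/p$ and its dual
then removes the weight. -/
theorem lintegral_rpow_half_le_of_setLIntegral_le {α : Type*} [MeasurableSpace α] {μ : Measure α}
    {p : ℝ} (h1 : 1 < p) (h2 : p < 2) {G M : α → ℝ≥0∞} (hG : Measurable G) (hM : Measurable M)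
    {D : ℝ≥0∞} (h0 : ∀ x, M x = 0 → G x = 0)
    (h : ∀ t, ∫⁻ x in {x | M x ≤ t}, G x ∂μ ≤ D * ∫⁻ x, min (M x) t ^ 2 ∂μ) :
    ∫⁻ x, G x ^ (p / 2) ∂μ ≤ (2 ^ (2 - p) * (D * (geomConst p + geomConst (2 - p)))) ^ (p / 2) *
      ∫⁻ x, M x ^ p ∂μ := by
  have hp0 : 0 < p := by linarith
  have hg0 : geomConst p + geomConst (2 - p) ≠ 0 :=
    (one_pos.trans_le ((one_le_geomConst p).trans le_self_add)).ne'
  have hc0 : (2 : ℝ≥0∞) ^ (2 - p) ≠ 0 := (ENNReal.rpow_pos (by norm_num) (by norm_num)).ne'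
  set W : α → ℝ≥0∞ := fun x =>
    ∑' j : ℤ, if M x ≤ 2 ^ j then ((2 : ℝ≥0∞) ^ j) ^ (p - 2) else 0 with hW
  have hmeas : ∀ j : ℤ, MeasurableSet {x | M x ≤ (2 : ℝ≥0∞) ^ j} := fun j =>
    measurableSet_le hM measurable_const
  have hWm : Measurable W := Measurable.tsum fun j =>
    Measurable.ite (hmeas j) measurable_const measurable_const
  have hGW : ∫⁻ x, G x * W x ∂μ ≤
      D * (geomConst p + geomConst (2 - p)) * ∫⁻ x, M x ^ p ∂μ := by
    calc ∫⁻ x, G x * W x ∂μ = ∑' j : ℤ, ((2 : ℝ≥0∞) ^ j) ^ (p - 2) *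
          ∫⁻ x in {x | M x ≤ 2 ^ j}, G x ∂μ := by
          simp only [hW, ← ENNReal.tsum_mul_left]
          have hm : ∀ j : ℤ, Measurable fun x =>
              G x * if M x ≤ 2 ^ j then ((2 : ℝ≥0∞) ^ j) ^ (p - 2) else 0 := fun j =>
            hG.mul (Measurable.ite (hmeas j) measurable_const measurable_const)
          rw [lintegral_tsum fun j => (hm j).aemeasurable]
          refine tsum_congr fun j => ?_
          rw [← lintegral_const_mul _ hG, ← lintegral_indicator (hmeas j)]
          refine lintegral_congr fun x => ?_
          by_cases hx : M x ≤ 2 ^ j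
          · rw [if_pos hx, Set.indicator_of_mem (show x ∈ {x | M x ≤ 2 ^ j} from hx), mul_comm]
          · rw [if_neg hx, Set.indicator_of_notMem (show x ∉ {x | M x ≤ 2 ^ j} from hx), mul_zero]
      _ ≤ ∑' j : ℤ, ((2 : ℝ≥0∞) ^ j) ^ (p - 2) * (D * ∫⁻ x, min (M x) (2 ^ j) ^ 2 ∂μ) :=
          ENNReal.tsum_le_tsum fun j => mul_le_mul' le_rfl (h _)
      _ = D * ∫⁻ x, ∑' j : ℤ, ((2 : ℝ≥0∞) ^ j) ^ (p - 2) * min (M x) (2 ^ j) ^ 2 ∂μ := by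
          rw [lintegral_tsum fun j =>
            (((hM.min measurable_const).pow_const 2).const_mul _).aemeasurable,
            ← ENNReal.tsum_mul_left]
          refine tsum_congr fun j => ?_
          rw [lintegral_const_mul _ ((hM.min measurable_const).pow_const 2)]
          ring
      _ ≤ D * ∫⁻ x, (geomConst p + geomConst (2 - p)) * M x ^ p ∂μ :=
          mul_le_mul' le_rfl (lintegral_mono fun x => tsum_layer_min_sq_le h1 h2.le _)
      _ = _ := by rw [lintegral_const_mul _ (hM.pow_const _), mul_assoc]
  by_cases hfin : ∫⁻ x, M x ^ p ∂μ = ∞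
  · rcases eq_or_ne D 0 with rfl | hD
    · have hGW0 : ∀ t : ℝ≥0∞, ∫⁻ x in {x | M x ≤ t}, G x ∂μ = 0 := fun t => by simpa using h t
      have := hGW0 ∞
      simp only [le_top, Set.ofPred_true, Measure.restrict_univ] at this
      rw [lintegral_eq_zero_iff hG] at this
      have h3 : ∫⁻ x, G x ^ (p / 2) ∂μ = 0 := by
        rw [lintegral_eq_zero_iff (hG.pow_const _)]
        filter_upwards [this] with x hx
        simp only [Pi.zero_apply] at hx ⊢
        rw [hx, ENNReal.zero_rpow_of_pos (by linarith)]
      rw [h3]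
      exact zero_le
    · rw [hfin, ENNReal.mul_top]
      · exact le_top
      · have := (ENNReal.rpow_pos_of_nonneg
          (pos_iff_ne_zero.2 (mul_ne_zero hc0 (mul_ne_zero hD hg0))) (by linarith : 0 ≤ p / 2))
        exact this.ne'
  have hMt : ∀ᵐ x ∂μ, M x ≠ ∞ := by
    filter_upwards [ae_lt_top (hM.pow_const p) hfin] with x hx hx'
    rw [hx', ENNReal.top_rpow_of_pos hp0] at hx
    exact lt_irrefl _ hx
  have hpt : ∀ᵐ x ∂μ, G x ^ (p / 2) ≤
      ((2 : ℝ≥0∞) ^ (2 - p)) ^ (p / 2) * ((G x * W x) ^ (p / 2) * (M x ^ p) ^ (1 - p / 2)) := by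
    filter_upwards [hMt] with x hx
    rcases eq_or_ne (M x) 0 with hx0 | hx0
    · rw [h0 x hx0, ENNReal.zero_rpow_of_pos (by linarith)]
      exact zero_le
    -- The powers of $M$ cancel: $(p-2)p/2+p(1-p/2)=0$.
    have h3 : (1 : ℝ≥0∞) ≤ (2 ^ (2 - p) * W x) ^ (p / 2) * (M x ^ p) ^ (1 - p / 2) := by
      calc (1 : ℝ≥0∞) = (M x ^ (p - 2)) ^ (p / 2) * (M x ^ p) ^ (1 - p / 2) := by
            rw [← ENNReal.rpow_mul, ← ENNReal.rpow_mul, ← ENNReal.rpow_add _ _ hx0 hx]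
            ring_nf
            simp
        _ ≤ _ := mul_le_mul' (ENNReal.rpow_le_rpow (rpow_le_tsum_layer_above h2 hx0 hx)
            (by linarith)) le_rfl
    calc G x ^ (p / 2) = G x ^ (p / 2) * 1 := (mul_one _).symm
      _ ≤ G x ^ (p / 2) * ((2 ^ (2 - p) * W x) ^ (p / 2) * (M x ^ p) ^ (1 - p / 2)) :=
          mul_le_mul' le_rfl h3
      _ = _ := by
          rw [ENNReal.mul_rpow_of_nonneg _ _ (by linarith : 0 ≤ p / 2),
            ENNReal.mul_rpow_of_nonneg _ _ (by linarith : 0 ≤ p / 2)]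
          ring
  have hct : ((2 : ℝ≥0∞) ^ (2 - p)) ^ (p / 2) ≠ ∞ :=
    ENNReal.rpow_ne_top_of_nonneg (by linarith)
      (ENNReal.rpow_ne_top_of_nonneg (by linarith) (by norm_num))
  calc ∫⁻ x, G x ^ (p / 2) ∂μ ≤ ∫⁻ x, ((2 : ℝ≥0∞) ^ (2 - p)) ^ (p / 2) *
        ((G x * W x) ^ (p / 2) * (M x ^ p) ^ (1 - p / 2)) ∂μ := lintegral_mono_ae hpt
    _ = ((2 : ℝ≥0∞) ^ (2 - p)) ^ (p / 2) *
        ∫⁻ x, (G x * W x) ^ (p / 2) * (M x ^ p) ^ (1 - p / 2) ∂μ := lintegral_const_mul' _ _ hct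
    _ ≤ ((2 : ℝ≥0∞) ^ (2 - p)) ^ (p / 2) *
        ((∫⁻ x, G x * W x ∂μ) ^ (p / 2) * (∫⁻ x, M x ^ p ∂μ) ^ (1 - p / 2)) :=
        mul_le_mul' le_rfl (ENNReal.lintegral_mul_norm_pow_le (hG.mul hWm).aemeasurable
          (hM.pow_const p).aemeasurable (by linarith) (by linarith) (by ring))
    _ ≤ ((2 : ℝ≥0∞) ^ (2 - p)) ^ (p / 2) *
        ((D * (geomConst p + geomConst (2 - p)) * ∫⁻ x, M x ^ p ∂μ) ^ (p / 2) *
          (∫⁻ x, M x ^ p ∂μ) ^ (1 - p / 2)) :=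
        mul_le_mul' le_rfl (mul_le_mul' (ENNReal.rpow_le_rpow hGW (by linarith)) le_rfl)
    _ = _ := by
        rw [ENNReal.mul_rpow_of_nonneg _ _ (by linarith : 0 ≤ p / 2),
          ENNReal.mul_rpow_of_nonneg (2 ^ (2 - p)) _ (by linarith : 0 ≤ p / 2), mul_assoc, mul_assoc,
          ← ENNReal.rpow_add_of_nonneg _ _ (by linarith) (by linarith)]
        simp

end DyadicInterval

end MultiParam

namespace MultiParam

/-! ### Haar square functions of families on the line -/

/-- Minkowski's integral inequality: the squared $\ell^2$ norm is the integral of an inner product,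
and one factor is divided out. Division needs finiteness, so an infinite integral is treated first.
-/
theorem l2norm_lintegral_le {α ι : Type*} [MeasurableSpace α] {μ : Measure α} [Countable ι]
    {g : ι → α → ℝ≥0∞} (hg : ∀ a, AEMeasurable (g a) μ) :
    l2norm (fun a => ∫⁻ x, g a x ∂μ) ≤ ∫⁻ x, l2norm (fun a => g a x) ∂μ := by
  have hle : ∀ a x, g a x ≤ l2norm fun a => g a x := by
    intro a x
    rw [← sq_rpow_half (g a x)]
    exact ENNReal.rpow_le_rpow (ENNReal.le_tsum (f := fun a => g a x ^ 2) a) (by norm_num)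
  by_cases htop : ∃ a, ∫⁻ x, g a x ∂μ = ∞
  · obtain ⟨a, ha⟩ := htop
    refine le_top.trans (ha.symm.le.trans (lintegral_mono fun x => hle a x))
  push Not at htop
  rw [l2norm_le_iff]
  intro s
  set N := (∑ a ∈ s, (∫⁻ x, g a x ∂μ) ^ 2) ^ (1 / 2 : ℝ) with hN
  have hNt : N ≠ ∞ := by
    refine ENNReal.rpow_ne_top_of_nonneg (by norm_num) (ENNReal.sum_ne_top.2 fun a _ => ?_)
    exact ENNReal.pow_ne_top (htop a)
  rcases eq_or_ne N 0 with h0 | h0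
  · rw [h0]
    exact zero_le
  have h1 : N * N ≤ N * ∫⁻ x, l2norm (fun a => g a x) ∂μ := by
    calc N * N = ∑ a ∈ s, (∫⁻ x, g a x ∂μ) * ∫⁻ x, g a x ∂μ := by
          rw [← pow_two, hN, rpow_half_sq]
          exact Finset.sum_congr rfl fun a _ => pow_two _
      _ = ∫⁻ x, ∑ a ∈ s, (∫⁻ y, g a y ∂μ) * g a x ∂μ := by
          rw [lintegral_finsetSum' _ fun a _ => (hg a).const_mul _]
          exact Finset.sum_congr rfl fun a _ => (lintegral_const_mul'' _ (hg a)).symm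
      _ ≤ ∫⁻ x, N * l2norm (fun a => g a x) ∂μ := by
          refine lintegral_mono fun x => ?_
          have := ENNReal.inner_le_Lp_mul_Lq s (fun a => ∫⁻ y, g a y ∂μ) (fun a => g a x)
            Real.HolderConjugate.two_two
          simp only [ENNReal.rpow_ofNat] at this
          exact this.trans (mul_le_mul' le_rfl (l2norm_le_iff.1 le_rfl s))
      _ = _ := lintegral_const_mul' _ _ hNt
  exact (ENNReal.mul_le_mul_iff_right h0 hNt).1 h1

theorem enorm_sq (z : ℂ) : ‖z‖ₑ ^ 2 = ENNReal.ofReal (‖z‖ ^ 2) := by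
  rw [ENNReal.ofReal_pow (norm_nonneg _), ofReal_norm]

namespace DyadicInterval

/-- The parallelogram law for the integrals over the two halves. -/
theorem energy_split {ψ : ℝ → ℂ} {I : DyadicInterval} (hψ : IntegrableOn ψ I.toSet) :
    volume I.toSet * ‖average ψ I‖ₑ ^ 2 + ‖coef ψ I‖ₑ ^ 2 =
      volume I.left.toSet * ‖average ψ I.left‖ₑ ^ 2 +
        volume I.right.toSet * ‖average ψ I.right‖ₑ ^ 2 := by
  have hI := I.length_pos
  have hs : (I.length ^ (-(1 / 2) : ℝ)) ^ 2 = I.length⁻¹ := by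
    rw [← Real.rpow_natCast, ← Real.rpow_mul hI.le, ← Real.rpow_neg_one]
    norm_num
  simp only [volume_toSet, enorm_sq]
  rw [← ENNReal.ofReal_mul hI.le, ← ENNReal.ofReal_mul I.left.length_pos.le,
    ← ENNReal.ofReal_mul I.right.length_pos.le, ← ENNReal.ofReal_add (by positivity) (by positivity),
    ← ENNReal.ofReal_add (mul_nonneg I.left.length_pos.le (by positivity))
      (mul_nonneg I.right.length_pos.le (by positivity))]
  congr 1
  rw [coef_eq I hψ]
  simp only [average]
  rw [integral_toSet_eq I hψ, length_left, length_right]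
  set X := ∫ t in I.left.toSet, ψ t
  set Y := ∫ t in I.right.toSet, ψ t
  have hpar := parallelogram_law_with_norm ℝ X Y
  simp only [norm_smul, norm_mul, mul_pow, Complex.norm_real, norm_inv, Real.norm_eq_abs, sq_abs,
    inv_pow, hs]
  field_simp
  linear_combination hpar

theorem l2norm_average_le {ι : Type*} [Countable ι] {f : ι → ℝ → ℂ} (hf : ∀ a, Measurable (f a))
    (I : DyadicInterval) : l2norm (fun a => ‖average (f a) I‖ₑ) ≤
      (volume I.toSet)⁻¹ * ∫⁻ t in I.toSet, l2norm (fun a => ‖f a t‖ₑ) := by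
  have h1 : ∀ a, ‖average (f a) I‖ₑ ≤ ∫⁻ t in I.toSet, (volume I.toSet)⁻¹ * ‖f a t‖ₑ := by
    intro a
    rw [average, enorm_smul, lintegral_const_mul _ (hf a).enorm]
    refine mul_le_mul' (le_of_eq ?_) (enorm_integral_le_lintegral_enorm _)
    rw [volume_toSet, ← ENNReal.ofReal_inv_of_pos I.length_pos,
      Real.enorm_of_nonneg (inv_nonneg.2 I.length_pos.le)]
  refine (l2norm_mono h1).trans ((l2norm_lintegral_le fun a =>
    ((hf a).enorm.const_mul _).aemeasurable).trans (le_of_eq ?_))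
  rw [← lintegral_const_mul' _ _ (ENNReal.inv_ne_top.2 I.volume_toSet_ne_zero)]
  refine lintegral_congr fun t => ?_
  unfold l2norm
  simp only [mul_pow, ENNReal.tsum_mul_left]
  rw [ENNReal.mul_rpow_of_nonneg _ _ (by norm_num), sq_rpow_half]

theorem volume_left (I : DyadicInterval) : volume I.left.toSet = 2⁻¹ * volume I.toSet := by
  rw [volume_toSet, volume_toSet, length_left, div_eq_inv_mul,
    ENNReal.ofReal_mul (by norm_num), ENNReal.ofReal_inv_of_pos (by norm_num), ENNReal.ofReal_ofNat]

theorem volume_right (I : DyadicInterval) : volume I.right.toSet = 2⁻¹ * volume I.toSet := by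
  rw [volume_toSet, volume_toSet, length_right, div_eq_inv_mul,
    ENNReal.ofReal_mul (by norm_num), ENNReal.ofReal_inv_of_pos (by norm_num), ENNReal.ofReal_ofNat]

theorem average_le_two_mul_parent (u : ℝ → ℝ≥0∞) (J : DyadicInterval) :
    (volume J.toSet)⁻¹ * ∫⁻ t in J.toSet, u t ≤
      2 * ((volume J.parent.toSet)⁻¹ * ∫⁻ t in J.parent.toSet, u t) := by
  have hv : volume J.toSet = 2⁻¹ * volume J.parent.toSet := by
    rcases left_parent_or_right_parent J with h | h
    · conv_lhs => rw [← h, volume_left]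
    · conv_lhs => rw [← h, volume_right]
  rw [hv, ENNReal.mul_inv (Or.inl (by norm_num)) (Or.inl (by norm_num)), inv_inv, mul_assoc]
  exact mul_le_mul' le_rfl (mul_le_mul' le_rfl (lintegral_mono_set (subset_parent J)))

/-- The squared Haar coefficients of a family. -/
noncomputable def sqCoef {ι : Type*} (f : ι → ℝ → ℂ) (I : DyadicInterval) : ℝ≥0∞ :=
  ∑' a, ‖coef (f a) I‖ₑ ^ 2

section Family

variable {ι : Type*} {f : ι → ℝ → ℂ}

theorem sqCoef_split (hi : ∀ a, Integrable (f a)) (I : DyadicInterval) :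
    volume I.toSet * l2norm (fun a => ‖average (f a) I‖ₑ) ^ 2 + sqCoef f I =
      volume I.left.toSet * l2norm (fun a => ‖average (f a) I.left‖ₑ) ^ 2 +
        volume I.right.toSet * l2norm (fun a => ‖average (f a) I.right‖ₑ) ^ 2 := by
  simp only [l2norm_sq, sqCoef, ← ENNReal.tsum_mul_left, ← ENNReal.tsum_add]
  exact tsum_congr fun a => energy_split (hi a).integrableOn

/-- Stop at the intervals that miss the set where the maximal function `M` is at most `t`. Averages
over the others are at most `min M t`, and those over their children at most twice that, so `4 * min
M t ^ 2` works as density; the telescoping doubles it to 8. -/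
theorem setLIntegral_sqSum_sqCoef_le [Countable ι] (hf : ∀ a, Measurable (f a)) (hi : ∀ a, Integrable (f a))
    (t : ℝ≥0∞) :
    ∫⁻ x in {x | maxFn (1 / 2) (fun x => l2norm fun a => ‖f a x‖ₑ) x ≤ t}, sqSum (sqCoef f) x ≤
      8 * ∫⁻ x, min (maxFn (1 / 2) (fun x => l2norm fun a => ‖f a x‖ₑ) x) t ^ 2 := by
  set u : ℝ → ℝ≥0∞ := fun x => l2norm fun a => ‖f a x‖ₑ with hu
  set M := maxFn (1 / 2) u with hM
  have hav : ∀ (I : DyadicInterval) x, x ∈ I.toSet →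
      (volume I.toSet)⁻¹ * ∫⁻ t in I.toSet, u t ≤ M x := fun I x hx =>
    average_le_maxFn (I.toSet_subset_dil le_rfl hx) u
  refine (setLIntegral_sqSum_le _ M t).trans ?_
  refine (tsum_indicator_energy_le (w := fun x => 4 * min (M x) t ^ 2) ?_
    (fun I => (sqCoef_split hi I).le) ?_ ?_).trans (le_of_eq ?_)
  · rintro I ⟨x, hx, hxt⟩ J hIJ
    exact ⟨x, hIJ hx, hxt⟩
  · rintro I ⟨y, hy, hyt⟩ x hx
    have h1 : l2norm (fun a => ‖average (f a) I‖ₑ) ≤ min (M x) t :=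
      (l2norm_average_le hf I).trans (le_min (hav I x hx) ((hav I y hy).trans hyt))
    calc _ ≤ min (M x) t ^ 2 := pow_le_pow_left' h1 2
      _ ≤ _ := le_mul_of_one_le_left' (by norm_num)
  · rintro J ⟨y, hy, hyt⟩ x hx
    have h1 : l2norm (fun a => ‖average (f a) J‖ₑ) ≤ 2 * min (M x) t := by
      refine (l2norm_average_le hf J).trans ((average_le_two_mul_parent u J).trans ?_)
      exact mul_le_mul' le_rfl (le_min (hav _ x (subset_parent J hx)) ((hav _ y hy).trans hyt))
    calc _ ≤ (2 * min (M x) t) ^ 2 := pow_le_pow_left' h1 2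
      _ = _ := by rw [mul_pow]; norm_num
  · rw [lintegral_const_mul' _ _ (by norm_num), ← mul_assoc]
    norm_num

theorem sqSum_eq_zero_of_maxFn_eq_zero [Countable ι] (hf : ∀ a, Measurable (f a)) (hi : ∀ a, Integrable (f a))
    {x : ℝ} (hx : maxFn (1 / 2) (fun x => l2norm fun a => ‖f a x‖ₑ) x = 0) :
    sqSum (sqCoef f) x = 0 := by
  set u : ℝ → ℝ≥0∞ := fun x => l2norm fun a => ‖f a x‖ₑ with hu
  unfold sqSum
  rw [ENNReal.tsum_eq_zero]
  intro I
  by_cases hxI : x ∈ I.toSet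
  · have h0 : (volume I.toSet)⁻¹ * ∫⁻ t in I.toSet, u t = 0 := by
      have := average_le_maxFn (I.toSet_subset_dil le_rfl hxI) u
      rw [hx] at this
      exact nonpos_iff_eq_zero.1 this
    have hJ : ∀ J, parent J = I → l2norm (fun a => ‖average (f a) J‖ₑ) = 0 := by
      intro J hJ
      refine nonpos_iff_eq_zero.1 ((l2norm_average_le hf J).trans
        ((average_le_two_mul_parent u J).trans ?_))
      rw [hJ, h0, mul_zero]
    have hs := sqCoef_split hi I
    rw [hJ _ (parent_left I), hJ _ (parent_right I)] at hs
    have : sqCoef f I = 0 := by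
      refine nonpos_iff_eq_zero.1 (le_add_self.trans (hs.le.trans ?_))
      simp
    simp [this]
  · exact Set.indicator_of_notMem hxI _

end Family

theorem measurable_l2norm {α ι : Type*} [MeasurableSpace α] [Countable ι] {g : ι → α → ℝ≥0∞}
    (hg : ∀ a, Measurable (g a)) : Measurable fun x => l2norm fun a => g a x :=
  (Measurable.tsum fun a => (hg a).pow_const 2).pow_const _

/-- The `L^p` estimate for Haar square functions of families on the line. -/
theorem exists_lintegral_sqSum_rpow_le {p : ℝ} (h1 : 1 < p) (h2 : p ≤ 2) :
    ∃ C : ℝ≥0∞, C ≠ ∞ ∧ ∀ {ι : Type} [Countable ι] (f : ι → ℝ → ℂ), (∀ a, Measurable (f a)) →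
      (∀ a, Integrable (f a)) →
      ∫⁻ x, sqSum (sqCoef f) x ^ (p / 2) ≤ C * ∫⁻ x, (∑' a, ‖f a x‖ₑ ^ 2) ^ (p / 2) := by
  have hmax : ∀ {ι : Type} [Countable ι] (f : ι → ℝ → ℂ), (∀ a, Measurable (f a)) →
      ∫⁻ x, maxFn (1 / 2) (fun x => l2norm fun a => ‖f a x‖ₑ) x ^ p ≤
        maxConst p * ∫⁻ x, (∑' a, ‖f a x‖ₑ ^ 2) ^ (p / 2) := by
    intro ι _ f hf
    refine (lintegral_maxFn_rpow_le le_rfl h1 (measurable_l2norm fun a => (hf a).enorm)).trans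
      (le_of_eq ?_)
    simp only [l2norm, ← ENNReal.rpow_mul]
    rw [show (1 / 2 : ℝ) * p = p / 2 by ring]
    norm_num
  rcases h2.lt_or_eq with h2 | rfl
  · refine ⟨(2 ^ (2 - p) * (8 * (geomConst p + geomConst (2 - p)))) ^ (p / 2) * maxConst p, ?_, ?_⟩
    · refine ENNReal.mul_ne_top (ENNReal.rpow_ne_top_of_nonneg (by linarith) ?_)
        (maxConst_lt_top h1).ne
      refine ENNReal.mul_ne_top (ENNReal.rpow_ne_top_of_nonneg (by linarith) (by norm_num))
        (ENNReal.mul_ne_top (by norm_num) (ENNReal.add_ne_top.2 ⟨?_, ?_⟩))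
      · exact (geomConst_lt_top (by linarith)).ne
      · exact (geomConst_lt_top (by linarith)).ne
    · intro ι _ f hf hi
      rw [mul_assoc]
      exact (lintegral_rpow_half_le_of_setLIntegral_le h1 h2 (measurable_sqSum _)
        (measurable_maxFn _ _) (fun x hx => sqSum_eq_zero_of_maxFn_eq_zero hf hi hx)
        (setLIntegral_sqSum_sqCoef_le hf hi)).trans (mul_le_mul' le_rfl (hmax f hf))
  -- At $p=2$ no stopping is needed: `t = ∞` gives the full energy.
  · refine ⟨8 * maxConst 2, ENNReal.mul_ne_top (by norm_num) (maxConst_lt_top (by norm_num)).ne, ?_⟩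
    intro ι _ f hf hi
    have h := setLIntegral_sqSum_sqCoef_le hf hi ∞
    simp only [le_top, Set.ofPred_true, Measure.restrict_univ, min_top_right] at h
    have h3 := hmax f hf
    simp only [ENNReal.rpow_ofNat] at h3
    rw [mul_assoc]
    refine le_trans (le_of_eq ?_) (h.trans (mul_le_mul' le_rfl h3))
    norm_num

end DyadicInterval

end MultiParam

namespace MultiParam

/-! ### Splitting off the first coordinate -/

section Cons

variable {d : ℕ}

theorem measurable_cons :
    Measurable fun z : ℝ × (Fin d → ℝ) => (Fin.cons z.1 z.2 : Fin (d + 1) → ℝ) := by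
  refine measurable_pi_iff.2 fun i => ?_
  refine Fin.cases ?_ (fun j => ?_) i
  · simpa using measurable_fst
  · simpa [Function.comp_def] using (measurable_pi_apply j).comp measurable_snd

theorem cons_eq_piFinSuccAbove_symm :
    (fun z : ℝ × (Fin d → ℝ) => (Fin.cons z.1 z.2 : Fin (d + 1) → ℝ)) =
      (MeasurableEquiv.piFinSuccAbove (fun _ : Fin (d + 1) => ℝ) 0).symm := by
  funext z
  simp [MeasurableEquiv.piFinSuccAbove, Fin.consEquiv]

theorem measurePreserving_cons : MeasurePreserving
    (fun z : ℝ × (Fin d → ℝ) => (Fin.cons z.1 z.2 : Fin (d + 1) → ℝ))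
    ((volume : Measure ℝ).prod (volume : Measure (Fin d → ℝ))) volume := by
  rw [cons_eq_piFinSuccAbove_symm]
  exact (volume_preserving_piFinSuccAbove (fun _ : Fin (d + 1) => ℝ) 0).symm

theorem measurableEmbedding_cons : MeasurableEmbedding
    (fun z : ℝ × (Fin d → ℝ) => (Fin.cons z.1 z.2 : Fin (d + 1) → ℝ)) := by
  rw [cons_eq_piFinSuccAbove_symm]
  exact (MeasurableEquiv.piFinSuccAbove (fun _ : Fin (d + 1) => ℝ) 0).symm.measurableEmbedding

theorem lintegral_cons {G : (Fin (d + 1) → ℝ) → ℝ≥0∞} (hG : Measurable G) :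
    ∫⁻ x, G x = ∫⁻ t : ℝ, ∫⁻ y : Fin d → ℝ, G (Fin.cons t y) := by
  rw [← measurePreserving_cons.lintegral_comp hG]
  exact lintegral_prod (fun z : ℝ × (Fin d → ℝ) => G (Fin.cons z.1 z.2))
    (hG.comp measurable_cons).aemeasurable

theorem lintegral_cons_symm {G : (Fin (d + 1) → ℝ) → ℝ≥0∞} (hG : Measurable G) :
    ∫⁻ x, G x = ∫⁻ y : Fin d → ℝ, ∫⁻ t : ℝ, G (Fin.cons t y) := by
  rw [← measurePreserving_cons.lintegral_comp hG]
  exact lintegral_prod_symm (fun z : ℝ × (Fin d → ℝ) => G (Fin.cons z.1 z.2))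
    (hG.comp measurable_cons).aemeasurable

theorem integrable_comp_cons {f : (Fin (d + 1) → ℝ) → ℂ} (hf : Integrable f) :
    Integrable (fun z : ℝ × (Fin d → ℝ) => f (Fin.cons z.1 z.2)) (volume.prod volume) :=
  (measurePreserving_cons.integrable_comp_emb measurableEmbedding_cons).2 hf

theorem integral_cons_symm {f : (Fin (d + 1) → ℝ) → ℂ} (hf : Integrable f) :
    ∫ x, f x = ∫ y : Fin d → ℝ, ∫ t : ℝ, f (Fin.cons t y) := by
  rw [← measurePreserving_cons.integral_comp measurableEmbedding_cons,
    integral_prod_symm _ (integrable_comp_cons hf)]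

/-- The Haar coefficient of `f` in the first coordinate. -/
noncomputable def headCoef (f : (Fin (d + 1) → ℝ) → ℂ) (I : DyadicInterval) (y : Fin d → ℝ) : ℂ :=
  DyadicInterval.coef (fun t => f (Fin.cons t y)) I

theorem measurable_headCoef {f : (Fin (d + 1) → ℝ) → ℂ} (hf : Measurable f) (I : DyadicInterval) :
    Measurable (headCoef f I) := by
  have h : Measurable (Function.uncurry fun (t : ℝ) (y : Fin d → ℝ) =>
      f (Fin.cons t y) * I.haar t) :=
    (hf.comp measurable_cons).mul (I.measurable_haar.comp measurable_fst)
  exact h.stronglyMeasurable.integral_prod_left.measurable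

theorem norm_haar_comp_le (I : DyadicInterval) : ∀ z : ℝ × (Fin d → ℝ),
    ‖I.haar z.1‖ ≤ I.length ^ (-(1 / 2) : ℝ) := fun z => I.norm_haar_le z.1

theorem integrable_headCoef {f : (Fin (d + 1) → ℝ) → ℂ} (hf : Integrable f) (I : DyadicInterval) :
    Integrable (headCoef f I) := by
  have h : Integrable (fun z : ℝ × (Fin d → ℝ) => f (Fin.cons z.1 z.2) * I.haar z.1)
      (volume.prod volume) := (integrable_comp_cons hf).mul_bdd
    (c := I.length ^ (-(1 / 2) : ℝ)) (I.measurable_haar.comp measurable_fst).aestronglyMeasurable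
    (Filter.Eventually.of_forall (norm_haar_comp_le I))
  exact h.integral_prod_right

theorem DyadicRect.norm_haar_le (R : DyadicRect d) (x : Fin d → ℝ) :
    ‖R.haar x‖ ≤ ∏ i, (R i).length ^ (-(1 / 2) : ℝ) := by
  unfold DyadicRect.haar
  rw [norm_prod]
  exact Finset.prod_le_prod (fun _ _ => norm_nonneg _) fun i _ => (R i).norm_haar_le _

theorem pairing_haar_cons {f : (Fin (d + 1) → ℝ) → ℂ} (hf : Integrable f) (I : DyadicInterval)
    (R : DyadicRect d) :
    pairing f (DyadicRect.haar (Fin.cons I R : DyadicRect (d + 1))) =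
      pairing (headCoef f I) R.haar := by
  unfold pairing
  have hi : Integrable fun x => f x *
      (starRingEnd ℂ) (DyadicRect.haar (Fin.cons I R : DyadicRect (d + 1)) x) := by
    simp only [DyadicRect.star_haar]
    exact hf.mul_bdd (DyadicRect.measurable_haar _).aestronglyMeasurable
      (Filter.Eventually.of_forall (DyadicRect.norm_haar_le _))
  rw [integral_cons_symm hi]
  refine integral_congr_ae (Filter.Eventually.of_forall fun y => ?_)
  simp only [DyadicRect.star_haar, headCoef, DyadicInterval.coef]
  rw [← integral_mul_const]
  refine integral_congr_ae (Filter.Eventually.of_forall fun t => ?_)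
  simp only [DyadicRect.haar, Fin.prod_univ_succ, Fin.cons_zero, Fin.cons_succ]
  ring

theorem mem_toSet_cons {I : DyadicInterval} {R : DyadicRect d} {t : ℝ} {y : Fin d → ℝ} :
    (Fin.cons t y : Fin (d + 1) → ℝ) ∈ DyadicRect.toSet (Fin.cons I R : DyadicRect (d + 1)) ↔
      t ∈ I.toSet ∧ y ∈ R.toSet := by
  unfold DyadicRect.toSet
  simp [Set.mem_pi, Fin.forall_fin_succ]

theorem volume_toSet_cons (I : DyadicInterval) (R : DyadicRect d) :
    volume (DyadicRect.toSet (Fin.cons I R : DyadicRect (d + 1))) =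
      volume I.toSet * volume R.toSet := by
  simp [DyadicRect.volume_toSet, Fin.prod_univ_succ]

/-- The square of the square function of a family of squared coefficients. -/
noncomputable def rectSum (e : DyadicRect d → ℝ≥0∞) (x : Fin d → ℝ) : ℝ≥0∞ :=
  ∑' R : DyadicRect d, R.toSet.indicator (fun _ => e R / volume R.toSet) x

theorem measurable_rectSum (e : DyadicRect d → ℝ≥0∞) : Measurable (rectSum e) :=
  Measurable.tsum fun R => measurable_const.indicator R.measurableSet_toSet

theorem rectSum_cons (e : DyadicRect (d + 1) → ℝ≥0∞) (t : ℝ) (y : Fin d → ℝ) :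
    rectSum e (Fin.cons t y) = rectSum (fun R => ∑' I : DyadicInterval,
      I.toSet.indicator (fun _ => e (Fin.cons I R : DyadicRect (d + 1)) / volume I.toSet) t) y := by
  unfold rectSum
  rw [← (Fin.consEquiv fun _ : Fin (d + 1) => DyadicInterval).tsum_eq, ENNReal.tsum_prod',
    ENNReal.tsum_comm]
  refine tsum_congr fun (R : DyadicRect d) => ?_
  by_cases hy : y ∈ R.toSet
  · rw [Set.indicator_of_mem hy, ENNReal.div_eq_inv_mul, ← ENNReal.tsum_mul_left]
    refine tsum_congr fun I => ?_
    simp only [Fin.consEquiv, Equiv.coe_fn_mk]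
    by_cases ht : t ∈ I.toSet
    · rw [Set.indicator_of_mem ht, Set.indicator_of_mem (mem_toSet_cons.2 ⟨ht, hy⟩),
        volume_toSet_cons, ENNReal.div_eq_inv_mul, ENNReal.div_eq_inv_mul,
        ENNReal.mul_inv (Or.inl I.volume_toSet_ne_zero) (Or.inl I.volume_toSet_ne_top)]
      ring
    · rw [Set.indicator_of_notMem ht, Set.indicator_of_notMem fun h => ht (mem_toSet_cons.1 h).1,
        mul_zero]
  · rw [Set.indicator_of_notMem hy, ENNReal.tsum_eq_zero]
    intro I
    exact Set.indicator_of_notMem (fun h => hy (mem_toSet_cons.1 h).2) _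

end Cons

/-! ### Haar square functions of families on `ℝ^d` -/

theorem tsum_prod_swap {ι κ : Type*} (F : ι × κ → ℝ≥0∞) :
    ∑' r, F r = ∑' b, ∑' a, F (a, b) := by
  rw [ENNReal.tsum_prod', ENNReal.tsum_comm]

theorem enorm_pairing_const_mul {d : ℕ} (c : ℂ) (f φ : (Fin d → ℝ) → ℂ) :
    ‖pairing (fun x => c * f x) φ‖ₑ = ‖c‖ₑ * ‖pairing f φ‖ₑ := by
  unfold pairing
  rw [← enorm_mul, ← integral_const_mul]
  simp only [mul_assoc]

/-- The squared Haar coefficients of a family on `ℝ^d`. -/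
noncomputable def sqPairing {d : ℕ} {ι : Type*} (f : ι → (Fin d → ℝ) → ℂ) (R : DyadicRect d) :
    ℝ≥0∞ := ∑' a, ‖pairing (f a) R.haar‖ₑ ^ 2

/-- Induction on the dimension. For fixed first coordinate $t$ the square function in dimension
$d+1$ is that of an enlarged family in dimension $d$, indexed also by the first sides, so families
rather than single functions carry the induction. The square sum of this family is a one-dimensional
square function in $t$, which the hypothesis bounds for almost every $y$. -/
theorem lintegral_rectSum_sqPairing_rpow_le {q : ℝ} (hq : 0 ≤ q) {C : ℝ≥0∞}
    (hC : ∀ {ι : Type} [Countable ι] (f : ι → ℝ → ℂ), (∀ a, Measurable (f a)) →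
      (∀ a, Integrable (f a)) → ∫⁻ x, DyadicInterval.sqSum (DyadicInterval.sqCoef f) x ^ q ≤
        C * ∫⁻ x, (∑' a, ‖f a x‖ₑ ^ 2) ^ q) (d : ℕ) {ι : Type} [Countable ι]
    (f : ι → (Fin d → ℝ) → ℂ) (hf : ∀ a, Measurable (f a)) (hi : ∀ a, Integrable (f a)) :
    ∫⁻ x, rectSum (sqPairing f) x ^ q ≤ C ^ d * ∫⁻ x, (∑' a, ‖f a x‖ₑ ^ 2) ^ q := by
  induction d generalizing ι with
  | zero =>
    rw [pow_zero, one_mul]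
    refine lintegral_mono fun x => ENNReal.rpow_le_rpow (le_of_eq ?_) hq
    have hx : ∀ R : DyadicRect 0, x ∈ R.toSet := fun R i => i.elim0
    have hv : ∀ R : DyadicRect 0, volume R.toSet = 1 := fun R => by
      rw [DyadicRect.volume_toSet]
      simp
    have hp : ∀ (R : DyadicRect 0) a, pairing (f a) R.haar = f a x := by
      intro R a
      unfold pairing DyadicRect.haar
      have hu : volume.real (Set.univ : Set (Fin 0 → ℝ)) = 1 := by
        rw [measureReal_def, ← Set.pi_univ Set.univ, volume_pi_pi]
        simp
      rw [integral_unique, hu, Subsingleton.elim x default]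
      simp only [Finset.univ_eq_empty, Finset.prod_empty, map_one, mul_one, one_smul]
      exact congrArg (f a) (Subsingleton.elim _ _)
    unfold rectSum sqPairing
    simp [hx, hv, hp]
  | succ d ih =>
    have hmeas : Measurable fun x => rectSum (sqPairing f) x ^ q :=
      (measurable_rectSum _).pow_const q
    -- Chosen so that $|w_I(t)|^2=\mathbf 1_I(t)/|I|$, the weight of the first side.
    set w : DyadicInterval → ℝ → ℂ := fun I t =>
      ((I.toSet.indicator (fun _ => I.length ^ (-(1 / 2) : ℝ)) t : ℝ) : ℂ) with hw
    have hwsq : ∀ I t, ‖w I t‖ₑ ^ 2 = I.toSet.indicator (fun _ => (volume I.toSet)⁻¹) t := by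
      intro I t
      have hI := I.length_pos
      by_cases ht : t ∈ I.toSet
      · rw [hw]
        dsimp only
        rw [Set.indicator_of_mem ht, Set.indicator_of_mem ht, enorm_sq, Complex.norm_real,
          Real.norm_eq_abs, sq_abs, DyadicInterval.volume_toSet,
          ← ENNReal.ofReal_inv_of_pos hI, ← Real.rpow_natCast, ← Real.rpow_mul hI.le,
          ← Real.rpow_neg_one]
        norm_num
      · simp [hw, Set.indicator_of_notMem ht]
    have hsq : ∀ t y, ∑' r : ι × DyadicInterval, ‖w r.2 t * headCoef (f r.1) r.2 y‖ₑ ^ 2 =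
        DyadicInterval.sqSum (DyadicInterval.sqCoef fun a t => f a (Fin.cons t y)) t := by
      intro t y
      rw [tsum_prod_swap fun r : ι × DyadicInterval => ‖w r.2 t * headCoef (f r.1) r.2 y‖ₑ ^ 2]
      unfold DyadicInterval.sqSum
      refine tsum_congr fun I => ?_
      simp only [enorm_mul, mul_pow, hwsq, ENNReal.tsum_mul_left]
      by_cases ht : t ∈ I.toSet
      · rw [Set.indicator_of_mem ht, Set.indicator_of_mem ht, ENNReal.div_eq_inv_mul]
        rfl
      · rw [Set.indicator_of_notMem ht, Set.indicator_of_notMem ht, zero_mul]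
    have hfib : ∀ t, ∫⁻ y, rectSum (sqPairing f) (Fin.cons t y) ^ q ≤ C ^ d *
        ∫⁻ y, DyadicInterval.sqSum (DyadicInterval.sqCoef fun a t => f a (Fin.cons t y)) t ^ q := by
      intro t
      have h := ih (fun (r : ι × DyadicInterval) y => w r.2 t * headCoef (f r.1) r.2 y)
        (fun r => (measurable_headCoef (hf r.1) r.2).const_mul _)
        (fun r => (integrable_headCoef (hi r.1) r.2).const_mul _)
      simp only [hsq] at h
      refine le_trans (le_of_eq ?_) h
      refine lintegral_congr fun y => ?_
      rw [rectSum_cons]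
      congr 2
      funext R
      unfold sqPairing
      rw [tsum_prod_swap fun r : ι × DyadicInterval =>
        ‖pairing (fun y => w r.2 t * headCoef (f r.1) r.2 y) R.haar‖ₑ ^ 2]
      refine tsum_congr fun I => ?_
      simp only [enorm_pairing_const_mul, mul_pow, hwsq, ENNReal.tsum_mul_left]
      by_cases ht : t ∈ I.toSet
      · rw [Set.indicator_of_mem ht, Set.indicator_of_mem ht, ENNReal.div_eq_inv_mul]
        simp only [pairing_haar_cons (hi _)]
      · rw [Set.indicator_of_notMem ht, Set.indicator_of_notMem ht, zero_mul]
    have hjoint : Measurable (Function.uncurry fun (t : ℝ) (y : Fin d → ℝ) =>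
        DyadicInterval.sqSum (DyadicInterval.sqCoef fun a t => f a (Fin.cons t y)) t ^ q) := by
      refine Measurable.pow_const (Measurable.tsum fun I => ?_) q
      have : (fun z : ℝ × (Fin d → ℝ) => I.toSet.indicator (fun _ =>
          DyadicInterval.sqCoef (fun a t => f a (Fin.cons t z.2)) I / volume I.toSet) z.1) =
          (Prod.fst ⁻¹' I.toSet).indicator fun z : ℝ × (Fin d → ℝ) =>
            DyadicInterval.sqCoef (fun a t => f a (Fin.cons t z.2)) I / volume I.toSet := rfl
      rw [this]
      refine Measurable.indicator (Measurable.div_const (Measurable.tsum fun a => ?_) _)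
        (measurable_fst I.measurableSet_toSet)
      exact (((measurable_headCoef (hf a) I).comp measurable_snd).enorm).pow_const 2
    have hright : Measurable fun x => (∑' a, ‖f a x‖ₑ ^ 2) ^ q :=
      (Measurable.tsum fun a => (hf a).enorm.pow_const 2).pow_const q
    calc ∫⁻ x, rectSum (sqPairing f) x ^ q
        = ∫⁻ t, ∫⁻ y, rectSum (sqPairing f) (Fin.cons t y) ^ q := lintegral_cons hmeas
      _ ≤ ∫⁻ t, C ^ d * ∫⁻ y, DyadicInterval.sqSum
            (DyadicInterval.sqCoef fun a t => f a (Fin.cons t y)) t ^ q :=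
          lintegral_mono hfib
      _ = C ^ d * ∫⁻ y, ∫⁻ t, DyadicInterval.sqSum
            (DyadicInterval.sqCoef fun a t => f a (Fin.cons t y)) t ^ q := by
          have hm : Measurable fun t => ∫⁻ y, DyadicInterval.sqSum
              (DyadicInterval.sqCoef fun a t => f a (Fin.cons t y)) t ^ q :=
            hjoint.lintegral_prod_right'
          rw [lintegral_const_mul _ hm, lintegral_lintegral_swap hjoint.aemeasurable]
      _ ≤ C ^ d * ∫⁻ y, C * ∫⁻ t, (∑' a, ‖f a (Fin.cons t y)‖ₑ ^ 2) ^ q := by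
          refine mul_le_mul' le_rfl (lintegral_mono_ae ?_)
          have hae : ∀ᵐ y : Fin d → ℝ, ∀ a, Integrable fun t => f a (Fin.cons t y) :=
            ae_all_iff.2 fun a => (integrable_comp_cons (hi a)).prod_left_ae
          filter_upwards [hae] with y hy
          exact hC _ (fun a => (hf a).comp (measurable_cons.comp measurable_prodMk_right)) hy
      _ = _ := by
          have hm : Measurable fun y : Fin d → ℝ =>
              ∫⁻ t, (∑' a, ‖f a (Fin.cons t y)‖ₑ ^ 2) ^ q :=
            (hright.comp measurable_cons).lintegral_prod_left'
          rw [lintegral_const_mul _ hm, lintegral_cons_symm hright, pow_succ, mul_assoc]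

end MultiParam

namespace MultiParam

/-! ### `L^p` norms of sums -/

theorem lintegral_tsum_rpow_le_of_finset {α κ : Type*} [MeasurableSpace α] {μ : Measure α}
    [Countable κ] {a : κ → α → ℝ≥0∞} (ha : ∀ k, Measurable (a k)) {q : ℝ} (hq : 0 < q) {X : ℝ≥0∞}
    (h : ∀ s : Finset κ, ∫⁻ x, (∑ k ∈ s, a k x) ^ q ∂μ ≤ X) :
    ∫⁻ x, (∑' k, a k x) ^ q ∂μ ≤ X := by
  have h1 : ∀ x, (∑' k, a k x) ^ q = ⨆ s : Finset κ, (∑ k ∈ s, a k x) ^ q := by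
    intro x
    rw [ENNReal.tsum_eq_iSup_sum]
    exact (ENNReal.orderIsoRpow q hq).map_iSup _
  simp only [h1]
  rw [lintegral_iSup_directed (fun s =>
    ((Finset.measurable_sum s fun k _ => ha k).pow_const q).aemeasurable)]
  · exact iSup_le h
  · intro s t
    classical
    refine ⟨s ∪ t, fun x => ?_, fun x => ?_⟩
    · exact ENNReal.rpow_le_rpow (Finset.sum_le_sum_of_subset Finset.subset_union_left) hq.le
    · exact ENNReal.rpow_le_rpow (Finset.sum_le_sum_of_subset Finset.subset_union_right) hq.le

theorem lintegral_finset_sum_rpow_le {α κ : Type*} [MeasurableSpace α] {μ : Measure α}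
    {a : κ → α → ℝ≥0∞} (ha : ∀ k, Measurable (a k)) {p : ℝ} (hp : 1 ≤ p) (s : Finset κ) :
    (∫⁻ x, (∑ k ∈ s, a k x) ^ p ∂μ) ^ (1 / p) ≤ ∑ k ∈ s, (∫⁻ x, a k x ^ p ∂μ) ^ (1 / p) := by
  classical
  have hp0 : 0 < p := by linarith
  induction s using Finset.induction_on with
  | empty => simp [hp0]
  | insert k s hk ih =>
    simp only [Finset.sum_insert hk]
    exact (ENNReal.lintegral_Lp_add_le (ha k).aemeasurable
      (Finset.measurable_sum s fun k _ => ha k).aemeasurable hp).trans (add_le_add le_rfl ih)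

theorem rpow_le_of_le_rpow_inv {p : ℝ} (hp : 0 < p) {a b : ℝ≥0∞} (h : a ^ (1 / p) ≤ b) :
    a ≤ b ^ p := by
  have h1 := ENNReal.rpow_le_rpow h hp.le
  rwa [← ENNReal.rpow_mul, one_div_mul_cancel hp.ne', ENNReal.rpow_one] at h1

theorem lintegral_tsum_rpow_le {α κ : Type*} [MeasurableSpace α] {μ : Measure α} [Countable κ]
    {a : κ → α → ℝ≥0∞} (ha : ∀ k, Measurable (a k)) {p : ℝ} (hp : 1 ≤ p) :
    ∫⁻ x, (∑' k, a k x) ^ p ∂μ ≤ (∑' k, (∫⁻ x, a k x ^ p ∂μ) ^ (1 / p)) ^ p := by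
  have hp0 : 0 < p := by linarith
  refine lintegral_tsum_rpow_le_of_finset ha hp0 fun s => ?_
  exact rpow_le_of_le_rpow_inv hp0 ((lintegral_finset_sum_rpow_le ha hp s).trans
    (ENNReal.sum_le_tsum s))

variable {d : ℕ}

theorem seqSquare_rpow (c : DyadicRect d → ℝ≥0∞) (x : Fin d → ℝ) (p : ℝ) :
    seqSquare c x ^ p = rectSum (fun R => c R ^ 2) x ^ (p / 2) := by
  rw [show p / 2 = 1 / 2 * p by ring, ENNReal.rpow_mul]
  rfl

/-- Monotone convergence. With finitely many rectangles, $f$ is needed only on a set of finite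
measure, and the norm is finite a priori. -/
theorem lintegral_seqSquare_rpow_le_of_finset (c : DyadicRect d → ℝ≥0∞) {p : ℝ} (hp : 0 < p)
    {X : ℝ≥0∞} (h : ∀ F : Finset (DyadicRect d),
      ∫⁻ x, seqSquare ((F : Set (DyadicRect d)).indicator c) x ^ p ≤ X) :
    ∫⁻ x, seqSquare c x ^ p ≤ X := by
  classical
  simp only [seqSquare_rpow] at h ⊢
  refine lintegral_tsum_rpow_le_of_finset (fun R => measurable_const.indicator
    R.measurableSet_toSet) (by linarith) fun F => le_trans (le_of_eq ?_) (h F)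
  refine lintegral_congr fun x => ?_
  congr 1
  unfold rectSum
  rw [tsum_eq_sum (s := F)]
  · refine Finset.sum_congr rfl fun R hR => ?_
    beta_reduce
    rw [Set.indicator_of_mem (Finset.mem_coe.2 hR)]
  · intro R hR
    beta_reduce
    rw [Set.indicator_of_notMem (fun h => hR (Finset.mem_coe.1 h))]
    simp

/-! ### Haar square functions in `L^p` -/

theorem pairing_congr_ae {f g : (Fin d → ℝ) → ℂ} (h : f =ᵐ[volume] g) (φ : (Fin d → ℝ) → ℂ) :
    pairing f φ = pairing g φ :=
  integral_congr_ae (h.mono fun x hx => by simp only [hx])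

theorem exists_lintegral_haar_rpow_le (d : ℕ) {p : ℝ} (h1 : 1 < p) (h2 : p ≤ 2) :
    ∃ C : ℝ≥0∞, C ≠ ∞ ∧ ∀ f : (Fin d → ℝ) → ℂ, Integrable f →
      ∫⁻ x, seqSquare (fun R => ‖pairing f R.haar‖ₑ) x ^ p ≤ C * ∫⁻ x, ‖f x‖ₑ ^ p := by
  obtain ⟨C, hC, hCb⟩ := DyadicInterval.exists_lintegral_sqSum_rpow_le h1 h2
  refine ⟨C ^ d, ENNReal.pow_ne_top hC, fun f hf => ?_⟩
  set g := hf.1.mk f with hg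
  have hfg : f =ᵐ[volume] g := hf.1.ae_eq_mk
  have h := lintegral_rectSum_sqPairing_rpow_le (by linarith : 0 ≤ p / 2) hCb d
    (fun _ : Unit => g) (fun _ => hf.1.stronglyMeasurable_mk.measurable) (fun _ => hf.congr hfg)
  have e1 : ∀ x, (∑' _ : Unit, ‖g x‖ₑ ^ 2) ^ (p / 2) = ‖g x‖ₑ ^ p := by
    intro x
    rw [tsum_fintype, Finset.univ_unique, Finset.sum_singleton, ← ENNReal.rpow_natCast,
      ← ENNReal.rpow_mul]
    congr 1
    push_cast
    ring
  have e2 : sqPairing (fun _ : Unit => g) = fun R : DyadicRect d => ‖pairing f R.haar‖ₑ ^ 2 := by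
    funext R
    unfold sqPairing
    rw [tsum_fintype, Finset.univ_unique, Finset.sum_singleton, pairing_congr_ae hfg]
  simp only [seqSquare_rpow]
  rw [e2] at h
  simp only [e1] at h
  refine h.trans (le_of_eq ?_)
  congr 1
  exact lintegral_congr_ae (hfg.mono fun x hx => by simp only [hx])

/-! ### Localization of the pairings with atoms -/

/-- The union of the supports of the atoms of order `m` of the rectangles in `S`. -/
def atomSpread (m : Fin d → ℕ) (S : Set (DyadicRect d)) : Set (Fin d → ℝ) :=
  ⋃ R ∈ S, R.dil fun i => 2 ^ (m i + 1)

theorem measurableSet_atomSpread (m : Fin d → ℕ) (S : Set (DyadicRect d)) :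
    MeasurableSet (atomSpread m S) :=
  MeasurableSet.biUnion (Set.to_countable S) fun R _ => R.measurableSet_dil _

theorem volume_atomSpread_le (m : Fin d → ℕ) (S : Set (DyadicRect d)) :
    volume (atomSpread m S) ≤ (∏ i, 4 * (2 : ℝ≥0∞) ^ (m i : ℝ)) * volume (⋃ R ∈ S, R.toSet) := by
  refine (DyadicRect.volume_biUnion_dil_le (r := fun i => 2 ^ (m i + 1)) (fun i => ?_) S).trans
    (le_of_eq ?_)
  · exact le_trans (by norm_num) (one_le_pow₀ one_le_two)
  · congr 1
    refine Finset.prod_congr rfl fun i _ => ?_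
    rw [show (2 : ℝ) * 2 ^ (m i + 1) = 4 * 2 ^ m i by ring, ENNReal.ofReal_mul (by norm_num),
      DyadicInterval.ofReal_two_pow, ENNReal.ofReal_ofNat]

theorem volume_atomSpread_lt_top (m : Fin d → ℕ) {S : Set (DyadicRect d)}
    (hS : volume (⋃ R ∈ S, R.toSet) < ∞) : volume (atomSpread m S) < ∞ :=
  (volume_atomSpread_le m S).trans_lt (ENNReal.mul_lt_top (ENNReal.prod_lt_top fun _ _ =>
    ENNReal.mul_lt_top (by norm_num) (ENNReal.rpow_lt_top_of_nonneg (by positivity) (by norm_num))) hS)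

theorem volume_biUnion_finset_lt_top (F : Finset (DyadicRect d)) :
    volume (⋃ R ∈ (F : Set (DyadicRect d)), R.toSet) < ∞ :=
  measure_biUnion_lt_top F.finite_toSet fun R _ => R.volume_toSet_ne_top.lt_top

open DyadicInterval in
theorem pairing_indicator_tensor {B : ℝ≥0} {m : Fin d → ℕ} {R : DyadicRect d}
    {ψ : Fin d → ℝ → ℂ} (hψ : ∀ i, IsLocalAtom B (m i) (R i) (ψ i)) {U : Set (Fin d → ℝ)}
    (hU : (R.dil fun i => 2 ^ (m i + 1)) ⊆ U) (f : (Fin d → ℝ) → ℂ) :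
    pairing (U.indicator f) (tensor ψ) = pairing f (tensor ψ) := by
  unfold pairing
  refine integral_congr_ae (Filter.Eventually.of_forall fun x => ?_)
  by_cases hx : x ∈ U
  · simp only [Set.indicator_of_mem hx]
  · have h := enorm_tensor_le hψ x
    rw [Set.indicator_of_notMem fun h => hx (hU h), nonpos_iff_eq_zero, enorm_eq_zero] at h
    simp only [h, map_zero, mul_zero]

/-- The bound for the matrix of Haar coefficients of the atoms of order `m`. -/
noncomputable def orderConst (B : ℝ≥0) (m : Fin d → ℕ) : ℝ≥0∞ :=
  ∏ i, (DyadicInterval.nearConst B * (2 : ℝ≥0∞) ^ (-3 * m i : ℝ))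

open DyadicInterval in
-- The atoms of `S` do not see `f` off their supports, so `f` may be truncated there. The truncation
-- is integrable, as the Haar expansion requires, even if `f` is not.
theorem indicator_enorm_pairing_le {B : ℝ≥0} {m : Fin d → ℕ}
    {ψ : DyadicRect d → Fin d → ℝ → ℂ} (hψ : ∀ R i, IsLocalAtom B (m i) (R i) (ψ R i))
    (S : Set (DyadicRect d)) {f : (Fin d → ℝ) → ℂ} (hf : IntegrableOn f (atomSpread m S))
    (R : DyadicRect d) :
    S.indicator (fun R => ‖pairing f (tensor (ψ R))‖ₑ) R ≤
      kernelOp (fun R R' : DyadicRect d => ∏ i, nearKernel B (m i) (R i) (R' i))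
        (fun R' => ‖pairing ((atomSpread m S).indicator f) R'.haar‖ₑ) R := by
  by_cases hR : R ∈ S
  · rw [Set.indicator_of_mem hR, ← pairing_indicator_tensor (hψ R)
      (Set.subset_biUnion_of_mem (u := fun R : DyadicRect d => R.dil fun i => 2 ^ (m i + 1)) hR) f]
    exact enorm_pairing_tensor_le (hψ R)
      ((integrable_indicator_iff (measurableSet_atomSpread m S)).2 hf)
  · rw [Set.indicator_of_notMem hR]
    exact zero_le

theorem lintegral_indicator_enorm_rpow {U : Set (Fin d → ℝ)} (hU : MeasurableSet U)
    (f : (Fin d → ℝ) → ℂ) {p : ℝ} (hp : 0 < p) :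
    ∫⁻ x, ‖U.indicator f x‖ₑ ^ p = ∫⁻ x in U, ‖f x‖ₑ ^ p := by
  rw [← lintegral_indicator hU]
  refine lintegral_congr fun x => ?_
  by_cases hx : x ∈ U
  · simp only [Set.indicator_of_mem hx]
  · simp [Set.indicator_of_notMem hx, hp]

open DyadicInterval in
-- The $\ell^2$ bound for the matrix, followed by the Haar square function bound in $L^2$ for the
-- truncated function.
theorem exists_localized_l2_le (d : ℕ) : ∃ C : ℝ≥0∞, C ≠ ∞ ∧ ∀ (B : ℝ≥0) (m : Fin d → ℕ)
    (ψ : DyadicRect d → Fin d → ℝ → ℂ), (∀ R i, IsLocalAtom B (m i) (R i) (ψ R i)) →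
    ∀ (S : Set (DyadicRect d)) (f : (Fin d → ℝ) → ℂ), IntegrableOn f (atomSpread m S) →
      ∑' R, S.indicator (fun R => ‖pairing f (tensor (ψ R))‖ₑ ^ 2) R ≤
        orderConst B m ^ 2 * (C * ∫⁻ x in atomSpread m S, ‖f x‖ₑ ^ 2) := by
  obtain ⟨C, hC, hCb⟩ := exists_lintegral_haar_rpow_le d one_lt_two le_rfl
  refine ⟨C, hC, fun B m ψ hψ S f hf => ?_⟩
  have hU := measurableSet_atomSpread m S
  have h1 := hCb _ ((integrable_indicator_iff hU).2 hf)
  rw [lintegral_indicator_enorm_rpow hU f two_pos] at h1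
  simp only [ENNReal.rpow_ofNat, lintegral_seqSquare_sq] at h1
  have h2 := (isAtomicallyBounded_nearKernel B m).l2norm_le
    fun R' => ‖pairing ((atomSpread m S).indicator f) R'.haar‖ₑ
  have h3 := pow_le_pow_left' ((l2norm_mono (indicator_enorm_pairing_le hψ S hf)).trans h2) 2
  rw [mul_pow, l2norm_sq, l2norm_sq] at h3
  refine le_trans (le_of_eq ?_) (h3.trans (mul_le_mul' le_rfl h1))
  refine tsum_congr fun R => ?_
  by_cases hR : R ∈ S
  · simp only [Set.indicator_of_mem hR]
  · simp [Set.indicator_of_notMem hR]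

end MultiParam

namespace MultiParam

variable {d : ℕ}

/-! ### Decay in the order of the atoms -/

/-- The factor `∏ 2^{-m_i}`. -/
noncomputable def decay (m : Fin d → ℕ) : ℝ≥0∞ := ∏ i, (2 : ℝ≥0∞) ^ (-(m i : ℝ))

theorem decay_le_one (m : Fin d → ℕ) : decay m ≤ 1 :=
  Finset.prod_le_one' fun i _ => by
    rw [← ENNReal.rpow_zero (x := 2)]
    exact ENNReal.rpow_le_rpow_of_exponent_le (by norm_num) (by simp)

theorem decay_ne_zero (m : Fin d → ℕ) : decay m ≠ 0 :=
  Finset.prod_ne_zero_iff.2 fun i _ => (ENNReal.rpow_pos (by norm_num) (by norm_num)).ne'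

theorem decay_ne_top (m : Fin d → ℕ) : decay m ≠ ∞ := ((decay_le_one m).trans_lt (by simp)).ne

theorem tsum_decay (d : ℕ) : ∑' m : Fin d → ℕ, decay m = geomConst 1 ^ d := by
  unfold decay
  rw [tsum_pi_prod fun (_ : Fin d) (m : ℕ) => (2 : ℝ≥0∞) ^ (-(m : ℝ)), Finset.prod_const,
    Finset.card_univ, Fintype.card_fin]
  congr 1
  unfold geomConst
  refine tsum_congr fun n => ?_
  rw [← ENNReal.rpow_natCast, ← ENNReal.rpow_mul]
  congr 1
  ring

theorem decay_inv (m : Fin d → ℕ) : (decay m)⁻¹ = ∏ i, (2 : ℝ≥0∞) ^ (m i : ℝ) := by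
  unfold decay
  rw [ENNReal.prod_inv_distrib]
  · exact Finset.prod_congr rfl fun i _ => by rw [ENNReal.rpow_neg, inv_inv]
  · intro i _ j _ _
    exact Or.inl (ENNReal.rpow_pos (by norm_num) (by norm_num)).ne'

/-- The part of `orderConst` that does not depend on the order. -/
noncomputable def baseConst (d : ℕ) (B : ℝ≥0) : ℝ≥0∞ := DyadicInterval.nearConst B ^ d

theorem baseConst_ne_top (d : ℕ) (B : ℝ≥0) : baseConst d B ≠ ∞ :=
  ENNReal.pow_ne_top (DyadicInterval.nearConst_lt_top B).ne

theorem orderConst_eq (B : ℝ≥0) (m : Fin d → ℕ) :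
    orderConst B m = baseConst d B * decay m ^ 3 := by
  unfold orderConst baseConst decay
  rw [Finset.prod_mul_distrib, Finset.prod_const, Finset.card_univ, Fintype.card_fin,
    ← Finset.prod_pow]
  congr 1
  refine Finset.prod_congr rfl fun i _ => ?_
  rw [← ENNReal.rpow_natCast, ← ENNReal.rpow_mul]
  congr 1
  push_cast
  ring

theorem decay_pow_le_rpow (m : Fin d → ℕ) {p : ℝ} {n : ℕ} (h : p ≤ n) :
    decay m ^ n ≤ decay m ^ p := by
  rw [← ENNReal.rpow_natCast]
  exact ENNReal.rpow_le_rpow_of_exponent_ge (decay_le_one m) h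

/-! ### The atoms of a fixed order in `L^p` -/

/-- Every term of the constant contains `Q` to the first or second power, and `t ≤ 1`. -/
theorem lpConst_mul_le (d : ℕ) (Q : ℝ≥0∞) {t : ℝ≥0∞} (ht : t ≤ 1) (p : ℝ) :
    lpConst d (Q * t) p ≤ t * lpConst d Q p := by
  unfold lpConst hardyConst
  calc _ ≤ (2 : ℝ≥0∞) ^ (2 * p) * ((t * (Q ^ 2 * (8 * coverConst d) * geomConst (2 - p)) +
        t * (Q * (3 * coverConst d) * geomConst (p - 1))) * geomConst p) := by
        refine mul_le_mul' le_rfl (mul_le_mul' (add_le_add ?_ (le_of_eq (by ring))) le_rfl)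
        calc (Q * t) ^ 2 * (8 * coverConst d) * geomConst (2 - p)
            = t * (t * (Q ^ 2 * (8 * coverConst d) * geomConst (2 - p))) := by ring
          _ ≤ t * (1 * (Q ^ 2 * (8 * coverConst d) * geomConst (2 - p))) := by gcongr
          _ = _ := by rw [one_mul]
    _ = _ := by ring

open DyadicInterval in
-- Interpolation for the matrix of order `m` followed by the Haar bound. The third power of `decay
-- m` in `orderConst` dominates the required `decay m ^ p`, since `p < 2`.
theorem exists_lintegral_atoms_rpow_le_of_lt_two (d : ℕ) (B : ℝ≥0) {p : ℝ} (h1 : 1 < p)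
    (h2 : p < 2) : ∃ C : ℝ≥0∞, C ≠ ∞ ∧ ∀ (m : Fin d → ℕ)
      (ψ : DyadicRect d → Fin d → ℝ → ℂ), (∀ R i, IsLocalAtom B (m i) (R i) (ψ R i)) →
      ∀ (F : Finset (DyadicRect d)) (f : (Fin d → ℝ) → ℂ), IntegrableOn f (atomSpread m F) →
        ∫⁻ x, ‖f x‖ₑ ^ p ≠ ∞ →
        ∫⁻ x, seqSquare ((F : Set (DyadicRect d)).indicator
          fun R => ‖pairing f (tensor (ψ R))‖ₑ) x ^ p ≤
        C * decay m ^ p * ∫⁻ x, ‖f x‖ₑ ^ p := by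
  obtain ⟨C, hC, hCb⟩ := exists_lintegral_haar_rpow_le d h1 h2.le
  refine ⟨lpConst d (baseConst d B) p * C, ENNReal.mul_ne_top
    (lpConst_lt_top d (baseConst_ne_top d B).lt_top h1 h2).ne hC, fun m ψ hψ F f hf hfp => ?_⟩
  have hp0 : 0 < p := by linarith
  have hU := measurableSet_atomSpread m (F : Set (DyadicRect d))
  have h3 := hCb _ ((integrable_indicator_iff hU).2 hf)
  rw [lintegral_indicator_enorm_rpow hU f hp0] at h3
  have h4 := h3.trans (mul_le_mul' le_rfl (setLIntegral_le_lintegral _ _))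
  have h5 := lintegral_seqSquare_kernelOp_rpow_le (isAtomicallyBounded_nearKernel B m) h1 h2 _
    (h4.trans_lt (ENNReal.mul_lt_top hC.lt_top hfp.lt_top)).ne
  calc _ ≤ _ := lintegral_mono fun x => ENNReal.rpow_le_rpow
        (seqSquare_mono (indicator_enorm_pairing_le hψ _ hf) x) hp0.le
    _ ≤ lpConst d (orderConst B m) p * (C * ∫⁻ x, ‖f x‖ₑ ^ p) :=
        h5.trans (mul_le_mul' le_rfl h4)
    _ ≤ (decay m ^ p * lpConst d (baseConst d B) p) * (C * ∫⁻ x, ‖f x‖ₑ ^ p) := by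
        refine mul_le_mul' ?_ le_rfl
        rw [orderConst_eq]
        exact (lpConst_mul_le d _ (pow_le_one' (decay_le_one m) 3) p).trans
          (mul_le_mul' (decay_pow_le_rpow m (by norm_num; linarith)) le_rfl)
    _ = _ := by ring

open DyadicInterval in
theorem exists_lintegral_atoms_sq_le (d : ℕ) (B : ℝ≥0) : ∃ C : ℝ≥0∞, C ≠ ∞ ∧ ∀ (m : Fin d → ℕ)
      (ψ : DyadicRect d → Fin d → ℝ → ℂ), (∀ R i, IsLocalAtom B (m i) (R i) (ψ R i)) →
      ∀ (S : Set (DyadicRect d)) (f : (Fin d → ℝ) → ℂ), IntegrableOn f (atomSpread m S) →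
        ∑' R, S.indicator (fun R => ‖pairing f (tensor (ψ R))‖ₑ ^ 2) R ≤
          C * decay m ^ 6 * ∫⁻ x in atomSpread m S, ‖f x‖ₑ ^ 2 := by
  obtain ⟨C, hC, hCb⟩ := exists_localized_l2_le d
  refine ⟨baseConst d B ^ 2 * C, ENNReal.mul_ne_top (ENNReal.pow_ne_top (baseConst_ne_top d B)) hC,
    fun m ψ hψ S f hf => (hCb B m ψ hψ S f hf).trans (le_of_eq ?_)⟩
  rw [orderConst_eq]
  ring

theorem indicator_sq {α : Type*} (S : Set α) (a : α → ℝ≥0∞) (x : α) :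
    S.indicator a x ^ 2 = S.indicator (fun x => a x ^ 2) x := by
  by_cases hx : x ∈ S
  · simp only [Set.indicator_of_mem hx]
  · simp [Set.indicator_of_notMem hx]

theorem lintegral_seqSquare_finset_rpow_lt_top (F : Finset (DyadicRect d))
    {a : DyadicRect d → ℝ≥0∞} (ha : ∀ R, a R ≠ ∞) {p : ℝ} (hp : 0 < p) :
    ∫⁻ x, seqSquare ((F : Set (DyadicRect d)).indicator a) x ^ p < ∞ := by
  classical
  set K := ∑ R ∈ F, a R ^ 2 / volume R.toSet with hK
  have hKt : K ≠ ∞ := ENNReal.sum_ne_top.2 fun R _ =>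
    ENNReal.div_ne_top (ENNReal.pow_ne_top (ha R)) R.volume_toSet_ne_zero
  set U := ⋃ R ∈ (F : Set (DyadicRect d)), R.toSet with hU
  have hUm : MeasurableSet U :=
    MeasurableSet.biUnion (Set.to_countable _) fun R _ => R.measurableSet_toSet
  have hpt : ∀ x, seqSquare ((F : Set (DyadicRect d)).indicator a) x ^ p ≤
      U.indicator (fun _ => K ^ (p / 2)) x := by
    intro x
    rw [seqSquare_rpow]
    unfold rectSum
    rw [tsum_eq_sum (s := F)]
    · by_cases hx : x ∈ U
      · rw [Set.indicator_of_mem hx]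
        refine ENNReal.rpow_le_rpow (Finset.sum_le_sum fun R hR => ?_) (by linarith)
        beta_reduce
        rw [Set.indicator_of_mem (Finset.mem_coe.2 hR)]
        exact Set.indicator_le_self _ _ _
      · rw [Set.indicator_of_notMem hx, Finset.sum_eq_zero, ENNReal.zero_rpow_of_pos (by linarith)]
        intro R hR
        exact Set.indicator_of_notMem (fun h => hx (Set.mem_biUnion (Finset.mem_coe.2 hR) h)) _
    · intro R hR
      beta_reduce
      rw [Set.indicator_of_notMem (fun h => hR (Finset.mem_coe.1 h))]
      simp
  refine (lintegral_mono hpt).trans_lt ?_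
  rw [lintegral_indicator_const hUm]
  exact ENNReal.mul_lt_top (ENNReal.rpow_lt_top_of_nonneg (by linarith) hKt)
    (volume_biUnion_finset_lt_top F)

/-- A layer-cake form of a localized `ℓ²` estimate. -/
theorem tsum_mul_le_lintegral_of_localized {κ α : Type*} [MeasurableSpace α] {μ : Measure α}
    {a b : κ → ℝ≥0∞} {D : ℝ≥0∞} {h v : α → ℝ≥0∞} (hh : AEMeasurable h μ) (hv : Measurable v)
    (hloc : ∀ t : ℝ≥0∞, ∑' k, {k | t < b k}.indicator a k ≤ D * ∫⁻ x in {x | t < v x}, h x ∂μ) :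
    ∑' k, a k * b k ≤ 2 * D * geomConst 1 * ∫⁻ x, h x * v x ∂μ := by
  have hm : ∀ j : ℤ, MeasurableSet {x | (2 : ℝ≥0∞) ^ j < v x} := fun j =>
    measurableSet_lt measurable_const hv
  calc ∑' k, a k * b k
      ≤ ∑' k, ∑' j : ℤ, 2 * (2 ^ j * {k | (2 : ℝ≥0∞) ^ j < b k}.indicator a k) := by
        refine ENNReal.tsum_le_tsum fun k => ?_
        have h1 := le_tsum_layer one_pos (b k)
        simp only [ENNReal.rpow_one] at h1
        refine (mul_le_mul' le_rfl h1).trans (le_of_eq ?_)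
        rw [← mul_assoc, ← ENNReal.tsum_mul_left]
        refine tsum_congr fun j => ?_
        by_cases hj : (2 : ℝ≥0∞) ^ j < b k
        · rw [if_pos hj, Set.indicator_of_mem (show k ∈ {k | (2 : ℝ≥0∞) ^ j < b k} from hj)]
          ring
        · rw [if_neg hj, Set.indicator_of_notMem (show k ∉ {k | (2 : ℝ≥0∞) ^ j < b k} from hj)]
          ring
    _ = 2 * ∑' j : ℤ, 2 ^ j * ∑' k, {k | (2 : ℝ≥0∞) ^ j < b k}.indicator a k := by
        rw [ENNReal.tsum_comm]
        simp only [ENNReal.tsum_mul_left]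
    _ ≤ 2 * ∑' j : ℤ, 2 ^ j * (D * ∫⁻ x in {x | (2 : ℝ≥0∞) ^ j < v x}, h x ∂μ) :=
        mul_le_mul' le_rfl (ENNReal.tsum_le_tsum fun j => mul_le_mul' le_rfl (hloc _))
    _ = 2 * D * ∫⁻ x, h x * ∑' j : ℤ, (if (2 : ℝ≥0∞) ^ j < v x then (2 : ℝ≥0∞) ^ j else 0) ∂μ := by
        simp only [← ENNReal.tsum_mul_left]
        have hite : ∀ j : ℤ, Measurable fun x => if (2 : ℝ≥0∞) ^ j < v x then (2 : ℝ≥0∞) ^ j else 0 :=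
          fun j => Measurable.ite (hm j) measurable_const measurable_const
        have hite' : ∀ j : ℤ, AEMeasurable
            (fun x => h x * if (2 : ℝ≥0∞) ^ j < v x then (2 : ℝ≥0∞) ^ j else 0) μ :=
          fun j => hh.mul (hite j).aemeasurable
        rw [lintegral_tsum hite', ← ENNReal.tsum_mul_left]
        refine tsum_congr fun j => ?_
        have h2 : ∫⁻ x, h x * (if (2 : ℝ≥0∞) ^ j < v x then (2 : ℝ≥0∞) ^ j else 0) ∂μ =
            2 ^ j * ∫⁻ x in {x | (2 : ℝ≥0∞) ^ j < v x}, h x ∂μ := by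
          rw [← lintegral_const_mul' _ _ (two_zpow_ne_top j), ← lintegral_indicator (hm j)]
          refine lintegral_congr fun x => ?_
          by_cases hx : (2 : ℝ≥0∞) ^ j < v x
          · rw [if_pos hx, Set.indicator_of_mem (show x ∈ {x | (2 : ℝ≥0∞) ^ j < v x} from hx),
              mul_comm]
          · rw [if_neg hx, Set.indicator_of_notMem (show x ∉ {x | (2 : ℝ≥0∞) ^ j < v x} from hx),
              mul_zero]
        rw [h2]
        ring
    _ ≤ 2 * D * ∫⁻ x, geomConst 1 * (h x * v x) ∂μ := by
        refine mul_le_mul' le_rfl (lintegral_mono fun x => ?_)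
        have h1 := tsum_layer_le one_pos (v x)
        simp only [ENNReal.rpow_one] at h1
        refine (mul_le_mul' le_rfl h1).trans (le_of_eq ?_)
        ring
    _ = _ := by
        rw [lintegral_const_mul' _ _ (geomConst_lt_top one_pos).ne]
        ring

/-- Absorption: division by a power of `X`, legitimate because `X` is finite. -/
theorem le_rpow_of_le_mul_rpow {p : ℝ} (hp : 2 < p) {X A N : ℝ≥0∞} (hX : X ≠ ∞)
    (h : X ≤ A * N ^ (2 / p) * X ^ (1 - 2 / p)) : X ≤ A ^ (p / 2) * N := by
  have hp0 : 0 < p := by linarith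
  rcases eq_or_ne X 0 with rfl | h0
  · exact zero_le
  have hy0 : X ^ (1 - 2 / p) ≠ 0 := (ENNReal.rpow_pos (pos_iff_ne_zero.2 h0) hX).ne'
  have hyt : X ^ (1 - 2 / p) ≠ ∞ := ENNReal.rpow_ne_top_of_ne_zero h0 hX
  have hXs : X = X ^ (2 / p) * X ^ (1 - 2 / p) := by
    rw [← ENNReal.rpow_add _ _ h0 hX]
    simp
  have h1 : X ^ (2 / p) ≤ A * N ^ (2 / p) := by
    rw [← ENNReal.mul_le_mul_iff_left hy0 hyt, ← hXs]
    exact h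
  have h2 := ENNReal.rpow_le_rpow h1 (by linarith : 0 ≤ p / 2)
  rw [ENNReal.mul_rpow_of_nonneg _ _ (by linarith), ← ENNReal.rpow_mul, ← ENNReal.rpow_mul,
    show 2 / p * (p / 2) = 1 by field_simp, ENNReal.rpow_one, ENNReal.rpow_one] at h2
  exact h2

open DyadicInterval in
-- With $G$ the square function, $X=\int G^p=\sum a_R^2b_R$ with $b_R$ the average of $G^{p-2}$ over
-- $R$. The localized $\ell^2$ bound gives $X\lesssim\int|f|^2v$ with $v$ a maximal function of
-- $G^{p-2}$ over dilated rectangles. Hölder's inequality and the maximal theorem bound this by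
-- $\|f\|_p^2X^{1-2/p}$, and $X$ is absorbed.
theorem exists_lintegral_atoms_rpow_le_of_two_lt (d : ℕ) (B : ℝ≥0) {p : ℝ} (hp : 2 < p) :
    ∃ C : ℝ≥0∞, C ≠ ∞ ∧ ∀ (m : Fin d → ℕ)
      (ψ : DyadicRect d → Fin d → ℝ → ℂ), (∀ R i, IsLocalAtom B (m i) (R i) (ψ R i)) →
      ∀ (F : Finset (DyadicRect d)) (f : (Fin d → ℝ) → ℂ), IntegrableOn f (atomSpread m F) →
        AEStronglyMeasurable f →
        ∫⁻ x, seqSquare ((F : Set (DyadicRect d)).indicator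
          fun R => ‖pairing f (tensor (ψ R))‖ₑ) x ^ p ≤
        C * decay m ^ p * ∫⁻ x, ‖f x‖ₑ ^ p := by
  have hp0 : 0 < p := by linarith
  obtain ⟨D, hD, hDb⟩ := exists_lintegral_atoms_sq_le d B
  -- The conjugate exponent of $p/2$, for which $(G^{p-2})^q=G^p$.
  set q := p / (p - 2) with hq
  have hq1 : 1 < q := by rw [hq, lt_div_iff₀ (by linarith)]; linarith
  have hqinv : 1 / q = 1 - 2 / p := by
    rw [hq, one_div_div, sub_div, div_self hp0.ne']
  have hconj : (p / 2).HolderConjugate q := by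
    rw [Real.holderConjugate_iff]
    refine ⟨by linarith, ?_⟩
    rw [← one_div q, hqinv, inv_div]
    ring
  set K := ∏ _i : Fin d, (4 * maxConst q) with hK
  have hKt : K ≠ ∞ := (ENNReal.prod_lt_top fun _ _ =>
    ENNReal.mul_lt_top (by norm_num) (maxConst_lt_top hq1)).ne
  set E := 2 * D * geomConst 1 * K ^ (1 - 2 / p) with hE
  have hexp : 0 ≤ 1 - 2 / p := by rw [← hqinv]; positivity
  have hexp1 : 1 - 2 / p ≤ 1 := by
    have : 0 ≤ 2 / p := by positivity
    linarith
  refine ⟨E ^ (p / 2), ENNReal.rpow_ne_top_of_nonneg (by linarith) (ENNReal.mul_ne_top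
    (ENNReal.mul_ne_top (ENNReal.mul_ne_top (by norm_num) hD) (geomConst_lt_top one_pos).ne)
    (ENNReal.rpow_ne_top_of_nonneg hexp hKt)), fun m ψ hψ F f hf hfm => ?_⟩
  set a : DyadicRect d → ℝ≥0∞ := fun R => ‖pairing f (tensor (ψ R))‖ₑ with ha
  set G := seqSquare ((F : Set (DyadicRect d)).indicator a) with hG
  have hGm : Measurable G := measurable_seqSquare _
  set X := ∫⁻ x, G x ^ p with hX
  have hXt : X ≠ ∞ := (lintegral_seqSquare_finset_rpow_lt_top F (fun R => enorm_ne_top) hp0).ne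
  set g : (Fin d → ℝ) → ℝ≥0∞ := fun x => G x ^ (p - 2) with hg
  have hgm : Measurable g := hGm.pow_const _
  have hgq : ∀ x, g x ^ q = G x ^ p := by
    intro x
    rw [hg]
    beta_reduce
    rw [← ENNReal.rpow_mul, hq, mul_div_cancel₀ _ (by linarith : p - 2 ≠ 0)]
  obtain ⟨v, hv, hvq, hvR⟩ := DyadicRect.exists_maximal (r := fun i : Fin d => 2 ^ (m i + 1))
    (fun i => le_trans (by norm_num) (one_le_pow₀ one_le_two)) hq1 hgm
  simp only [hgq] at hvq
  -- The maximal function over the supports of the atoms costs $\prod 2^{m_i}$, the inverse of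
  -- `decay m`.
  have hKm : (∏ i : Fin d, ENNReal.ofReal (2 * 2 ^ (m i + 1)) * maxConst q) =
      K * (decay m)⁻¹ := by
    rw [decay_inv, hK, ← Finset.prod_mul_distrib]
    refine Finset.prod_congr rfl fun i _ => ?_
    rw [show (2 : ℝ) * 2 ^ (m i + 1) = 4 * 2 ^ m i by ring, ENNReal.ofReal_mul (by norm_num),
      ofReal_two_pow, ENNReal.ofReal_ofNat]
    ring
  rw [hKm] at hvq
  set b : DyadicRect d → ℝ≥0∞ := fun R => (volume R.toSet)⁻¹ * ∫⁻ x in R.toSet, g x with hb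
  have hXsum : X = ∑' R, (F : Set (DyadicRect d)).indicator (fun R => a R ^ 2) R * b R := by
    have h1 := lintegral_seqSquare_sq_indicator ((F : Set (DyadicRect d)).indicator a) hgm
    simp only [indicator_sq] at h1
    rw [← h1, hX]
    refine lintegral_congr fun x => ?_
    rw [← ENNReal.rpow_natCast, ← ENNReal.rpow_add_of_nonneg _ _ (by norm_num) (by linarith)]
    congr 1
    push_cast
    ring
  -- If the average over `R` exceeds `t`, so does `v` on the whole support of the atom of `R`.
  have hloc : ∀ t : ℝ≥0∞, ∑' R, {R | t < b R}.indicator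
      ((F : Set (DyadicRect d)).indicator fun R => a R ^ 2) R ≤
      D * decay m ^ 6 * ∫⁻ x in {x | t < v x}, ‖f x‖ₑ ^ 2 := by
    intro t
    have hsub : atomSpread m ({R | t < b R} ∩ F) ⊆ atomSpread m F :=
      Set.biUnion_mono Set.inter_subset_right fun _ _ => le_rfl
    simp only [Set.indicator_indicator]
    refine (hDb m ψ hψ ({R | t < b R} ∩ F) f (hf.mono_set hsub)).trans
      (mul_le_mul' le_rfl (lintegral_mono_set ?_))
    intro x hx
    obtain ⟨R, hR, hxR⟩ := Set.mem_iUnion₂.1 hx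
    have h1 : t < b R := hR.1
    exact h1.trans_le (hvR R x hxR)
  have h1 := tsum_mul_le_lintegral_of_localized (hfm.enorm.pow_const 2) hv hloc
  rw [← hXsum] at h1
  have h2 : ∫⁻ x, ‖f x‖ₑ ^ 2 * v x ≤
      (∫⁻ x, ‖f x‖ₑ ^ p) ^ (2 / p) * (K * (decay m)⁻¹ * X) ^ (1 - 2 / p) := by
    refine (ENNReal.lintegral_mul_le_Lp_mul_Lq volume hconj (hfm.enorm.pow_const 2)
      hv.aemeasurable).trans ?_
    rw [hqinv, one_div_div]
    refine mul_le_mul' (le_of_eq ?_) (ENNReal.rpow_le_rpow hvq hexp)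
    congr 1
    refine lintegral_congr fun x => ?_
    rw [← ENNReal.rpow_natCast, ← ENNReal.rpow_mul]
    congr 1
    push_cast
    ring
  -- The sixth power from the localized bound outweighs the loss in the maximal function; `decay m ^
  -- 2` becomes `decay m ^ p` after the power `p / 2` in the absorption.
  have hdec : decay m ^ 6 * ((decay m)⁻¹) ^ (1 - 2 / p) ≤ decay m ^ 2 := by
    calc decay m ^ 6 * ((decay m)⁻¹) ^ (1 - 2 / p) ≤ decay m ^ 6 * (decay m)⁻¹ := by
          refine mul_le_mul' le_rfl ?_
          conv_rhs => rw [← ENNReal.rpow_one (decay m)⁻¹]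
          exact ENNReal.rpow_le_rpow_of_exponent_le (ENNReal.one_le_inv.2 (decay_le_one m)) hexp1
      _ = decay m ^ 5 := by
          rw [pow_succ, mul_assoc, ENNReal.mul_inv_cancel (decay_ne_zero m) (decay_ne_top m), mul_one]
      _ ≤ decay m ^ 2 := pow_le_pow_right_of_le_one' (decay_le_one m) (by norm_num)
  have h3 : X ≤ (E * decay m ^ 2) * (∫⁻ x, ‖f x‖ₑ ^ p) ^ (2 / p) * X ^ (1 - 2 / p) := by
    calc X ≤ _ := h1.trans (mul_le_mul' le_rfl h2)
      _ = (2 * D * geomConst 1 * K ^ (1 - 2 / p)) *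
          (decay m ^ 6 * ((decay m)⁻¹) ^ (1 - 2 / p)) * (∫⁻ x, ‖f x‖ₑ ^ p) ^ (2 / p) *
            X ^ (1 - 2 / p) := by
          rw [ENNReal.mul_rpow_of_nonneg _ _ hexp, ENNReal.mul_rpow_of_nonneg _ _ hexp]
          ring
      _ ≤ _ := mul_le_mul' (mul_le_mul' (mul_le_mul' le_rfl hdec) le_rfl) le_rfl
  refine (le_rpow_of_le_mul_rpow hp hXt h3).trans (le_of_eq ?_)
  rw [ENNReal.mul_rpow_of_nonneg _ _ (by linarith), ← ENNReal.rpow_natCast, ← ENNReal.rpow_mul]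
  congr 3
  push_cast
  ring

open DyadicInterval in
theorem exists_lintegral_atoms_rpow_le (d : ℕ) (B : ℝ≥0) {p : ℝ} (hp : 1 < p) :
    ∃ C : ℝ≥0∞, C ≠ ∞ ∧ ∀ (m : Fin d → ℕ)
      (ψ : DyadicRect d → Fin d → ℝ → ℂ), (∀ R i, IsLocalAtom B (m i) (R i) (ψ R i)) →
      ∀ (f : (Fin d → ℝ) → ℂ), MemLp f (ENNReal.ofReal p) →
        ∫⁻ x, seqSquare (fun R => ‖pairing f (tensor (ψ R))‖ₑ) x ^ p ≤
        C * decay m ^ p * ∫⁻ x, ‖f x‖ₑ ^ p := by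
  have hp0 : 0 < p := by linarith
  have hp1 : 1 ≤ ENNReal.ofReal p := by
    rw [← ENNReal.ofReal_one]
    exact ENNReal.ofReal_le_ofReal hp.le
  have hint : ∀ (f : (Fin d → ℝ) → ℂ), MemLp f (ENNReal.ofReal p) → ∀ (m : Fin d → ℕ)
      (F : Finset (DyadicRect d)), IntegrableOn f (atomSpread m F) := by
    intro f hf m F
    have : Fact (volume (atomSpread m (F : Set (DyadicRect d))) < ∞) :=
      ⟨volume_atomSpread_lt_top m (volume_biUnion_finset_lt_top F)⟩
    exact (hf.restrict _).integrable hp1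
  have hfin : ∀ (f : (Fin d → ℝ) → ℂ), MemLp f (ENNReal.ofReal p) → ∫⁻ x, ‖f x‖ₑ ^ p ≠ ∞ := by
    intro f hf
    have h := lintegral_rpow_enorm_lt_top_of_eLpNorm_lt_top (by simpa using hp0)
      ENNReal.ofReal_ne_top hf.2
    rw [ENNReal.toReal_ofReal hp0.le] at h
    exact h.ne
  rcases lt_trichotomy p 2 with h2 | rfl | h2
  · obtain ⟨C, hC, hCb⟩ := exists_lintegral_atoms_rpow_le_of_lt_two d B hp h2
    exact ⟨C, hC, fun m ψ hψ f hf => lintegral_seqSquare_rpow_le_of_finset _ hp0 fun F =>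
      hCb m ψ hψ F f (hint f hf m F) (hfin f hf)⟩
  · obtain ⟨C, hC, hCb⟩ := exists_lintegral_atoms_sq_le d B
    refine ⟨C, hC, fun m ψ hψ f hf => lintegral_seqSquare_rpow_le_of_finset _ hp0 fun F => ?_⟩
    simp only [ENNReal.rpow_ofNat, lintegral_seqSquare_sq, indicator_sq]
    refine (hCb m ψ hψ F f (hint f hf m F)).trans
      (mul_le_mul' (mul_le_mul' le_rfl ?_) (setLIntegral_le_lintegral _ _))
    exact pow_le_pow_right_of_le_one' (decay_le_one m) (by norm_num)
  · obtain ⟨C, hC, hCb⟩ := exists_lintegral_atoms_rpow_le_of_two_lt d B h2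
    exact ⟨C, hC, fun m ψ hψ f hf => lintegral_seqSquare_rpow_le_of_finset _ hp0 fun F =>
      hCb m ψ hψ F f (hint f hf m F) hf.1⟩

end MultiParam

namespace MultiParam

variable {d : ℕ}

/-! ### Square functions over adapted families -/

/-- A family of functions indexed by the dyadic rectangles, each a sum of products of local
atoms. -/
structure HasAtoms (B : ℝ≥0) (φ : DyadicRect d → (Fin d → ℝ) → ℂ)
    (ψ : DyadicRect d → Fin d → ℕ → ℝ → ℂ) : Prop where
  atom : ∀ R i m, DyadicInterval.IsLocalAtom B m (R i) (ψ R i m)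
  hasSum : ∀ R x, HasSum (fun m : Fin d → ℕ => tensor (fun i => ψ R i (m i)) x) (φ R x)

theorem exists_hasAtoms {K : ℝ} {φ : DyadicRect d → (Fin d → ℝ) → ℂ}
    (h : ∀ R, IsAdaptedRect K 21 R (φ R)) (hz : ∀ R j, HasZero j (φ R)) :
    ∃ ψ, HasAtoms (2 ^ 23 * ‖K‖₊) φ ψ := by
  choose ψ hψ hs using fun R => (h R).exists_atoms (hz R)
  exact ⟨ψ, hψ, hs⟩

section Atoms

variable {B : ℝ≥0} {φ : DyadicRect d → (Fin d → ℝ) → ℂ} {ψ : DyadicRect d → Fin d → ℕ → ℝ → ℂ}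

theorem HasAtoms.enorm_pairing_le (h : HasAtoms B φ ψ) {f : (Fin d → ℝ) → ℂ}
    (hf : IsSumBounded f) (R : DyadicRect d) :
    ‖pairing f (φ R)‖ₑ ≤ ∑' m : Fin d → ℕ, ‖pairing f (tensor fun i => ψ R i (m i))‖ₑ :=
  enorm_pairing_le_tsum_atoms (h.atom R) (h.hasSum R) hf

/-- The square function in `L^p`. -/
theorem exists_lintegral_squareFunction_rpow_le (d : ℕ) (B : ℝ≥0) {p : ℝ} (hp : 1 < p) :
    ∃ C : ℝ≥0∞, C ≠ ∞ ∧ ∀ (φ : DyadicRect d → (Fin d → ℝ) → ℂ) ψ, HasAtoms B φ ψ →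
      ∀ f : (Fin d → ℝ) → ℂ, MemLp f (ENNReal.ofReal p) →
        ∫⁻ x, squareFunction φ f x ^ p ≤ C * ∫⁻ x, ‖f x‖ₑ ^ p := by
  have hp0 : 0 < p := by linarith
  obtain ⟨C, hC, hCb⟩ := exists_lintegral_atoms_rpow_le d B hp
  refine ⟨C * (geomConst 1 ^ d) ^ p, ENNReal.mul_ne_top hC (ENNReal.rpow_ne_top_of_nonneg hp0.le
    (ENNReal.pow_ne_top (geomConst_lt_top one_pos).ne)), fun φ ψ h f hf => ?_⟩
  have hfs : IsSumBounded f := by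
    refine isSumBounded_of_memLp ?_ hf
    rw [← ENNReal.ofReal_one]
    exact ENNReal.ofReal_le_ofReal hp.le
  calc ∫⁻ x, squareFunction φ f x ^ p
      ≤ ∫⁻ x, (∑' m : Fin d → ℕ,
          seqSquare (fun R => ‖pairing f (tensor fun i => ψ R i (m i))‖ₑ) x) ^ p :=
        lintegral_mono fun x => ENNReal.rpow_le_rpow
          ((seqSquare_mono (h.enorm_pairing_le hfs) x).trans (seqSquare_tsum_le _ x)) hp0.le
    _ ≤ (∑' m : Fin d → ℕ, (∫⁻ x, seqSquare
          (fun R => ‖pairing f (tensor fun i => ψ R i (m i))‖ₑ) x ^ p) ^ (1 / p)) ^ p :=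
        lintegral_tsum_rpow_le (fun m => measurable_seqSquare _) hp.le
    _ ≤ (∑' m : Fin d → ℕ, (C * ∫⁻ x, ‖f x‖ₑ ^ p) ^ (1 / p) * decay m) ^ p := by
        refine ENNReal.rpow_le_rpow (ENNReal.tsum_le_tsum fun m => ?_) hp0.le
        refine (ENNReal.rpow_le_rpow (hCb m (fun R i => ψ R i (m i))
          (fun R i => h.atom R i (m i)) f hf) (by positivity)).trans (le_of_eq ?_)
        rw [mul_right_comm, ENNReal.mul_rpow_of_nonneg _ (decay m ^ p) (by positivity),
          ← ENNReal.rpow_mul, mul_one_div_cancel hp0.ne', ENNReal.rpow_one]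
    _ = _ := by
        rw [ENNReal.tsum_mul_left, tsum_decay, ENNReal.mul_rpow_of_nonneg _ _ hp0.le,
          ← ENNReal.rpow_mul, one_div_mul_cancel hp0.ne', ENNReal.rpow_one]
        ring

/-- The square function on the dyadic product Hardy space. -/
theorem HasAtoms.lintegral_squareFunction_le (h : HasAtoms B φ ψ) {f : (Fin d → ℝ) → ℂ}
    (hf : Integrable f) (hS : ∫⁻ x, squareFunction DyadicRect.haar f x ≠ ∞) :
    ∫⁻ x, squareFunction φ f x ≤ hardyConst d (DyadicInterval.totalConst d B) * geomConst 1 *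
      ∫⁻ x, squareFunction DyadicRect.haar f x := by
  have hfs : IsSumBounded f := isSumBounded_of_memLp le_rfl (memLp_one_iff_integrable.2 hf)
  have hker : ∀ R : DyadicRect d, ‖pairing f (φ R)‖ₑ ≤
      kernelOp (fun R R' : DyadicRect d => ∑' m : Fin d → ℕ,
        ∏ i, DyadicInterval.nearKernel B (m i) (R i) (R' i))
        (fun R' => ‖pairing f R'.haar‖ₑ) R := by
    intro R
    rw [kernelOp_tsum_left fun (m : Fin d → ℕ) (R R' : DyadicRect d) =>
      ∏ i, DyadicInterval.nearKernel B (m i) (R i) (R' i)]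
    refine (h.enorm_pairing_le hfs R).trans (ENNReal.tsum_le_tsum fun m => ?_)
    exact enorm_pairing_tensor_le (fun i => h.atom R i (m i)) hf
  have hA := DyadicInterval.isAtomicallyBounded_tsum_nearKernel (d := d) B
  rw [squareFunction_eq] at hS ⊢
  rw [squareFunction_eq]
  exact (lintegral_mono fun x => seqSquare_mono hker x).trans
    (lintegral_seqSquare_kernelOp_le hA _ hS)

theorem decay_pow_three_mul_le (m : Fin d → ℕ) :
    decay m ^ 3 * (∏ i, 4 * (2 : ℝ≥0∞) ^ (m i : ℝ)) ^ (1 / 2 : ℝ) ≤ 4 ^ d * decay m := by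
  have h1 : (∏ i, 4 * (2 : ℝ≥0∞) ^ (m i : ℝ)) = 4 ^ d * (decay m)⁻¹ := by
    rw [decay_inv, Finset.prod_mul_distrib, Finset.prod_const, Finset.card_univ, Fintype.card_fin]
  have h2 : 1 ≤ (4 : ℝ≥0∞) ^ d * (decay m)⁻¹ :=
    one_le_mul (one_le_pow₀ (by norm_num)) (ENNReal.one_le_inv.2 (decay_le_one m))
  rw [h1]
  calc decay m ^ 3 * ((4 : ℝ≥0∞) ^ d * (decay m)⁻¹) ^ (1 / 2 : ℝ)
      ≤ decay m ^ 3 * ((4 : ℝ≥0∞) ^ d * (decay m)⁻¹) := by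
        refine mul_le_mul' le_rfl ?_
        conv_rhs => rw [← ENNReal.rpow_one ((4 : ℝ≥0∞) ^ d * (decay m)⁻¹)]
        exact ENNReal.rpow_le_rpow_of_exponent_le h2 (by norm_num)
    _ = 4 ^ d * (decay m ^ 2 * (decay m * (decay m)⁻¹)) := by ring
    _ = 4 ^ d * decay m ^ 2 := by
        rw [ENNReal.mul_inv_cancel (decay_ne_zero m) (decay_ne_top m), mul_one]
    _ ≤ 4 ^ d * decay m := by
        refine mul_le_mul' le_rfl ?_
        calc decay m ^ 2 ≤ decay m ^ 1 := pow_le_pow_right_of_le_one' (decay_le_one m) (by norm_num)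
          _ = decay m := pow_one _

/-- The Carleson estimate for bounded functions. -/
theorem exists_carlesonSup_le (d : ℕ) (B : ℝ≥0) :
    ∃ C : ℝ≥0∞, C ≠ ∞ ∧ ∀ (φ : DyadicRect d → (Fin d → ℝ) → ℂ) ψ, HasAtoms B φ ψ →
      ∀ f : (Fin d → ℝ) → ℂ, MemLp f ∞ →
        carlesonSup φ f ≤ C * eLpNorm f ∞ volume ^ 2 := by
  obtain ⟨C, hC, hCb⟩ := exists_localized_l2_le d
  refine ⟨(baseConst d B * C ^ (1 / 2 : ℝ) * 4 ^ d * geomConst 1 ^ d) ^ 2, ?_, ?_⟩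
  · refine ENNReal.pow_ne_top (ENNReal.mul_ne_top (ENNReal.mul_ne_top (ENNReal.mul_ne_top
      (baseConst_ne_top d B) (ENNReal.rpow_ne_top_of_nonneg (by norm_num) hC))
      (ENNReal.pow_ne_top (by norm_num))) (ENNReal.pow_ne_top (geomConst_lt_top one_pos).ne))
  intro φ ψ h f hf
  have hfs : IsSumBounded f := isSumBounded_of_memLp le_top hf
  set N := eLpNorm f ∞ volume with hN
  have hNf : ∀ᵐ x, ‖f x‖ₑ ≤ N := by
    rw [hN, eLpNorm_exponent_top]
    exact enorm_ae_le_eLpNormEssSup _ _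
  refine iSup₂_le fun U hU => ?_
  set S : Set (DyadicRect d) := {R | R.toSet ⊆ U} with hS
  -- The set `U` enters only through the countable union `V` of its rectangles, so outer measure
  -- suffices.
  set V := ⋃ R ∈ S, R.toSet with hV
  have hVU : volume V ≤ volume U := measure_mono (Set.iUnion₂_subset fun R hR => hR)
  have hVt : volume V < ∞ := hVU.trans_lt hU
  -- For bounded `f` the localized bound is the squared sup norm times the measure of the enlarged
  -- set; the root of the enlargement costs at most the inverse of `decay m`, against a third power
  -- available.
  have hloc : ∀ m : Fin d → ℕ,
      l2norm (S.indicator fun R => ‖pairing f (tensor fun i => ψ R i (m i))‖ₑ) ≤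
        baseConst d B * C ^ (1 / 2 : ℝ) * 4 ^ d * volume V ^ (1 / 2 : ℝ) * N * decay m := by
    intro m
    have hWt := volume_atomSpread_lt_top m hVt
    have hint : IntegrableOn f (atomSpread m S) := by
      have : Fact (volume (atomSpread m S) < ∞) := ⟨hWt⟩
      exact (hf.restrict _).integrable le_top
    have h1 := hCb B m (fun R i => ψ R i (m i)) (fun R i => h.atom R i (m i)) S f hint
    have h2 : ∫⁻ x in atomSpread m S, ‖f x‖ₑ ^ 2 ≤
        N ^ 2 * ((∏ i, 4 * (2 : ℝ≥0∞) ^ (m i : ℝ)) * volume V) := by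
      calc ∫⁻ x in atomSpread m S, ‖f x‖ₑ ^ 2 ≤ ∫⁻ _ in atomSpread m S, N ^ 2 :=
            lintegral_mono_ae ((ae_restrict_of_ae hNf).mono fun x hx => pow_le_pow_left' hx 2)
        _ = N ^ 2 * volume (atomSpread m S) := setLIntegral_const _ _
        _ ≤ _ := mul_le_mul' le_rfl (volume_atomSpread_le m S)
    have h3 : l2norm (S.indicator fun R => ‖pairing f (tensor fun i => ψ R i (m i))‖ₑ) ≤
        (orderConst B m ^ 2 * (C * (N ^ 2 *
          ((∏ i, 4 * (2 : ℝ≥0∞) ^ (m i : ℝ)) * volume V)))) ^ (1 / 2 : ℝ) := by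
      refine ENNReal.rpow_le_rpow ?_ (by norm_num)
      simp only [indicator_sq]
      exact h1.trans (mul_le_mul' le_rfl (mul_le_mul' le_rfl h2))
    have hh : (0 : ℝ) ≤ 1 / 2 := by norm_num
    calc _ ≤ _ := h3
      _ = baseConst d B * C ^ (1 / 2 : ℝ) * volume V ^ (1 / 2 : ℝ) * N *
          (decay m ^ 3 * (∏ i, 4 * (2 : ℝ≥0∞) ^ (m i : ℝ)) ^ (1 / 2 : ℝ)) := by
          rw [ENNReal.mul_rpow_of_nonneg _ _ hh, ENNReal.mul_rpow_of_nonneg _ _ hh,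
            ENNReal.mul_rpow_of_nonneg _ _ hh, ENNReal.mul_rpow_of_nonneg _ _ hh, sq_rpow_half,
            sq_rpow_half, orderConst_eq]
          ring
      _ ≤ baseConst d B * C ^ (1 / 2 : ℝ) * volume V ^ (1 / 2 : ℝ) * N * (4 ^ d * decay m) :=
          mul_le_mul' le_rfl (decay_pow_three_mul_le m)
      _ = _ := by ring
  have hsum : l2norm (S.indicator fun R => ‖pairing f (φ R)‖ₑ) ≤
      baseConst d B * C ^ (1 / 2 : ℝ) * 4 ^ d * volume V ^ (1 / 2 : ℝ) * N * geomConst 1 ^ d := by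
    calc l2norm (S.indicator fun R => ‖pairing f (φ R)‖ₑ)
        ≤ l2norm fun R => ∑' m : Fin d → ℕ,
            S.indicator (fun R => ‖pairing f (tensor fun i => ψ R i (m i))‖ₑ) R := by
          refine l2norm_mono fun R => ?_
          by_cases hR : R ∈ S
          · simp only [Set.indicator_of_mem hR]
            exact h.enorm_pairing_le hfs R
          · rw [Set.indicator_of_notMem hR]
            exact zero_le
      _ ≤ ∑' m : Fin d → ℕ,
            l2norm (S.indicator fun R => ‖pairing f (tensor fun i => ψ R i (m i))‖ₑ) :=
          l2norm_tsum_le _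
      _ ≤ _ := ENNReal.tsum_le_tsum hloc
      _ = _ := by rw [ENNReal.tsum_mul_left, tsum_decay]
  have hsq : ∑' R : {R : DyadicRect d // R.toSet ⊆ U}, ‖pairing f (φ R.1)‖ₑ ^ 2 ≤
      volume V * ((baseConst d B * C ^ (1 / 2 : ℝ) * 4 ^ d * geomConst 1 ^ d) ^ 2 * N ^ 2) := by
    have h1 := pow_le_pow_left' hsum 2
    rw [l2norm_sq] at h1
    simp only [indicator_sq] at h1
    rw [← tsum_subtype S fun R => ‖pairing f (φ R)‖ₑ ^ 2] at h1
    refine h1.trans (le_of_eq ?_)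
    calc _ = (volume V ^ (1 / 2 : ℝ)) ^ 2 *
          ((baseConst d B * C ^ (1 / 2 : ℝ) * 4 ^ d * geomConst 1 ^ d) ^ 2 * N ^ 2) := by ring
      _ = _ := by rw [rpow_half_sq]
  refine (mul_le_mul' le_rfl (hsq.trans (mul_le_mul' hVU le_rfl))).trans ?_
  rw [← mul_assoc]
  -- This includes `volume U = 0`, where the product `∞ * 0` is 0.
  exact mul_le_of_le_one_left' (ENNReal.inv_mul_le_one _)

end Atoms

end MultiParam
-- The three estimates
theorem lemma4p2 (d : ℕ) :
    ∃ N : ℕ, 2 ≤ N ∧ ∀ K : ℝ,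
      -- boundedness on `L^p`, `1 < p < ∞`
      (∀ p : ℝ≥0∞, 1 < p → p < ∞ → ∃ C : ℝ≥0,
        ∀ φ : MultiParam.DyadicRect d → (Fin d → ℝ) → ℂ,
          (∀ R, MultiParam.IsAdaptedRect K N R (φ R)) →
          (∀ R j, MultiParam.HasZero j (φ R)) →
          ∀ f : (Fin d → ℝ) → ℂ, MemLp f p volume →
            eLpNorm (MultiParam.squareFunction φ f) p volume ≤ C * eLpNorm f p volume) ∧
      -- boundedness from `H^1` to `L^1`
      (∃ C : ℝ≥0,
        ∀ φ : MultiParam.DyadicRect d → (Fin d → ℝ) → ℂ,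
          (∀ R, MultiParam.IsAdaptedRect K N R (φ R)) →
          (∀ R j, MultiParam.HasZero j (φ R)) →
          ∀ f : (Fin d → ℝ) → ℂ, MemLp f 1 volume → MultiParam.hardyNorm f < ∞ →
            eLpNorm (MultiParam.squareFunction φ f) 1 volume ≤ C * MultiParam.hardyNorm f) ∧
      -- the Carleson estimate for bounded functions, over all sets of finite measure
      (∃ C : ℝ≥0,
        ∀ φ : MultiParam.DyadicRect d → (Fin d → ℝ) → ℂ,
          (∀ R, MultiParam.IsAdaptedRect K N R (φ R)) →
          (∀ R j, MultiParam.HasZero j (φ R)) →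
          ∀ f : (Fin d → ℝ) → ℂ, MemLp f ∞ volume →
            MultiParam.carlesonSup φ f ≤ C * eLpNorm f ∞ volume ^ 2) := by
  -- The exponent 21 is what `exists_local_atoms` needs to produce decay $2^{-20m}$; the resulting
  -- constants do not depend on the family.
  refine ⟨21, by norm_num, fun K => ⟨fun p hp1 hpt => ?_, ?_, ?_⟩⟩
  · have hp : 1 < p.toReal := by
      rw [← ENNReal.toReal_one]
      exact (ENNReal.toReal_lt_toReal ENNReal.one_ne_top hpt.ne).2 hp1
    have hp0 : 0 < p.toReal := by linarith
    obtain ⟨C, hC, hCb⟩ := MultiParam.exists_lintegral_squareFunction_rpow_le d (2 ^ 23 * ‖K‖₊) hp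
    refine ⟨(C ^ (1 / p.toReal)).toNNReal, fun φ hφ hz f hf => ?_⟩
    obtain ⟨ψ, hψ⟩ := MultiParam.exists_hasAtoms hφ hz
    have h := hCb φ ψ hψ f (by rwa [ENNReal.ofReal_toReal hpt.ne])
    have hp0' : p ≠ 0 := (one_pos.trans hp1).ne'
    rw [ENNReal.coe_toNNReal (ENNReal.rpow_ne_top_of_nonneg (by positivity) hC),
      eLpNorm_eq_lintegral_rpow_enorm_toReal hp0' hpt.ne,
      eLpNorm_eq_lintegral_rpow_enorm_toReal hp0' hpt.ne,
      ← ENNReal.mul_rpow_of_nonneg _ _ (by positivity)]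
    simp only [enorm_eq_self]
    exact ENNReal.rpow_le_rpow h (by positivity)
  · set C := MultiParam.hardyConst d (MultiParam.DyadicInterval.totalConst d (2 ^ 23 * ‖K‖₊)) *
      MultiParam.geomConst 1 with hCdef
    have hC : C ≠ ∞ := (ENNReal.mul_lt_top (ENNReal.mul_lt_top
      (MultiParam.DyadicInterval.totalConst_lt_top _ _)
      (ENNReal.mul_lt_top (by norm_num) (MultiParam.coverConst_lt_top d)))
      (MultiParam.geomConst_lt_top one_pos)).ne
    refine ⟨C.toNNReal, fun φ hφ hz f hf hfH => ?_⟩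
    obtain ⟨ψ, hψ⟩ := MultiParam.exists_hasAtoms hφ hz
    have hS : ∫⁻ x, MultiParam.squareFunction MultiParam.DyadicRect.haar f x ≤
        MultiParam.hardyNorm f := by
      unfold MultiParam.hardyNorm
      simp only [eLpNorm_one_eq_lintegral_enorm, enorm_eq_self]
      exact le_add_self
    rw [ENNReal.coe_toNNReal hC, eLpNorm_one_eq_lintegral_enorm]
    simp only [enorm_eq_self]
    exact (hψ.lintegral_squareFunction_le (memLp_one_iff_integrable.1 hf)
      (hS.trans_lt hfH).ne).trans (mul_le_mul' le_rfl hS)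
  · obtain ⟨C, hC, hCb⟩ := MultiParam.exists_carlesonSup_le d (2 ^ 23 * ‖K‖₊)
    refine ⟨C.toNNReal, fun φ hφ hz f hf => ?_⟩
    obtain ⟨ψ, hψ⟩ := MultiParam.exists_hasAtoms hφ hz
    rw [ENNReal.coe_toNNReal hC]
    exact hCb φ ψ hψ f hf
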